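/- **Setting.** Let $\mathcal K=L^2(\mathbb R^3,d^3k)$, let $\omega(\vec k)=|\vec k|$, let $\mathcal H$ be the bosonic Fock space over $\mathcal K$, and let $W(v)\in\mathcal B(\mathcal H)$, $v\in\mathcal K$, be the Weyl operators, normalised so that $W(u)W(v)=e^{-\frac i2\mathrm{Im}\langle u,v\rangle}W(u+v)$ and $\langle\Omega,W(v)\Omega\rangle=e^{-\frac14\|v\|^2}$ for the Fock vacuum $\Omega$. For open $O\subset\mathbb R^3$ let $\mathcal D_{\mathbb R}(O)$ be the real-valued smooth functions with compact support in $O$, and write $\hat h(\vec k)=\int e^{-i\vec k\vec x}h(\vec x)\,d^3x$. If $\mathcal O$ is the causal completion of an open ball $O$ at time $0$, put $\mathcal L(\mathcal O)=\omega^{-1/2}\widehat{\mathcal D_{\mathbb R}(O)}+i\omega^{1/2}\widehat{\mathcal D_{\mathbb R}(O)}\subset\mathcal K$. For all other open double cones $\mathcal O$ in Minkowski space define $\mathcal L(\mathcal O)$ by translation covariance (time translations act by $e^{i\omega t}$) and additivity. Let $\mathcal L=\bigcup_{\mathcal O}\mathcal L(\mathcal O)$, let $\mathfrak A(\mathcal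 O)=\{W(f):f\in\mathcal L(\mathcal O)\}''$, and let $\mathfrak A$ be the C$^*$-algebra generated by all the $\mathfrak A(\mathcal O)$. A map on $\mathfrak A$ is called locally normal if its restriction to each $\mathfrak A(\mathcal O)$ is ultraweakly continuous. Let $\pi_0$ be the identical representation of $\mathfrak A$ on $\mathcal H$. Two representations $\pi,\rho$ of $\mathfrak A$ on $\mathcal H$ are unitarily equivalent, $\pi\cong\rho$, if $U\pi(A)U^*=\rho(A)$ for all $A\in\mathfrak A$, for some unitary $U$. **Charges.** Let $\mathcal L_\Gamma=\omega^{-1/2}\widehat{\mathcal D_{\mathbb R}(\mathbb R^3)}+i\omega^{-3/2}\widehat{\mathcal D_{\mathbb R}(\mathbb R^3)}$. Each $\gamma\in\mathcal L_\Gamma$ determines an automorphism of $\mathfrak A$, again denoted by $\gamma$, namely the locally normal one with $\gamma(W(f))=e^{il_\gamma(f)}W(f)$ for $f\in\mathcal L$, where $l_\gamma(f)=-\mathrm{Im}\int\overline{\gamma(\vec k)}f(\vec k)\,d^3k$. **KPR-like infravacua.** Let $(\Gamma v)(\vec k)=\overline{v(-\vec k)}$, and for $\epsilon>0$ let $P_\epsilon$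 be the orthogonal projection of $\mathcal K$ onto the functions that vanish for $|\vec k|<\epsilon$. Let $i$ run through $1,2,\dots$, and let * $\epsilon_i>0$ be strictly decreasing with $\epsilon_i\to0$, and $P_i=P_{\epsilon_{i+1}}-P_{\epsilon_i}$; * $Q_i$ be orthogonal projections of finite rank in $\mathcal K$ with $Q_i\Gamma=\Gamma Q_i$ and $Q_iP_i=Q_i$; * $b_i\in\,]0,1[$ with $b_i\to0$ and $\sum_i\frac{\epsilon_i}{b_i^2}\operatorname{rk}Q_i<\infty$. Put $T_1=1+\sum_i(b_i-1)Q_i$ on $\mathcal K$ and $T_2=1+\sum_i(\frac1{b_i}-1)Q_i$ on $\omega_r^{1/2}\mathcal K$, where $\omega_r=\min(\omega,\epsilon_1)$, and $T=T_2\frac{1+\Gamma}2+T_1\frac{1-\Gamma}2$ on $\{v\in\mathcal K:\frac{1+\Gamma}2v\in\omega_r^{1/2}\mathcal K\}\supset\mathcal L$. Let $\pi_T$ be the locally normal representation of $\mathfrak A$ on $\mathcal H$ with $\pi_T(W(f))=W(Tf)$ for $f\in\mathcal L$. It is called a KPR-like infravacuum representation if, in addition, $(\ln\frac{\epsilon_i}{\epsilon_{i+1}})_i$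 is polynomially bounded, $\sum_ib_i^2\ln\frac{\epsilon_i}{\epsilon_{i+1}}<\infty$, and, for all $i$, $Q_i$ is the orthogonal projection onto the span of the functions equal to $|\vec k|^{-3/2}Y_{lm}(\vec k/|\vec k|)$ for $\epsilon_{i+1}\le|\vec k|\le\epsilon_i$ and to $0$ elsewhere, where $0<l\le i$, $-l\le m\le l$, and $Y_{lm}$ are the spherical harmonics. **Lemma 3.6.** Let $\pi_T$ be a KPR-like infravacuum representation. Then, for any $\gamma_1,\gamma_2\in\mathcal L_\Gamma$, $$\pi_0\circ\gamma_1\cong\pi_0\circ\gamma_2\quad\text{iff}\quad\pi_T\circ\gamma_1\cong\pi_T\circ\gamma_2 .$$ -/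

import Mathlib

open MeasureTheory Complex
open scoped InnerProductSpace ENNReal ContDiff Topology ComplexConjugate

noncomputable section
/-- Euclidean three-space, used both for positions and for momenta. -/
abbrev R3 : Type := EuclideanSpace ℝ (Fin 3)
/-- The one-particle space `L²(ℝ³, d³k)` of momentum space wave functions. -/
abbrev OneParticle : Type := Lp ℂ 2 (volume : Measure R3)

/-- `L²((ℝ³)ⁿ)`, i.e. the `n`-fold Hilbert space tensor power of the one-particle space. -/
abbrev NParticle (n : ℕ) : Type := Lp ℂ 2 (volume : Measure (Fin n → R3))

/-- The full Fock space, the Hilbert space direct sum of all the `L²((ℝ³)ⁿ)`. -/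
abbrev FullFock : Type := lp NParticle 2

theorem memLp_tensorPower (v : OneParticle) (n : ℕ) :
    MemLp (fun k : Fin n → R3 => ∏ j, v (k j)) 2 volume := by
  have hv : MemLp v 2 (volume : Measure R3) := Lp.memLp v
  have hm : AEStronglyMeasurable (fun k : Fin n → R3 => ∏ j, v (k j)) volume := by
    refine Finset.aestronglyMeasurable_fun_prod _ fun j _ => ?_
    exact hv.1.comp_quasiMeasurePreserving (Measure.quasiMeasurePreserving_eval _ j)
  rw [memLp_two_iff_integrable_sq_norm hm]
  have h := Integrable.fintype_prod (ι := Fin n) (f := fun _ (k : R3) => ‖v k‖ ^ 2)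
    (μ := fun _ => volume) fun _ => (memLp_two_iff_integrable_sq_norm hv.1).1 hv
  simpa [norm_prod, Finset.prod_pow, volume_pi] using h

/-- The tensor power `v ⊗ ⋯ ⊗ v`, i.e. the function `(k₁,…,kₙ) ↦ v(k₁) ⋯ v(kₙ)`. -/
def tensorPower (v : OneParticle) (n : ℕ) : NParticle n := (memLp_tensorPower v n).toLp _

theorem coeFn_tensorPower (v : OneParticle) (n : ℕ) :
    tensorPower v n =ᵐ[volume] fun k => ∏ j, v (k j) := MemLp.coeFn_toLp _

theorem inner_tensorPower (u v : OneParticle) (n : ℕ) :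
    ⟪tensorPower u n, tensorPower v n⟫_ℂ = ⟪u, v⟫_ℂ ^ n := by
  rw [L2.inner_def, L2.inner_def]
  have h := integral_fintype_prod_volume_eq_pow (ι := Fin n) (fun k : R3 => ⟪u k, v k⟫_ℂ)
  rw [Fintype.card_fin] at h
  rw [← h]
  refine integral_congr_ae ?_
  filter_upwards [coeFn_tensorPower u n, coeFn_tensorPower v n] with k h1 h2
  simp [h1, h2, Finset.prod_mul_distrib]

theorem norm_tensorPower (v : OneParticle) (n : ℕ) : ‖tensorPower v n‖ = ‖v‖ ^ n := by
  have h := inner_tensorPower v v n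
  rw [inner_self_eq_norm_sq_to_K, inner_self_eq_norm_sq_to_K] at h
  have h2 : ‖tensorPower v n‖ ^ 2 = (‖v‖ ^ n) ^ 2 := by
    rw [← pow_mul, mul_comm n, pow_mul]; exact_mod_cast h
  exact (pow_left_inj₀ (norm_nonneg _) (by positivity) two_ne_zero).1 h2

theorem tensorPower_smul (z : ℂ) (v : OneParticle) (n : ℕ) :
    tensorPower (z • v) n = z ^ n • tensorPower v n := by
  refine Lp.ext ?_
  have hq : ∀ j : Fin n, ∀ᵐ k : Fin n → R3, (z • v : OneParticle) (k j) = z • v (k j) := fun j =>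
    (Measure.quasiMeasurePreserving_eval (μ := fun _ : Fin n => (volume : Measure R3)) j).ae
      (p := fun x => (z • v : OneParticle) x = z • v x) (Lp.coeFn_smul z v)
  filter_upwards [coeFn_tensorPower (z • v) n, coeFn_tensorPower v n,
    Lp.coeFn_smul (z ^ n) (tensorPower v n), ae_all_iff.2 hq] with k h1 h2 h3 h4
  simp [h1, h2, h3, h4, Finset.prod_mul_distrib]

/-- The symmetric tensor power, as the closed linear span of all the powers `v ⊗ ⋯ ⊗ v`; by
polarisation this is the space of all permutation invariant functions in `L²((ℝ³)ⁿ)`. -/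
def symPower (n : ℕ) : Submodule ℂ (NParticle n) :=
  (Submodule.span ℂ (Set.range fun v => tensorPower v n)).topologicalClosure

/-- The bosonic Fock space as a subspace of the full Fock space: each `n`-particle component is
a symmetric tensor. -/
def fockSubspace : Submodule ℂ FullFock where
  carrier := {ψ | ∀ n, ψ n ∈ symPower n}
  add_mem' ha hb n := (symPower n).add_mem (ha n) (hb n)
  zero_mem' n := (symPower n).zero_mem
  smul_mem' z _ ha n := (symPower n).smul_mem z (ha n)

theorem isClosed_fockSubspace : IsClosed (fockSubspace : Set FullFock) := by
  have : (fockSubspace : Set FullFock) = ⋂ n, (fun ψ : FullFock => ψ n) ⁻¹' (symPower n) := by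
    ext ψ
    simp only [Set.mem_iInter, Set.mem_preimage]
    rfl
  rw [this]
  refine isClosed_iInter fun n => IsClosed.preimage ?_ ?_
  · exact (lp.evalCLM ℂ NParticle 2 n).continuous
  · exact Submodule.isClosed_topologicalClosure _

/-- The bosonic Fock space over the one-particle space (the vacuum Hilbert space). -/
def Fock : Type := fockSubspace

instance : NormedAddCommGroup Fock := inferInstanceAs (NormedAddCommGroup fockSubspace)
instance : InnerProductSpace ℂ Fock := inferInstanceAs (InnerProductSpace ℂ fockSubspace)
instance : CompleteSpace Fock := isClosed_fockSubspace.completeSpace_coe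




/-- The component of degree `n` of the exponential vector of `v`: `v ⊗ ⋯ ⊗ v / √n!`. -/
def expComponent (v : OneParticle) (n : ℕ) : NParticle n :=
  ((Real.sqrt (n.factorial : ℝ))⁻¹ : ℂ) • tensorPower v n

theorem inner_expComponent (u v : OneParticle) (n : ℕ) :
    ⟪expComponent u n, expComponent v n⟫_ℂ = ⟪u, v⟫_ℂ ^ n / (n.factorial : ℂ) := by
  have h : ((Real.sqrt (n.factorial : ℝ) : ℂ)) * (Real.sqrt (n.factorial : ℝ) : ℂ)
      = (n.factorial : ℂ) := by
    rw [← Complex.ofReal_mul, Real.mul_self_sqrt (by positivity)]; simp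
  rw [expComponent, expComponent, inner_smul_left, inner_smul_right, inner_tensorPower, ← h]
  simp only [map_inv₀, Complex.conj_ofReal]
  field_simp

theorem memℓp_expComponent (v : OneParticle) : Memℓp (expComponent v) 2 := by
  refine memℓp_gen ?_
  have h := Real.summable_pow_div_factorial (‖v‖ ^ 2)
  refine h.congr fun n => ?_
  have h2 : (‖expComponent v n‖ : ℂ) ^ 2 = ((‖v‖ ^ 2) ^ n / (n.factorial : ℝ) : ℝ) := by
    have h3 := inner_expComponent v v n
    rw [inner_self_eq_norm_sq_to_K, inner_self_eq_norm_sq_to_K] at h3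
    push_cast
    exact h3
  have h4 : ‖expComponent v n‖ ^ 2 = (‖v‖ ^ 2) ^ n / (n.factorial : ℝ) := by exact_mod_cast h2
  simp [h4]

/-- The exponential (coherent) vector `⊕ₙ v ⊗ ⋯ ⊗ v / √n!`. -/
def expVec (v : OneParticle) : Fock :=
  ⟨⟨expComponent v, memℓp_expComponent v⟩, fun n => (symPower n).smul_mem _
    (Submodule.le_topologicalClosure _ (Submodule.subset_span ⟨v, rfl⟩))⟩

theorem inner_expVec (u v : OneParticle) :
    ⟪expVec u, expVec v⟫_ℂ = Complex.exp ⟪u, v⟫_ℂ := by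
  have h : HasSum (fun n => ⟪expComponent u n, expComponent v n⟫_ℂ)
      ⟪(expVec u).1, (expVec v).1⟫_ℂ := lp.hasSum_inner _ _
  have h2 := NormedSpace.expSeries_div_hasSum_exp (⟪u, v⟫_ℂ)
  rw [← Complex.exp_eq_exp_ℂ] at h2
  refine HasSum.unique h (h2.congr_fun ?_)
  intro n
  exact (inner_expComponent u v n)

theorem denseRange_linearCombination_expVec :
    DenseRange (Finsupp.linearCombination ℂ expVec) := by
  have key : ∀ ψ : Fock, (∀ u, ⟪expVec u, ψ⟫_ℂ = 0) → ψ = 0 := by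
    intro ψ hψ
    have h0 : ∀ (u : OneParticle) (n : ℕ), ⟪tensorPower u n, (ψ.1 : FullFock) n⟫_ℂ = 0 := by
      intro u
      let p : FormalMultilinearSeries ℂ ℂ ℂ := fun n =>
        ContinuousMultilinearMap.mkPiRing ℂ (Fin n) ⟪expComponent u n, (ψ.1 : FullFock) n⟫_ℂ
      have hp : HasFPowerSeriesAt (0 : ℂ → ℂ) p 0 := by
        rw [hasFPowerSeriesAt_iff]
        refine Filter.Eventually.of_forall fun z => ?_
        have h : HasSum (fun n => ⟪expComponent (starRingEnd ℂ z • u) n, (ψ.1 : FullFock) n⟫_ℂ)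
          ⟪(expVec (starRingEnd ℂ z • u)).1, (ψ.1 : FullFock)⟫_ℂ := lp.hasSum_inner _ _
        have h1 : ⟪(expVec (starRingEnd ℂ z • u)).1, (ψ.1 : FullFock)⟫_ℂ = 0 :=
          hψ (starRingEnd ℂ z • u)
        rw [h1] at h
        refine h.congr_fun fun n => ?_
        simp only [p, FormalMultilinearSeries.coeff, expComponent, tensorPower_smul]
        simp [inner_smul_left]
        ring
      have hp0 := hp.eq_zero
      intro n
      have h1 : ⟪expComponent u n, (ψ.1 : FullFock) n⟫_ℂ = 0 := by
        have := congrArg (fun q : FormalMultilinearSeries ℂ ℂ ℂ => q.coeff n) hp0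
        simpa [p, FormalMultilinearSeries.coeff] using this
      rw [expComponent, inner_smul_left] at h1
      refine (mul_eq_zero.1 h1).resolve_left ?_
      simp [Nat.factorial_ne_zero]
    have h1 : ∀ n, (ψ.1 : FullFock) n = 0 := by
      intro n
      have hmem : (ψ.1 : FullFock) n ∈ symPower n := ψ.2 n
      have hperp : (ψ.1 : FullFock) n ∈ (Submodule.span ℂ
          (Set.range fun v => tensorPower v n))ᗮ := by
        rw [Submodule.mem_orthogonal]
        intro x hx
        induction hx using Submodule.span_induction with
        | mem x hx => obtain ⟨u, rfl⟩ := hx; exact h0 u n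
        | zero => simp
        | add x y _ _ hx hy => rw [inner_add_left, hx, hy, add_zero]
        | smul a x _ hx => rw [inner_smul_left, hx, mul_zero]
      rw [← Submodule.orthogonal_closure] at hperp
      exact inner_self_eq_zero.1 (Submodule.inner_right_of_mem_orthogonal hmem hperp)
    exact Subtype.ext (lp.ext (funext h1))
  have h2 : (LinearMap.range (Finsupp.linearCombination ℂ expVec)).topologicalClosure = ⊤ := by
    rw [Submodule.topologicalClosure_eq_top_iff, Submodule.eq_bot_iff]
    intro ψ hψ
    refine key ψ fun u => ?_
    exact (Submodule.mem_orthogonal _ _).1 hψ _ ⟨Finsupp.single u 1, by simp⟩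
  have h3 := (Submodule.dense_iff_topologicalClosure_eq_top).2 h2
  exact h3

/-- The value of the Weyl operator `W(f)` on the exponential vector `e(u)`, namely
`exp(-‖f‖²/4 + i⟨f,u⟩/√2) e(u + i f/√2)`. -/
def weylOnExp (f u : OneParticle) : Fock :=
  Complex.exp (-(‖f‖ ^ 2 / 4 : ℝ) + (I / (Real.sqrt 2 : ℝ)) * ⟪f, u⟫_ℂ) •
    expVec (u + (I / (Real.sqrt 2 : ℝ)) • f)

theorem inner_weylOnExp (f u v : OneParticle) :
    ⟪weylOnExp f u, weylOnExp f v⟫_ℂ = ⟪expVec u, expVec v⟫_ℂ := by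
  have h2 : ((Real.sqrt 2 : ℝ) : ℂ) ^ 2 = 2 := by
    rw [← Complex.ofReal_pow, Real.sq_sqrt (by norm_num)]; norm_num
  have h0 : ((Real.sqrt 2 : ℝ) : ℂ) ≠ 0 := by
    intro h; rw [h] at h2; norm_num at h2
  have hnn : ∀ x : OneParticle, ⟪x, x⟫_ℂ = ((‖x‖ : ℝ) : ℂ) ^ 2 := fun x => inner_self_eq_norm_sq_to_K x
  simp only [weylOnExp, inner_smul_left, inner_smul_right, inner_expVec, ← Complex.exp_conj,
    ← Complex.exp_add]
  congr 1
  simp only [inner_add_left, inner_add_right, inner_smul_left, inner_smul_right,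
    hnn, map_add, map_mul, map_neg, Complex.conj_ofReal, map_div₀,
    Complex.conj_I, inner_conj_symm]
  push_cast
  field_simp
  ring_nf
  simp only [h2, Complex.I_sq]
  ring

/-- The Weyl operator `W(f)` (equal to `exp (i (a(f) + a*(f))/√2)`): the unique bounded operator
with the prescribed values on the exponential vectors, whose linear span is dense. See
`weyl_expVec`, `weyl_mul_weyl`. -/
def weyl (f : OneParticle) : Fock →L[ℂ] Fock :=
  (Finsupp.linearCombination ℂ (weylOnExp f)).extendOfNorm (Finsupp.linearCombination ℂ expVec)

theorem norm_weyl_aux (f : OneParticle) (a : OneParticle →₀ ℂ) :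
    ‖Finsupp.linearCombination ℂ (weylOnExp f) a‖ = ‖Finsupp.linearCombination ℂ expVec a‖ := by
  have h : ⟪Finsupp.linearCombination ℂ (weylOnExp f) a,
      Finsupp.linearCombination ℂ (weylOnExp f) a⟫_ℂ =
      ⟪Finsupp.linearCombination ℂ expVec a, Finsupp.linearCombination ℂ expVec a⟫_ℂ := by
    simp only [Finsupp.linearCombination_apply, Finsupp.sum, sum_inner, inner_sum,
      inner_smul_left, inner_smul_right, inner_weylOnExp]
  rw [inner_self_eq_norm_sq_to_K, inner_self_eq_norm_sq_to_K] at h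
  have h' : ‖Finsupp.linearCombination ℂ (weylOnExp f) a‖ ^ 2 =
    ‖Finsupp.linearCombination ℂ expVec a‖ ^ 2 := by exact_mod_cast h
  exact (pow_left_inj₀ (norm_nonneg _) (norm_nonneg _) two_ne_zero).1 h'

theorem weyl_expVec (f u : OneParticle) : weyl f (expVec u) = weylOnExp f u := by
  have h := LinearMap.extendOfNorm_eq (f := Finsupp.linearCombination ℂ (weylOnExp f))
    denseRange_linearCombination_expVec
    ⟨1, fun a => by rw [one_mul]; exact (norm_weyl_aux f a).le⟩ (Finsupp.single u 1)
  simpa [weyl] using h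

/-- The Weyl relations `W(f) W(g) = exp(-(i/2) Im⟨f,g⟩) W(f+g)`. -/
theorem weyl_mul_weyl (f g : OneParticle) :
    weyl f * weyl g = Complex.exp (-(I / 2) * (⟪f, g⟫_ℂ).im) • weyl (f + g) := by
  have h2 : ((Real.sqrt 2 : ℝ) : ℂ) ^ 2 = 2 := by
    rw [← Complex.ofReal_pow, Real.sq_sqrt (by norm_num)]; norm_num
  have h0 : ((Real.sqrt 2 : ℝ) : ℂ) ≠ 0 := by
    intro h; rw [h] at h2; norm_num at h2
  have hext : ∀ A B : Fock →L[ℂ] Fock, (∀ u, A (expVec u) = B (expVec u)) → A = B := by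
    intro A B hAB
    refine ContinuousLinearMap.coeFn_injective
      (denseRange_linearCombination_expVec.equalizer A.continuous B.continuous ?_)
    funext a
    simp [Finsupp.linearCombination_apply, Finsupp.sum, hAB]
  refine hext _ _ fun u => ?_
  have hnn : ∀ x : OneParticle, ⟪x, x⟫_ℂ = ((‖x‖ : ℝ) : ℂ) ^ 2 := fun x => inner_self_eq_norm_sq_to_K x
  have hn : ((‖f + g‖ : ℝ) : ℂ) ^ 2 = ‖f‖ ^ 2 + ‖g‖ ^ 2 + ⟪f, g⟫_ℂ + ⟪g, f⟫_ℂ := by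
    have := hnn (f + g)
    rw [inner_add_left, inner_add_right, inner_add_right, hnn, hnn] at this
    rw [← this]; ring
  have him : ((⟪f, g⟫_ℂ).im : ℂ) = (⟪f, g⟫_ℂ - ⟪g, f⟫_ℂ) / (2 * I) := by
    rw [Complex.im_eq_sub_conj, inner_conj_symm]
  rw [mul_apply_eq_comp, weyl_expVec, weylOnExp, map_smul, weyl_expVec, weylOnExp,
    smul_apply, weyl_expVec, weylOnExp, smul_smul, smul_smul,
    ← Complex.exp_add, ← Complex.exp_add]
  have hv : u + (I / (Real.sqrt 2 : ℝ)) • g + (I / (Real.sqrt 2 : ℝ)) • f =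
    u + (I / (Real.sqrt 2 : ℝ)) • (f + g) := by rw [smul_add]; abel
  rw [hv]
  congr 2
  rw [him]
  push_cast
  rw [hn]
  simp only [inner_add_left, inner_add_right, inner_smul_right]
  field_simp
  ring_nf
  simp only [h2, Complex.I_sq]
  ring

theorem weyl_zero : weyl 0 = 1 := by
  refine ContinuousLinearMap.coeFn_injective
    (denseRange_linearCombination_expVec.equalizer (weyl 0).continuous continuous_id ?_)
  funext a
  simp [Finsupp.linearCombination_apply, Finsupp.sum, weyl_expVec, weylOnExp]

/-! ### The net of local algebras -/

/-- The open forward light cone in Minkowski space `ℝ × ℝ³` (time first). -/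
def forwardCone : Set (ℝ × R3) := {x | ‖x.2‖ < x.1}

/-- For `b - a` in the forward cone this is the open double cone with past apex `a` and future
apex `b`. The causal completion of the open ball of radius `r` about `c` at time `t` is
`doubleCone (t - r, c) (t + r, c)`. -/
def doubleCone (a b : ℝ × R3) : Set (ℝ × R3) :=
  {x | x - a ∈ forwardCone ∧ b - x ∈ forwardCone}

def IsDoubleCone (O : Set (ℝ × R3)) : Prop :=
  ∃ a b : ℝ × R3, b - a ∈ forwardCone ∧ O = doubleCone a b

/-- The real-valued smooth functions with compact support contained in `U`. -/
def testFunctions (U : Set R3) : Set (R3 → ℝ) :=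
  {h | ContDiff ℝ ∞ h ∧ HasCompactSupport h ∧ tsupport h ⊆ U}

/-- The Fourier transform `ĥ(k) = ∫ e^{-ikx} h(x) d³x`, so that `ĥ(0) = ∫ h`. -/
def fourierHat (h : R3 → ℝ) (k : R3) : ℂ :=
  ∫ x : R3, Complex.exp (-I * (⟪k, x⟫_ℝ : ℝ)) * (h x : ℂ)

/-- The function `ω^s`, where `ω(k) = |k|`. -/
def omegaPow (s : ℝ) (k : R3) : ℂ := ((‖k‖ ^ s : ℝ) : ℂ)

/-- The symplectic space `ℒ(O)`. For the causal completion of a ball at time zero it consists of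
the vectors `ω^{-1/2} ĥ + i ω^{1/2} ĝ`, with real test functions `h`, `g` supported in the ball; for
balls at time `t` these vectors are translated with `e^{iωt}`, and general regions are reached by
additivity. -/
def localSpace (O : Set (ℝ × R3)) : Submodule ℝ OneParticle :=
  Submodule.span ℝ {f | ∃ (t : ℝ) (c : R3) (r : ℝ), 0 < r ∧
    doubleCone (t - r, c) (t + r, c) ⊆ O ∧
    ∃ h ∈ testFunctions (Metric.ball c r), ∃ g ∈ testFunctions (Metric.ball c r),
      f =ᵐ[volume] fun k => Complex.exp (I * ((‖k‖ * t : ℝ) : ℂ)) *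
        (omegaPow (-1 / 2) k * fourierHat h k + I * omegaPow (1 / 2) k * fourierHat g k)}

/-- The space `ℒ`, the union of the spaces `ℒ(O)` of all double cones. -/
def observableSpace : Set OneParticle := {f | ∃ O, IsDoubleCone O ∧ f ∈ localSpace O}

/-- The bounded operators on the Fock space. -/
abbrev BFock : Type := Fock →L[ℂ] Fock

/-- The C*-algebra generated by the Weyl operators `W(f)`, `f ∈ L`. -/
def weylAlgebra (L : Set OneParticle) : StarSubalgebra ℂ BFock :=
  (StarAlgebra.adjoin ℂ (weyl '' L)).topologicalClosure

/-- The local von Neumann algebra: the double commutant of the Weyl algebra over `ℒ(O)`. -/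
def localAlgebra (O : Set (ℝ × R3)) : StarSubalgebra ℂ BFock :=
  StarSubalgebra.centralizer ℂ
    (StarSubalgebra.centralizer ℂ (weylAlgebra (localSpace O) : Set BFock) : Set BFock)

/-- The quasilocal algebra: the C*-algebra generated by the local algebras of all double cones. -/
def quasilocalAlgebra : StarSubalgebra ℂ BFock :=
  (⨆ O : {O : Set (ℝ × R3) // IsDoubleCone O}, localAlgebra O).topologicalClosure

theorem weyl_mem_localAlgebra {O : Set (ℝ × R3)} {f : OneParticle} (hf : f ∈ localSpace O) :
    weyl f ∈ localAlgebra O := by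
  have h1 : weyl f ∈ weylAlgebra (localSpace O) :=
    StarSubalgebra.le_topologicalClosure _ (StarAlgebra.subset_adjoin ℂ _ ⟨f, hf, rfl⟩)
  rw [localAlgebra, StarSubalgebra.mem_centralizer_iff]
  intro B hB
  have hB' := (StarSubalgebra.mem_centralizer_iff ℂ).1 hB _ h1
  have hB'' := (StarSubalgebra.mem_centralizer_iff ℂ).1 (star_mem hB) _ h1
  exact ⟨hB'.1.symm, hB''.1.symm⟩

theorem weyl_mem_quasilocalAlgebra {f : OneParticle} (hf : f ∈ observableSpace) :
    weyl f ∈ quasilocalAlgebra := by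
  obtain ⟨O, hO, hf⟩ := hf
  exact StarSubalgebra.le_topologicalClosure _
    (le_iSup (fun O : {O : Set (ℝ × R3) // IsDoubleCone O} => localAlgebra O) ⟨O, hO⟩
      (weyl_mem_localAlgebra hf))

/-- The Weyl operator `W(f)`, `f ∈ ℒ`, as an element of the quasilocal algebra. -/
def weylObs (f : OneParticle) (hf : f ∈ observableSpace) : quasilocalAlgebra :=
  ⟨weyl f, weyl_mem_quasilocalAlgebra hf⟩

/-- The functional `A ↦ ∑ₙ ⟨xₙ, A yₙ⟩` with `∑ ‖xₙ‖² < ∞`, `∑ ‖yₙ‖² < ∞`. These are exactly the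
ultraweakly continuous (normal) functionals on the bounded operators. -/
def normalFunctional (x y : lp (fun _ : ℕ => Fock) 2) (A : BFock) : ℂ :=
  ∑' n, ⟪x n, A (y n)⟫_ℂ

/-- Local normality: on each local von Neumann algebra the map is ultraweakly continuous, i.e. it
pulls normal functionals back to (restrictions of) normal functionals. -/
def IsLocallyNormal (Φ : quasilocalAlgebra → BFock) : Prop :=
  ∀ O, IsDoubleCone O → ∀ x y : lp (fun _ : ℕ => Fock) 2,
    ∃ x' y' : lp (fun _ : ℕ => Fock) 2, ∀ A : quasilocalAlgebra, (A : BFock) ∈ localAlgebra O →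
      normalFunctional x y (Φ A) = normalFunctional x' y' A

/-- Unitary equivalence of two representations of the quasilocal algebra on the Fock space. -/
def UnitarilyEquivalent (π ρ : quasilocalAlgebra →⋆ₐ[ℂ] BFock) : Prop :=
  ∃ U ∈ unitary BFock, ∀ A, U * π A * star U = ρ A

/-- The vacuum representation `π₀`, the identical representation on the Fock space. -/
def vacuumRep : quasilocalAlgebra →⋆ₐ[ℂ] BFock := quasilocalAlgebra.subtype

/-! ### Charges -/

/-- The set `ℒ_Γ` of functions `ω^{-1/2} σ̂ + i ω^{-3/2} ρ̂` with real test functions `σ`, `ρ`.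
They need not be square integrable. -/
def chargeSpace : Set (R3 → ℂ) :=
  {γ | ∃ σ ∈ testFunctions Set.univ, ∃ ρ ∈ testFunctions Set.univ,
    γ = fun k => omegaPow (-1 / 2) k * fourierHat σ k + I * omegaPow (-3 / 2) k * fourierHat ρ k}

/-- The linear form `l_γ(f) = -Im ∫ conj(γ) f d³k`; the integrand is integrable for `f ∈ ℒ`. -/
def chargeForm (γ : R3 → ℂ) (f : OneParticle) : ℝ := -(∫ k, conj (γ k) * f k).im

/-- `α` is the automorphism of the quasilocal algebra determined by `γ`: it multiplies `W(f)` by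
`e^{i l_γ(f)}`, and it is extended from the local Weyl algebras to the local von Neumann algebras
by weak continuity. These properties fix `α`, as the Weyl algebra is ultraweakly dense in each
local von Neumann algebra. -/
structure IsChargeAutomorphism (γ : R3 → ℂ) (α : quasilocalAlgebra ≃⋆ₐ[ℂ] quasilocalAlgebra) :
    Prop where
  locallyNormal : IsLocallyNormal fun A => (α A : BFock)
  apply_weyl : ∀ (f : OneParticle) (hf : f ∈ observableSpace),
    α (weylObs f hf) = Complex.exp (I * (chargeForm γ f : ℂ)) • weylObs f hf

/-! ### Infravacua -/

/-- Pointwise complex conjugation in position space, `(Γ v)(k) = conj (v (-k))`. -/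
def conjugation (v : OneParticle) : OneParticle :=
  star (Lp.compMeasurePreserving (fun k : R3 => -k) (Measure.measurePreserving_neg volume) v)

theorem conjugation_ae (v : OneParticle) :
    conjugation v =ᵐ[volume] fun k => conj (v (-k)) := by
  filter_upwards [Lp.coeFn_star (Lp.compMeasurePreserving (fun k : R3 => -k)
    (Measure.measurePreserving_neg volume) v), Lp.coeFn_compMeasurePreserving v
      (Measure.measurePreserving_neg (volume : Measure R3))] with k h1 h2
  rw [conjugation, h1, Pi.star_apply, h2]
  rfl

/-- The closed subspace of the vectors that vanish for `|k| < ε`, see `mem_aboveSubspace`. -/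
def aboveSubspace (ε : ℝ) : Submodule ℂ OneParticle :=
  LinearMap.ker (LpToLpRestrictCLM R3 ℂ ℂ volume 2 (Metric.ball 0 ε)).toLinearMap

instance (ε : ℝ) : CompleteSpace (aboveSubspace ε) :=
  (LpToLpRestrictCLM R3 ℂ ℂ volume 2 (Metric.ball 0 ε)).isClosed_ker.completeSpace_coe

theorem mem_aboveSubspace (ε : ℝ) (v : OneParticle) :
    v ∈ aboveSubspace ε ↔ ∀ᵐ k : R3, ‖k‖ < ε → v k = 0 := by
  have h := LpToLpRestrictCLM_coeFn ℂ (Metric.ball (0 : R3) ε) v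
  have h2 : v ∈ aboveSubspace ε ↔ LpToLpRestrictCLM R3 ℂ ℂ volume 2 (Metric.ball 0 ε) v = 0 :=
    Iff.rfl
  have h3 : (∀ᵐ k : R3, ‖k‖ < ε → v k = 0) ↔
      v =ᵐ[volume.restrict (Metric.ball (0 : R3) ε)] (0 : R3 → ℂ) := by
    rw [Filter.EventuallyEq, ae_restrict_iff' Metric.isOpen_ball.measurableSet]
    simp
  rw [h2, h3, Lp.eq_zero_iff_ae_eq_zero]
  exact ⟨fun h4 => h.symm.trans h4, fun h4 => h.trans h4⟩

/-- The projector `P_ε` onto that subspace. -/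
def cutoff (ε : ℝ) : OneParticle →L[ℂ] OneParticle := (aboveSubspace ε).starProjection

/-- The sequences `(εᵢ)`, `(Qᵢ)`, `(bᵢ)`, `i = 1, 2, …`. The index starts at `0` here: the entry
`i` of each of the three sequences is the one that is customarily numbered `i + 1`. -/
structure InfravacuumData where
  ε : ℕ → ℝ
  ε_pos : ∀ i, 0 < ε i
  ε_anti : ∀ i, ε (i + 1) < ε i
  ε_lim : Filter.Tendsto ε Filter.atTop (𝓝 0)
  Q : ℕ → OneParticle →L[ℂ] OneParticle
  Q_proj : ∀ i, IsStarProjection (Q i)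
  Q_fin : ∀ i, FiniteDimensional ℂ (LinearMap.range (Q i).toLinearMap)
  Q_conj : ∀ i v, Q i (conjugation v) = conjugation (Q i v)
  Q_shell : ∀ i, Q i * (cutoff (ε (i + 1)) - cutoff (ε i)) = Q i
  b : ℕ → ℝ
  b_pos : ∀ i, 0 < b i
  b_lt_one : ∀ i, b i < 1
  b_lim : Filter.Tendsto b Filter.atTop (𝓝 0)
  summable_energy : Summable fun i =>
    ε i / b i ^ 2 * (Module.finrank ℂ (LinearMap.range (Q i).toLinearMap) : ℝ)

namespace InfravacuumData

/-- `T₁ = 1 + ∑ᵢ (bᵢ - 1) Qᵢ`. As the ranges of the `Qᵢ` are mutually orthogonal and `0 < bᵢ < 1`,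
the series converges on every vector; this is the continuous extension of the operator given by the
same formula on the vectors that vanish near `k = 0`. -/
def T₁ (D : InfravacuumData) (v : OneParticle) : OneParticle :=
  v + ∑' i, ((D.b i - 1 : ℝ) : ℂ) • D.Q i v

/-- `T₂ = 1 + ∑ᵢ (1/bᵢ - 1) Qᵢ` on its domain `ω_r^{1/2} L²`, where `ω_r(k) = min(|k|, ε₁)`. The series
converges on this domain, because `rk Qᵢ ≥ 1` unless `Qᵢ = 0`, so that `εᵢ / bᵢ²` is bounded over
the `i` with `Qᵢ ≠ 0`; hence `T₂ ω_r^{1/2}` is the continuous extension of the operator given by the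
same formula on the vectors that vanish near `k = 0`. Outside of the domain the value is irrelevant. -/
def T₂ (D : InfravacuumData) (v : OneParticle) : OneParticle :=
  v + ∑' i, ((1 / D.b i - 1 : ℝ) : ℂ) • D.Q i v

/-- The symplectic operator `T = T₂ (1 + Γ)/2 + T₁ (1 - Γ)/2`, with the domain of all `v` such that
`(1 + Γ)/2 v ∈ ω_r^{1/2} L²`. It contains `ℒ`, and `T` is only used there. -/
def T (D : InfravacuumData) (v : OneParticle) : OneParticle :=
  D.T₂ ((1 / 2 : ℂ) • (v + conjugation v)) + D.T₁ ((1 / 2 : ℂ) • (v - conjugation v))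

end InfravacuumData

/-- Homogeneous harmonic polynomials of degree `l` in three variables. Their restrictions to the
unit sphere are the linear combinations of the spherical harmonics `Y_{lm}`, `-l ≤ m ≤ l`. -/
def IsSolidHarmonic (l : ℕ) (p : MvPolynomial (Fin 3) ℂ) : Prop :=
  p.IsHomogeneous l ∧ ∑ j, MvPolynomial.pderiv j (MvPolynomial.pderiv j p) = 0

/-- The span of the vectors `ξ ⊗ Y_{lm}`, `0 < l ≤ N`, `-l ≤ m ≤ l`, where `ξ(ω) = ω^{-3/2}` on
`[a, b]`: these functions are supported in the shell `a ≤ |k| ≤ b`, and are equal to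
`|k|^{-3/2} Y(k/|k|)` there. -/
def shellHarmonics (a b : ℝ) (N : ℕ) : Submodule ℂ OneParticle :=
  Submodule.span ℂ {v | ∃ (l : ℕ) (p : MvPolynomial (Fin 3) ℂ), 0 < l ∧ l ≤ N ∧
    IsSolidHarmonic l p ∧
    v =ᵐ[volume] {k : R3 | a ≤ ‖k‖ ∧ ‖k‖ ≤ b}.indicator fun k =>
      omegaPow (-3 / 2) k * MvPolynomial.eval (fun j => ((k j / ‖k‖ : ℝ) : ℂ)) p}

/-- The two additional conditions for a KPR-like operator. The second one says that, for the
numbering `i = 1, 2, …`, the operator `Qᵢ` is the orthogonal projection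
`|ξᵢ⟩⟨ξᵢ|/⟨ξᵢ|ξᵢ⟩ ⊗ ∑_{0<l≤i} ∑ₘ |Y_{lm}⟩⟨Y_{lm}|`; as `Qᵢ` is an orthogonal projection, it is
enough to give its range. -/
structure InfravacuumData.IsKPRLike (D : InfravacuumData) : Prop where
  log_poly : ∃ (C : ℝ) (N : ℕ), ∀ i : ℕ, Real.log (D.ε i / D.ε (i + 1)) ≤ C * ((i : ℝ) + 1) ^ N
  summable_log : Summable fun i => D.b i ^ 2 * Real.log (D.ε i / D.ε (i + 1))
  range_Q : ∀ i, LinearMap.range (D.Q i).toLinearMap =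
    shellHarmonics (D.ε (i + 1)) (D.ε i) (i + 1)

/-- `π` is the representation `π_T` on the Fock space: `π_T(W(f)) = W(T f)` for `f ∈ ℒ`, extended
to the local von Neumann algebras by local normality. These properties fix `π`. -/
structure InfravacuumData.IsRepresentation (D : InfravacuumData)
    (π : quasilocalAlgebra →⋆ₐ[ℂ] BFock) : Prop where
  locallyNormal : IsLocallyNormal π
  apply_weyl : ∀ (f : OneParticle) (hf : f ∈ observableSpace), π (weylObs f hf) = weyl (D.T f)

end

/-!
Write `γⱼ = ω^{-1/2} σ̂ⱼ + i ω^{-3/2} ρ̂ⱼ`. Both equivalences hold if and only if the total charges `∫ ρ₁`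
and `∫ ρ₂` coincide.

*Equal charges.* The difference `g = γ₂ - γ₁` is then dominated by `ω^{-1/2}` near `k = 0`, because
`ρ̂₂ - ρ̂₁` vanishes there. So `g` is a one-particle vector, and `W(g)` intertwines the charged vacuum
representations on the Weyl operators. As `‖Qᵢ v‖` is of order `εᵢ` for every `v` dominated by
`ω^{-1/2}`, the series for `T g` converges absolutely; `T` is symplectic on such vectors
(`InfravacuumData.im_inner_T`), and `W(T g)` intertwines the charged infravacuum representations.
The passage from the Weyl operators to the quasilocal algebra (`starAlgHom_ext_of_weyl`) uses local
normality and the ultraweak half of the bicommutant theorem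
(`inner_amplify_eq_zero_of_mem_bicommutant`).

*Different charges.* Let `h` be a test function with rotation invariant, nonnegative `ĥ`, and let
`fₙ(k) = s n ω^{-1/2} ĥ(n k)`. These vectors of `ℒ` have the same norm and tend weakly to zero, whence
`W(fₙ)` tends weakly to a nonzero scalar (`tendsto_inner_weyl`), whereas `l_γ(fₙ)` tends to
`s ρ̂(0) ∫ ω^{-2} ĥ` (`tendsto_chargeForm_fieldVec_dilate`). A unitary that turns `W(fₙ)` into
`exp(i (l_{γ₂} - l_{γ₁})(fₙ)) W(fₙ)` can therefore exist for all `s` only if the total charges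
coincide. This argument applies to the infravacuum as well: the ranges of the `Qᵢ` consist of functions
of angular momentum `l > 0`, so that `Qᵢ fₙ = 0` and `T fₙ = fₙ`. Here the vanishing of the spherical
mean of a solid harmonic (`integral_sphere_polyFun`) enters, which is obtained by an integration by
parts.
-/

noncomputable section

/-! ### Amplifications and normal functionals -/

theorem memℓp_sumElim {ι κ H : Type*} [NormedAddCommGroup H]
    (x : lp (fun _ : ι => H) 2) (y : lp (fun _ : κ => H) 2) :
    Memℓp (E := fun _ : ι ⊕ κ => H) (Sum.elim x y) 2 := by
  have hx := (memℓp_gen_iff (p := 2) (by norm_num)).1 (lp.memℓp x)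
  have hy := (memℓp_gen_iff (p := 2) (by norm_num)).1 (lp.memℓp y)
  refine memℓp_gen ?_
  exact (HasSum.sum (f := fun i : ι ⊕ κ => ‖(Sum.elim x y i : H)‖ ^ (2 : ℝ≥0∞).toReal)
    hx.hasSum hy.hasSum).summable

section Amplification

variable {ι H : Type*} [NormedAddCommGroup H] [InnerProductSpace ℂ H]

/-- The amplification `A ⊗ 1` of a bounded operator `A` on `H` to `H ⊗ ℓ²(ι)`, realised as the
square summable families in `H`; it acts on every component by `A`. -/
def amplify (ι : Type*) (A : H →L[ℂ] H) :
    lp (fun _ : ι => H) 2 →L[ℂ] lp (fun _ : ι => H) 2 :=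
  lp.mapCLM 2 (fun _ => A) (norm_nonneg A) fun _ => le_rfl

@[simp]
theorem amplify_apply (A : H →L[ℂ] H) (x : lp (fun _ : ι => H) 2) (i : ι) :
    amplify ι A x i = A (x i) := rfl

theorem norm_amplify_le (A : H →L[ℂ] H) : ‖amplify ι A‖ ≤ ‖A‖ := lp.norm_mapCLM_le ..

theorem amplify_add (A B : H →L[ℂ] H) : amplify ι (A + B) = amplify ι A + amplify ι B := rfl

theorem amplify_smul (c : ℂ) (A : H →L[ℂ] H) : amplify ι (c • A) = c • amplify ι A := rfl

theorem inner_amplify_eq_tsum (x y : lp (fun _ : ι => H) 2) (A : H →L[ℂ] H) :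
    ⟪x, amplify ι A y⟫_ℂ = ∑' n, ⟪x n, A (y n)⟫_ℂ := lp.inner_eq_tsum _ _

theorem hasSum_inner_amplify (x y : lp (fun _ : ι => H) 2) (A : H →L[ℂ] H) :
    HasSum (fun n => ⟪x n, A (y n)⟫_ℂ) ⟪x, amplify ι A y⟫_ℂ := lp.hasSum_inner _ _

theorem inner_amplify_left [CompleteSpace H] (x y : lp (fun _ : ι => H) 2) (A : H →L[ℂ] H) :
    ⟪amplify ι A x, y⟫_ℂ = ⟪x, amplify ι (star A) y⟫_ℂ := by
  rw [lp.inner_eq_tsum, lp.inner_eq_tsum]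
  refine tsum_congr fun n => ?_
  rw [amplify_apply, amplify_apply, ContinuousLinearMap.star_eq_adjoint,
    ContinuousLinearMap.adjoint_inner_right]

theorem continuous_inner_amplify (x y : lp (fun _ : ι => H) 2) :
    Continuous fun A : H →L[ℂ] H => ⟪x, amplify ι A y⟫_ℂ := by
  let φ : (H →L[ℂ] H) →ₗ[ℂ] ℂ :=
    { toFun := fun A => ⟪x, amplify ι A y⟫_ℂ
      map_add' := fun A B => by
        rw [amplify_add, add_apply, inner_add_right]
      map_smul' := fun c A => by
        rw [amplify_smul, smul_apply, inner_smul_right]; rfl }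
  refine (φ.mkContinuous (‖x‖ * ‖y‖) fun A => ?_).continuous
  calc ‖⟪x, amplify ι A y⟫_ℂ‖ ≤ ‖x‖ * ‖amplify ι A y‖ := norm_inner_le_norm _ _
    _ ≤ ‖x‖ * (‖A‖ * ‖y‖) := by
        gcongr
        exact (amplify ι A).le_of_opNorm_le (norm_amplify_le A) y
    _ = ‖x‖ * ‖y‖ * ‖A‖ := by ring

/-- The ultraweak half of the bicommutant theorem: an ultraweakly continuous functional that
vanishes on a unital `*`-algebra of operators vanishes on its bicommutant. The projection onto the
closure of `(S ⊗ 1) y` commutes with `S ⊗ 1`, so that its matrix entries lie in the commutant of `S`,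
and it therefore commutes with `A ⊗ 1` for every `A` in the bicommutant. -/
theorem inner_amplify_eq_zero_of_mem_bicommutant [CompleteSpace H]
    (S : StarSubalgebra ℂ (H →L[ℂ] H)) (x y : lp (fun _ : ι => H) 2)
    (h : ∀ B ∈ S, ⟪x, amplify ι B y⟫_ℂ = 0) {A : H →L[ℂ] H}
    (hA : A ∈ StarSubalgebra.centralizer ℂ
      (StarSubalgebra.centralizer ℂ (S : Set (H →L[ℂ] H)) : Set (H →L[ℂ] H))) :
    ⟪x, amplify ι A y⟫_ℂ = 0 := by
  classical
  let K := lp (fun _ : ι => H) 2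
  let N₀ : Submodule ℂ K :=
    { carrier := {z | ∃ B ∈ S, amplify ι B y = z}
      add_mem' := by
        rintro _ _ ⟨B, hB, rfl⟩ ⟨C, hC, rfl⟩
        exact ⟨B + C, add_mem hB hC, rfl⟩
      zero_mem' := ⟨0, zero_mem S, by ext i; simp⟩
      smul_mem' := by
        rintro c _ ⟨B, hB, rfl⟩
        exact ⟨c • B, S.smul_mem hB c, rfl⟩ }
  let N := N₀.topologicalClosure
  have : CompleteSpace N := N₀.isClosed_topologicalClosure.completeSpace_coe
  have hinv : ∀ B ∈ S, ∀ z ∈ N, amplify ι B z ∈ N := by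
    intro B hB z hz
    refine map_mem_closure (amplify ι B).continuous hz ?_
    rintro _ ⟨C, hC, rfl⟩
    exact ⟨B * C, mul_mem hB hC, rfl⟩
  let P : K →L[ℂ] K := N.starProjection
  have hP : ∀ B ∈ S, ∀ z, P (amplify ι B z) = amplify ι B (P z) := by
    intro B hB z
    refine Submodule.eq_starProjection_of_mem_of_inner_eq_zero
      (hinv B hB _ (Submodule.starProjection_apply_mem _ _)) fun w hw => ?_
    rw [← map_sub, inner_amplify_left]
    exact Submodule.starProjection_inner_eq_zero _ _ (hinv _ (star_mem hB) w hw)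
  let entry : ι → ι → (H →L[ℂ] H) := fun m n =>
    (lp.evalCLM ℂ (fun _ : ι => H) 2 m).comp
      (P.comp (lp.singleContinuousLinearMap ℂ (fun _ : ι => H) 2 n))
  have hsingle : ∀ (B : H →L[ℂ] H) (n : ι) (ξ : H),
      amplify ι B (lp.single 2 n ξ) = lp.single 2 n (B ξ) := by
    intro B n ξ
    ext m
    by_cases hmn : m = n
    · subst hmn; simp
    · simp [Pi.single_eq_of_ne hmn]
  have hentry : ∀ m n, ∀ B ∈ S, entry m n * B = B * entry m n := by
    intro m n B hB
    ext ξ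
    change (P (lp.single 2 n (B ξ))) m = B (P (lp.single 2 n ξ) m)
    rw [← hsingle, hP B hB]
    rfl
  have hentry' : ∀ m n, entry m n ∈ StarSubalgebra.centralizer ℂ (S : Set (H →L[ℂ] H)) := by
    intro m n
    rw [StarSubalgebra.mem_centralizer_iff]
    exact fun B hB => ⟨(hentry m n B hB).symm, (hentry m n _ (star_mem hB)).symm⟩
  have hAP : ∀ z, amplify ι A (P z) = P (amplify ι A z) := by
    have hs : ∀ n ξ, amplify ι A (P (lp.single 2 n ξ)) = P (amplify ι A (lp.single 2 n ξ)) := by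
      intro n ξ
      rw [hsingle]
      ext m
      have := ((StarSubalgebra.mem_centralizer_iff ℂ).1 hA _ (hentry' m n)).1
      exact (congrArg (fun T : H →L[ℂ] H => T ξ) this).symm
    intro z
    have hz := lp.hasSum_single (p := 2) (by simp) z
    have h1 := hz.mapL ((amplify ι A).comp P)
    have h2 := hz.mapL (P.comp (amplify ι A))
    refine h1.unique (h2.congr_fun fun n => ?_)
    exact hs n _
  have hy : y ∈ N := N₀.le_topologicalClosure ⟨1, one_mem S, by ext i; simp⟩
  have hmem : amplify ι A y ∈ N := by
    have : amplify ι A y = P (amplify ι A y) := by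
      rw [← hAP, show P y = y from Submodule.starProjection_eq_self_iff.2 hy]
    rw [this]
    exact Submodule.starProjection_apply_mem _ _
  have hx : N ≤ LinearMap.ker (innerSL ℂ x).toLinearMap := by
    refine Submodule.topologicalClosure_minimal _ ?_ (innerSL ℂ x).isClosed_ker
    rintro _ ⟨B, hB, rfl⟩
    exact h B hB
  exact hx hmem

/-- Two ultraweakly continuous functionals that agree on a unital `*`-algebra of operators agree on
its bicommutant. -/
theorem inner_amplify_eq_of_mem_bicommutant [CompleteSpace H]
    (S : StarSubalgebra ℂ (H →L[ℂ] H)) (x y x' y' : lp (fun _ : ι => H) 2)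
    (h : ∀ B ∈ S, ⟪x, amplify ι B y⟫_ℂ = ⟪x', amplify ι B y'⟫_ℂ) {A : H →L[ℂ] H}
    (hA : A ∈ StarSubalgebra.centralizer ℂ
      (StarSubalgebra.centralizer ℂ (S : Set (H →L[ℂ] H)) : Set (H →L[ℂ] H))) :
    ⟪x, amplify ι A y⟫_ℂ = ⟪x', amplify ι A y'⟫_ℂ := by
  let X : lp (fun _ : ι ⊕ ι => H) 2 := ⟨_, memℓp_sumElim x x'⟩
  let Y : lp (fun _ : ι ⊕ ι => H) 2 := ⟨_, memℓp_sumElim y (-y')⟩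
  have key : ∀ B : H →L[ℂ] H,
      ⟪X, amplify (ι ⊕ ι) B Y⟫_ℂ = ⟪x, amplify ι B y⟫_ℂ - ⟪x', amplify ι B y'⟫_ℂ := by
    intro B
    refine (hasSum_inner_amplify X Y B).unique ?_
    rw [sub_eq_add_neg]
    refine HasSum.sum ((hasSum_inner_amplify x y B).congr_fun fun n => rfl) ?_
    refine (hasSum_inner_amplify x' y' B).neg.congr_fun fun n => ?_
    change ⟪x' n, B (-(y' n))⟫_ℂ = _
    rw [map_neg, inner_neg_right]
  have := inner_amplify_eq_zero_of_mem_bicommutant S X Y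
    (fun B hB => by rw [key, h B hB, sub_self]) hA
  rwa [key, sub_eq_zero] at this

end Amplification

/-! ### Weyl operators and the local algebras -/

theorem weyl_mul_weyl_neg (f : OneParticle) : weyl f * weyl (-f) = 1 := by
  have h : (⟪f, f⟫_ℂ).im = 0 := inner_self_im (𝕜 := ℂ) f
  rw [weyl_mul_weyl, add_neg_cancel, weyl_zero, inner_neg_right, Complex.neg_im, h]
  simp

theorem norm_weyl_apply (f : OneParticle) (ψ : Fock) : ‖weyl f ψ‖ = ‖ψ‖ := by
  have h : (fun ψ : Fock => ‖weyl f ψ‖) = fun ψ => ‖ψ‖ := by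
    refine denseRange_linearCombination_expVec.equalizer (by fun_prop) (by fun_prop) ?_
    funext a
    have h1 : weyl f (Finsupp.linearCombination ℂ expVec a) =
        Finsupp.linearCombination ℂ (weylOnExp f) a := by
      simp [Finsupp.linearCombination_apply, Finsupp.sum, weyl_expVec]
    simp only [Function.comp_apply, h1, norm_weyl_aux]
  exact congrFun h ψ

theorem star_weyl (f : OneParticle) : star (weyl f) = weyl (-f) := by
  have h : star (weyl f) * weyl f = 1 := by
    rw [ContinuousLinearMap.star_eq_adjoint]
    exact ((weyl f).norm_map_iff_adjoint_comp_self).1 (norm_weyl_apply f)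
  calc star (weyl f) = star (weyl f) * (weyl f * weyl (-f)) := by
        rw [weyl_mul_weyl_neg, mul_one]
    _ = weyl (-f) := by rw [← mul_assoc, h, one_mul]

theorem weyl_mem_unitary (f : OneParticle) : weyl f ∈ unitary BFock := by
  have h := weyl_mul_weyl_neg (-f)
  rw [neg_neg] at h
  exact Unitary.mem_iff.2 ⟨by rw [star_weyl, h], by rw [star_weyl, weyl_mul_weyl_neg]⟩

/-- `W(g)` implements the multiplication of the Weyl operators by characters. -/
theorem weyl_conj_weyl (g f : OneParticle) :
    weyl g * weyl f * star (weyl g) = Complex.exp (-(I * ((⟪g, f⟫_ℂ).im : ℂ))) • weyl f := by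
  have h0 : (⟪g, g⟫_ℂ).im = 0 := inner_self_im (𝕜 := ℂ) g
  have h1 : (⟪f, g⟫_ℂ).im = -(⟪g, f⟫_ℂ).im := by
    rw [← inner_conj_symm f g, Complex.conj_im]
  rw [star_weyl, weyl_mul_weyl, smul_mul_assoc, weyl_mul_weyl, smul_smul, ← Complex.exp_add,
    add_neg_cancel_comm]
  congr 2
  rw [inner_neg_right, inner_add_left, Complex.neg_im, Complex.add_im, h0, h1]
  push_cast
  ring

/-- Ultraweakly continuous functionals that agree on the Weyl operators over a real subspace agree
on the C*-algebra these generate, as the linear span of the Weyl operators is dense in it. -/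
theorem inner_amplify_eq_of_mem_weylAlgebra {ι : Type*} (L : Submodule ℝ OneParticle)
    (x y x' y' : lp (fun _ : ι => Fock) 2)
    (h : ∀ f ∈ L, ⟪x, amplify ι (weyl f) y⟫_ℂ = ⟪x', amplify ι (weyl f) y'⟫_ℂ)
    {B : BFock} (hB : B ∈ weylAlgebra L) :
    ⟪x, amplify ι B y⟫_ℂ = ⟪x', amplify ι B y'⟫_ℂ := by
  have hcl : IsClosed {B : BFock | ⟪x, amplify ι B y⟫_ℂ = ⟪x', amplify ι B y'⟫_ℂ} :=
    isClosed_eq (continuous_inner_amplify x y) (continuous_inner_amplify x' y')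
  refine closure_minimal (s := (StarAlgebra.adjoin ℂ (weyl '' L) : Set BFock)) ?_ hcl hB
  have hmon : ∀ C ∈ Submonoid.closure (weyl '' (L : Set OneParticle) ∪ star (weyl '' L)),
      ∃ (c : ℂ) (f : OneParticle), f ∈ L ∧ C = c • weyl f := by
    intro C hC
    induction hC using Submonoid.closure_induction with
    | mem C hC =>
      rcases hC with ⟨f, hf, rfl⟩ | ⟨f, hf, hfC⟩
      · exact ⟨1, f, hf, (one_smul _ _).symm⟩
      · refine ⟨1, -f, L.neg_mem hf, ?_⟩
        rw [one_smul, ← star_weyl, hfC, star_star]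
    | one => exact ⟨1, 0, L.zero_mem, by rw [weyl_zero, one_smul]⟩
    | mul C C' _ _ h1 h2 =>
      obtain ⟨c, f, hf, rfl⟩ := h1
      obtain ⟨c', f', hf', rfl⟩ := h2
      exact ⟨_, f + f', L.add_mem hf hf', by rw [smul_mul_smul_comm, weyl_mul_weyl, smul_smul]⟩
  have hspan : ∀ C ∈ Submodule.span ℂ
      (Submonoid.closure (weyl '' (L : Set OneParticle) ∪ star (weyl '' L)) : Set BFock),
      ⟪x, amplify ι C y⟫_ℂ = ⟪x', amplify ι C y'⟫_ℂ := by
    intro C hC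
    induction hC using Submodule.span_induction with
    | mem C hC =>
      obtain ⟨c, f, hf, rfl⟩ := hmon C hC
      simp only [amplify_smul, smul_apply, inner_smul_right, h f hf]
    | zero =>
      have h0 : amplify ι (0 : BFock) = 0 := by
        have := amplify_smul (ι := ι) (0 : ℂ) (0 : BFock)
        rwa [zero_smul, zero_smul] at this
      simp [h0]
    | add C C' _ _ h1 h2 => simp only [amplify_add, add_apply, inner_add_right, h1, h2]
    | smul c C _ h1 => simp only [amplify_smul, smul_apply, inner_smul_right, h1]
  intro C hC
  refine hspan C ?_
  rw [← StarAlgebra.adjoin_eq_span]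
  exact hC

/-- The vector `ψ` as the first member of a family whose other members vanish; with these families
`normalFunctional` reproduces the matrix elements of an operator. -/
def unitFamily (ψ : Fock) : lp (fun _ : ℕ => Fock) 2 := lp.single 2 0 ψ

theorem normalFunctional_unitFamily (φ ψ : Fock) (A : BFock) :
    normalFunctional (unitFamily φ) (unitFamily ψ) A = ⟪φ, A ψ⟫_ℂ := by
  have h := lp.inner_single_left (𝕜 := ℂ) (G := fun _ : ℕ => Fock) 0 φ
    (amplify ℕ A (unitFamily ψ))
  rw [show normalFunctional (unitFamily φ) (unitFamily ψ) A =
    ⟪unitFamily φ, amplify ℕ A (unitFamily ψ)⟫_ℂ from (inner_amplify_eq_tsum _ _ _).symm]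
  rw [unitFamily, h, amplify_apply, unitFamily, lp.single_apply_self]

/-- Normal functionals are determined on a local von Neumann algebra by their values on its Weyl
operators. -/
theorem normalFunctional_eq_of_weyl {O : Set (ℝ × R3)} {x y x' y' : lp (fun _ : ℕ => Fock) 2}
    (h : ∀ f ∈ localSpace O, normalFunctional x y (weyl f) = normalFunctional x' y' (weyl f))
    {A : BFock} (hA : A ∈ localAlgebra O) : normalFunctional x y A = normalFunctional x' y' A := by
  have hn : ∀ (x y : lp (fun _ : ℕ => Fock) 2) (B : BFock),
      normalFunctional x y B = ⟪x, amplify ℕ B y⟫_ℂ :=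
    fun x y B => (inner_amplify_eq_tsum x y B).symm
  simp only [hn] at h ⊢
  exact inner_amplify_eq_of_mem_bicommutant (weylAlgebra (localSpace O)) x y x' y'
    (fun B hB => inner_amplify_eq_of_mem_weylAlgebra (localSpace O) x y x' y' h hB) hA

/-- Locally normal maps are given on the local algebras, in the sense of matrix elements, by normal
functionals. -/
theorem IsLocallyNormal.exists_inner {Φ : quasilocalAlgebra → BFock} (hΦ : IsLocallyNormal Φ)
    {O : Set (ℝ × R3)} (hO : IsDoubleCone O) (φ ψ : Fock) :
    ∃ x y : lp (fun _ : ℕ => Fock) 2, ∀ A : quasilocalAlgebra, (A : BFock) ∈ localAlgebra O →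
      ⟪φ, Φ A ψ⟫_ℂ = normalFunctional x y A := by
  obtain ⟨x, y, h⟩ := hΦ O hO (unitFamily φ) (unitFamily ψ)
  exact ⟨x, y, fun A hA => by rw [← h A hA, normalFunctional_unitFamily]⟩

theorem localAlgebra_le_quasilocalAlgebra {O : Set (ℝ × R3)} (hO : IsDoubleCone O) :
    localAlgebra O ≤ quasilocalAlgebra :=
  (le_iSup (fun O : {O : Set (ℝ × R3) // IsDoubleCone O} => localAlgebra O) ⟨O, hO⟩).trans
    (StarSubalgebra.le_topologicalClosure _)

instance : CStarAlgebra quasilocalAlgebra :=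
  StarSubalgebra.cstarAlgebra quasilocalAlgebra
    (h_closed := StarSubalgebra.isClosed_topologicalClosure _)

/-- A locally normal endomorphism that multiplies the Weyl operators by scalars maps every local
algebra into itself. -/
theorem mem_localAlgebra_of_apply_weyl {α : quasilocalAlgebra → quasilocalAlgebra}
    (hα : IsLocallyNormal fun A => (α A : BFock)) {c : OneParticle → ℂ}
    (hw : ∀ (f : OneParticle) (hf : f ∈ observableSpace), α (weylObs f hf) = c f • weylObs f hf)
    {O : Set (ℝ × R3)} (hO : IsDoubleCone O) {A : quasilocalAlgebra}
    (hA : (A : BFock) ∈ localAlgebra O) : (α A : BFock) ∈ localAlgebra O := by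
  have key : ∀ B ∈ StarSubalgebra.centralizer ℂ (weylAlgebra (localSpace O) : Set BFock),
      B * (α A : BFock) = α A * B := by
    intro B hB
    refine ContinuousLinearMap.ext fun ψ => ext_inner_left ℂ fun φ => ?_
    obtain ⟨x, y, h1⟩ := hα.exists_inner hO (star B φ) ψ
    obtain ⟨x', y', h2⟩ := hα.exists_inner hO φ (B ψ)
    have e1 : ⟪φ, (B * (α A : BFock)) ψ⟫_ℂ = ⟪star B φ, (α A : BFock) ψ⟫_ℂ := by
      rw [ContinuousLinearMap.star_eq_adjoint, ContinuousLinearMap.adjoint_inner_left]; rfl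
    have e2 : ⟪φ, ((α A : BFock) * B) ψ⟫_ℂ = ⟪φ, (α A : BFock) (B ψ)⟫_ℂ := rfl
    rw [e1, e2, h1 A hA, h2 A hA]
    refine normalFunctional_eq_of_weyl (fun f hf => ?_) hA
    have hf' : f ∈ observableSpace := ⟨O, hO, hf⟩
    have hmem : ((weylObs f hf' : quasilocalAlgebra) : BFock) ∈ localAlgebra O :=
      weyl_mem_localAlgebra hf
    have g1 := h1 _ hmem
    have g2 := h2 _ hmem
    rw [hw f hf'] at g1 g2
    change _ = normalFunctional x y (weyl f) at g1
    change _ = normalFunctional x' y' (weyl f) at g2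
    rw [← g1, ← g2]
    have hcomm : weyl f * B = B * weyl f :=
      ((StarSubalgebra.mem_centralizer_iff ℂ).1 hB _
        (StarSubalgebra.le_topologicalClosure _ (StarAlgebra.subset_adjoin ℂ _ ⟨f, hf, rfl⟩))).1
    change ⟪star B φ, (c f • weyl f) ψ⟫_ℂ = ⟪φ, (c f • weyl f) (B ψ)⟫_ℂ
    rw [ContinuousLinearMap.star_eq_adjoint, ContinuousLinearMap.adjoint_inner_left, smul_apply,
      smul_apply, map_smul]
    congr 2
    exact (congrArg (fun T : BFock => T ψ) hcomm).symm
  rw [localAlgebra, StarSubalgebra.mem_centralizer_iff]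
  exact fun B hB => ⟨key B hB, key _ (star_mem hB)⟩

/-- Locally normal representations are determined by their values on the Weyl operators: these fix
them on the local algebras by ultraweak continuity, and then on the quasilocal algebra by norm
continuity. -/
theorem starAlgHom_ext_of_weyl {Φ Ψ : quasilocalAlgebra →⋆ₐ[ℂ] BFock}
    (hΦ : IsLocallyNormal Φ) (hΨ : IsLocallyNormal Ψ)
    (h : ∀ (f : OneParticle) (hf : f ∈ observableSpace), Φ (weylObs f hf) = Ψ (weylObs f hf)) :
    Φ = Ψ := by
  have hloc : ∀ O, IsDoubleCone O → ∀ A : quasilocalAlgebra, (A : BFock) ∈ localAlgebra O →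
      Φ A = Ψ A := by
    intro O hO A hA
    refine ContinuousLinearMap.ext fun ψ => ext_inner_left ℂ fun φ => ?_
    obtain ⟨x, y, h1⟩ := hΦ.exists_inner hO φ ψ
    obtain ⟨x', y', h2⟩ := hΨ.exists_inner hO φ ψ
    rw [h1 A hA, h2 A hA]
    refine normalFunctional_eq_of_weyl (fun f hf => ?_) hA
    have hf' : f ∈ observableSpace := ⟨O, hO, hf⟩
    have hmem : ((weylObs f hf' : quasilocalAlgebra) : BFock) ∈ localAlgebra O :=
      weyl_mem_localAlgebra hf
    have g1 := h1 _ hmem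
    have g2 := h2 _ hmem
    rw [h f hf'] at g1
    exact g1.symm.trans g2
  let E : StarSubalgebra ℂ quasilocalAlgebra := StarAlgHom.equalizer Φ Ψ
  have hE : IsClosed (E : Set quasilocalAlgebra) := by
    have hc : ∀ Θ : quasilocalAlgebra →⋆ₐ[ℂ] BFock, Continuous Θ := fun Θ =>
      AddMonoidHomClass.continuous_of_bound Θ 1 fun A => by
        rw [one_mul]; exact NonUnitalStarAlgHom.norm_apply_le Θ A
    exact isClosed_eq (hc Φ) (hc Ψ)
  have hsup : (⨆ O : {O : Set (ℝ × R3) // IsDoubleCone O}, localAlgebra O) ≤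
      E.map quasilocalAlgebra.subtype := by
    refine iSup_le fun O A hA => ?_
    exact ⟨⟨A, localAlgebra_le_quasilocalAlgebra O.2 hA⟩, hloc O O.2 _ hA, rfl⟩
  refine StarAlgHom.ext fun A => ?_
  have hA : (A : BFock) ∈ closure (Subtype.val '' (E : Set quasilocalAlgebra)) :=
    closure_mono hsup A.2
  rw [← closure_subtype, hE.closure_eq] at hA
  exact hA

theorem IsLocallyNormal.comp_of_apply_weyl {π : quasilocalAlgebra → BFock}
    (hπ : IsLocallyNormal π) {α : quasilocalAlgebra → quasilocalAlgebra}
    (hα : IsLocallyNormal fun A => (α A : BFock)) {c : OneParticle → ℂ}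
    (hw : ∀ (f : OneParticle) (hf : f ∈ observableSpace), α (weylObs f hf) = c f • weylObs f hf) :
    IsLocallyNormal fun A => π (α A) := by
  intro O hO x y
  obtain ⟨x', y', h1⟩ := hπ O hO x y
  obtain ⟨x'', y'', h2⟩ := hα O hO x' y'
  exact ⟨x'', y'', fun A hA => by
    rw [h1 _ (mem_localAlgebra_of_apply_weyl hα hw hO hA), h2 A hA]⟩

theorem IsLocallyNormal.conj {π : quasilocalAlgebra → BFock} (hπ : IsLocallyNormal π)
    (U : BFock) : IsLocallyNormal fun A => U * π A * star U := by
  intro O hO x y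
  obtain ⟨x', y', h⟩ := hπ O hO (amplify ℕ (star U) x) (amplify ℕ (star U) y)
  refine ⟨x', y', fun A hA => ?_⟩
  rw [← h A hA]
  refine tsum_congr fun n => ?_
  rw [amplify_apply, amplify_apply, ContinuousLinearMap.star_eq_adjoint,
    ContinuousLinearMap.adjoint_inner_left]
  rfl

/-- If the vector `g` represents the difference of two charge forms symplectically on the vectors
`S f`, then `W(g)` intertwines the two charged representations. -/
theorem unitarilyEquivalent_of_chargeForm {π : quasilocalAlgebra →⋆ₐ[ℂ] BFock}
    (hπ : IsLocallyNormal π) {S : OneParticle → OneParticle}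
    (hS : ∀ (f : OneParticle) (hf : f ∈ observableSpace), π (weylObs f hf) = weyl (S f))
    {γ₁ γ₂ : R3 → ℂ} {α₁ α₂ : quasilocalAlgebra ≃⋆ₐ[ℂ] quasilocalAlgebra}
    (hα₁ : IsChargeAutomorphism γ₁ α₁) (hα₂ : IsChargeAutomorphism γ₂ α₂) {g : OneParticle}
    (hg : ∀ f ∈ observableSpace, (⟪g, S f⟫_ℂ).im = chargeForm γ₁ f - chargeForm γ₂ f) :
    UnitarilyEquivalent (π.comp (α₁ : quasilocalAlgebra →⋆ₐ[ℂ] quasilocalAlgebra))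
      (π.comp (α₂ : quasilocalAlgebra →⋆ₐ[ℂ] quasilocalAlgebra)) := by
  let U : unitary BFock := ⟨weyl g, weyl_mem_unitary g⟩
  let Φ : quasilocalAlgebra →⋆ₐ[ℂ] BFock :=
    (Unitary.conjStarAlgAut ℂ BFock U : BFock →⋆ₐ[ℂ] BFock).comp
      (π.comp (α₁ : quasilocalAlgebra →⋆ₐ[ℂ] quasilocalAlgebra))
  have h : Φ = π.comp (α₂ : quasilocalAlgebra →⋆ₐ[ℂ] quasilocalAlgebra) := by
    refine starAlgHom_ext_of_weyl
      ((hπ.comp_of_apply_weyl hα₁.locallyNormal hα₁.apply_weyl).conj (weyl g))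
      (hπ.comp_of_apply_weyl hα₂.locallyNormal hα₂.apply_weyl) fun f hf => ?_
    change weyl g * π (α₁ (weylObs f hf)) * star (weyl g) = π (α₂ (weylObs f hf))
    rw [hα₁.apply_weyl, hα₂.apply_weyl, map_smul, map_smul, hS f hf, mul_smul_comm,
      smul_mul_assoc, weyl_conj_weyl, smul_smul, ← Complex.exp_add, hg f hf]
    congr 2
    push_cast
    ring
  exact ⟨weyl g, weyl_mem_unitary g, fun A => congrArg (fun Θ : quasilocalAlgebra →⋆ₐ[ℂ] BFock =>
    Θ A) h⟩

/-! ### Weak limits of Weyl operators -/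

theorem tendsto_zero_of_dense {X : Type*} [SeminormedAddCommGroup X] {D : Set X} (hD : Dense D)
    {g : ℕ → X → ℂ} {C : ℝ} (hg : ∀ n x y, ‖g n x - g n y‖ ≤ C * ‖x - y‖)
    (h : ∀ x ∈ D, Filter.Tendsto (fun n => g n x) Filter.atTop (𝓝 0)) (x : X) :
    Filter.Tendsto (fun n => g n x) Filter.atTop (𝓝 0) := by
  rw [Metric.tendsto_atTop]
  intro ε hε
  have hC : 0 < |C| + 1 := by positivity
  obtain ⟨y, hy, hxy⟩ := Metric.dense_iff.1 hD x (ε / 2 / (|C| + 1)) (by positivity)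
  obtain ⟨N, hN⟩ := Metric.tendsto_atTop.1 (h _ hxy) (ε / 2) (by positivity)
  refine ⟨N, fun n hn => ?_⟩
  have h1 := hN n hn
  rw [dist_zero_right] at h1 ⊢
  have h2 : ‖x - y‖ < ε / 2 / (|C| + 1) := by
    rw [← dist_eq_norm, dist_comm]; exact hy
  have h3 : ‖g n x - g n y‖ < ε / 2 := by
    refine (hg n x y).trans_lt ?_
    calc C * ‖x - y‖ ≤ (|C| + 1) * ‖x - y‖ := by
          gcongr; linarith [le_abs_self C]
      _ < ε / 2 := by rw [mul_comm]; exact (lt_div_iff₀ hC).1 h2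
  calc ‖g n x‖ = ‖(g n x - g n y) + g n y‖ := by rw [sub_add_cancel]
    _ ≤ ‖g n x - g n y‖ + ‖g n y‖ := norm_add_le _ _
    _ < ε := by linarith

/-- If `fₙ → 0` weakly with `‖fₙ‖ = r`, then `W(fₙ)` tends weakly to the scalar `exp(-r²/4)`. -/
theorem tendsto_inner_weyl {f : ℕ → OneParticle} {r : ℝ} (hr : ∀ n, ‖f n‖ = r)
    (hf : ∀ u, Filter.Tendsto (fun n => ⟪f n, u⟫_ℂ) Filter.atTop (𝓝 0)) (φ ψ : Fock) :
    Filter.Tendsto (fun n => ⟪φ, weyl (f n) ψ⟫_ℂ) Filter.atTop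
      (𝓝 (Complex.exp (-(r ^ 2 / 4 : ℝ)) * ⟪φ, ψ⟫_ℂ)) := by
  let c : ℂ := Complex.exp (-(r ^ 2 / 4 : ℝ))
  let T : ℕ → BFock := fun n => weyl (f n) - c • 1
  have hTapp : ∀ n φ ψ, ⟪φ, T n ψ⟫_ℂ = ⟪φ, weyl (f n) ψ⟫_ℂ - c * ⟪φ, ψ⟫_ℂ := by
    intro n φ ψ
    change ⟪φ, weyl (f n) ψ - c • ψ⟫_ℂ = _
    rw [inner_sub_right, inner_smul_right]
  have hT : ∀ n ψ, ‖T n ψ‖ ≤ (1 + ‖c‖) * ‖ψ‖ := by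
    intro n ψ
    calc ‖weyl (f n) ψ - c • ψ‖ ≤ ‖weyl (f n) ψ‖ + ‖c • ψ‖ := norm_sub_le _ _
      _ = (1 + ‖c‖) * ‖ψ‖ := by rw [norm_weyl_apply, norm_smul]; ring
  have hexp : ∀ u v, Filter.Tendsto (fun n => ⟪expVec v, T n (expVec u)⟫_ℂ) Filter.atTop
      (𝓝 0) := by
    intro u v
    simp only [hTapp]
    rw [← sub_self (c * ⟪expVec v, expVec u⟫_ℂ)]
    refine Filter.Tendsto.sub_const ?_ _
    have h1 : ∀ n, ⟪expVec v, weyl (f n) (expVec u)⟫_ℂ =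
        Complex.exp (-(r ^ 2 / 4 : ℝ) + (I / (Real.sqrt 2 : ℝ)) * ⟪f n, u⟫_ℂ) *
          Complex.exp (⟪v, u⟫_ℂ + (I / (Real.sqrt 2 : ℝ)) * ⟪v, f n⟫_ℂ) := by
      intro n
      rw [weyl_expVec, weylOnExp, inner_smul_right, inner_expVec, inner_add_right,
        inner_smul_right, hr n]
    simp only [h1]
    have h2 : Filter.Tendsto (fun n => ⟪v, f n⟫_ℂ) Filter.atTop (𝓝 0) := by
      have := (Complex.continuous_conj.tendsto 0).comp (hf v)
      simpa [Function.comp_def] using this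
    have h3 : c * ⟪expVec v, expVec u⟫_ℂ =
        Complex.exp (-(r ^ 2 / 4 : ℝ) + (I / (Real.sqrt 2 : ℝ)) * 0) *
          Complex.exp (⟪v, u⟫_ℂ + (I / (Real.sqrt 2 : ℝ)) * 0) := by
      rw [inner_expVec, mul_zero, add_zero, add_zero]
    rw [h3]
    exact (((hf u).const_mul _).const_add _).cexp.mul ((h2.const_mul _).const_add _).cexp
  have hdense : Dense (Set.range (Finsupp.linearCombination ℂ expVec)) :=
    denseRange_linearCombination_expVec
  have hexp2 : ∀ u φ, Filter.Tendsto (fun n => ⟪T n (expVec u), φ⟫_ℂ) Filter.atTop (𝓝 0) := by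
    intro u
    refine tendsto_zero_of_dense hdense (C := (1 + ‖c‖) * ‖expVec u‖) (fun n x y => ?_) ?_
    · rw [← inner_sub_right]
      exact (norm_inner_le_norm _ _).trans (by gcongr; exact hT _ _)
    · rintro _ ⟨a, rfl⟩
      simp only [Finsupp.linearCombination_apply, Finsupp.sum, inner_sum, inner_smul_right]
      rw [← Finset.sum_const_zero (s := a.support)]
      refine tendsto_finsetSum _ fun v _ => ?_
      have := (Complex.continuous_conj.tendsto 0).comp (hexp u v)
      simpa [Function.comp_def] using this.const_mul (a v)
  have hall : Filter.Tendsto (fun n => ⟪φ, T n ψ⟫_ℂ) Filter.atTop (𝓝 0) := by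
    revert ψ
    refine tendsto_zero_of_dense hdense (C := (1 + ‖c‖) * ‖φ‖) (fun n x y => ?_) ?_
    · rw [← inner_sub_right, ← map_sub]
      refine (norm_inner_le_norm _ _).trans ?_
      calc ‖φ‖ * ‖T n (x - y)‖ ≤ ‖φ‖ * ((1 + ‖c‖) * ‖x - y‖) := by gcongr; exact hT _ _
        _ = _ := by ring
    · rintro _ ⟨a, rfl⟩
      simp only [Finsupp.linearCombination_apply, Finsupp.sum, map_sum, map_smul, inner_sum,
        inner_smul_right]
      rw [← Finset.sum_const_zero (s := a.support)]
      refine tendsto_finsetSum _ fun v _ => ?_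
      have := (Complex.continuous_conj.tendsto 0).comp (hexp2 v φ)
      simpa [Function.comp_def] using this.const_mul (a v)
  have := hall.add_const (c * ⟪φ, ψ⟫_ℂ)
  simp only [hTapp, sub_add_cancel, zero_add] at this
  exact this

/-- A unitary that multiplies the Weyl operators of a weakly vanishing sequence by phases forces
these phases to tend to `1`. -/
theorem eq_one_of_tendsto_of_conj_weyl {f : ℕ → OneParticle} {r : ℝ} (hr : ∀ n, ‖f n‖ = r)
    (hf : ∀ u, Filter.Tendsto (fun n => ⟪f n, u⟫_ℂ) Filter.atTop (𝓝 0))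
    {U : BFock} (hU : U ∈ unitary BFock) {z : ℕ → ℂ} {w : ℂ}
    (hz : Filter.Tendsto z Filter.atTop (𝓝 w))
    (h : ∀ n, U * weyl (f n) * star U = z n • weyl (f n)) : w = 1 := by
  let e := expVec 0
  have he : ⟪e, e⟫_ℂ = 1 := by rw [inner_expVec, inner_zero_left, Complex.exp_zero]
  have h1 := tendsto_inner_weyl hr hf (star U e) (star U e)
  have h2 := hz.mul (tendsto_inner_weyl hr hf e e)
  have h3 : ⟪star U e, star U e⟫_ℂ = 1 := by
    rw [ContinuousLinearMap.star_eq_adjoint, ContinuousLinearMap.adjoint_inner_left,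
      ← ContinuousLinearMap.star_eq_adjoint]
    have := congrArg (fun T : BFock => T e) (Unitary.mul_star_self_of_mem hU)
    rw [show U (star U e) = e from this, he]
  have h4 : ∀ n, ⟪star U e, weyl (f n) (star U e)⟫_ℂ = z n * ⟪e, weyl (f n) e⟫_ℂ := by
    intro n
    rw [ContinuousLinearMap.star_eq_adjoint, ContinuousLinearMap.adjoint_inner_left,
      ← ContinuousLinearMap.star_eq_adjoint, ← inner_smul_right]
    congr 1
    exact congrArg (fun T : BFock => T e) (h n)
  simp only [h4, h3, he] at h1 h2
  have h5 := tendsto_nhds_unique h1 h2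
  have h6 := Complex.exp_ne_zero (-(r ^ 2 / 4 : ℝ))
  exact (mul_right_cancel₀ (b := Complex.exp (-(r ^ 2 / 4 : ℝ))) h6
    (by simpa using h5)).symm

/-- If the two charged representations are equivalent, then the phases by which the charges differ
tend to `1` along every weakly vanishing sequence of constant norm. -/
theorem exp_eq_one_of_unitarilyEquivalent {π : quasilocalAlgebra →⋆ₐ[ℂ] BFock}
    {γ₁ γ₂ : R3 → ℂ} {α₁ α₂ : quasilocalAlgebra ≃⋆ₐ[ℂ] quasilocalAlgebra}
    (hα₁ : IsChargeAutomorphism γ₁ α₁) (hα₂ : IsChargeAutomorphism γ₂ α₂)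
    (h : UnitarilyEquivalent (π.comp (α₁ : quasilocalAlgebra →⋆ₐ[ℂ] quasilocalAlgebra))
      (π.comp (α₂ : quasilocalAlgebra →⋆ₐ[ℂ] quasilocalAlgebra)))
    {f : ℕ → OneParticle} (hobs : ∀ n, f n ∈ observableSpace)
    (hS : ∀ n, π (weylObs (f n) (hobs n)) = weyl (f n)) {r : ℝ} (hr : ∀ n, ‖f n‖ = r)
    (hf : ∀ u, Filter.Tendsto (fun n => ⟪f n, u⟫_ℂ) Filter.atTop (𝓝 0)) {a₁ a₂ : ℝ}
    (h₁ : Filter.Tendsto (fun n => chargeForm γ₁ (f n)) Filter.atTop (𝓝 a₁))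
    (h₂ : Filter.Tendsto (fun n => chargeForm γ₂ (f n)) Filter.atTop (𝓝 a₂)) :
    Complex.exp (I * (a₂ - a₁ : ℝ)) = 1 := by
  obtain ⟨U, hU, hUA⟩ := h
  refine eq_one_of_tendsto_of_conj_weyl hr hf hU
    (z := fun n => Complex.exp (I * (chargeForm γ₂ (f n) - chargeForm γ₁ (f n) : ℝ))) ?_ fun n => ?_
  · exact (((Complex.continuous_ofReal.tendsto _).comp (h₂.sub h₁)).const_mul I).cexp
  · have h3 := hUA (weylObs (f n) (hobs n))
    change U * π (α₁ (weylObs (f n) (hobs n))) * star U = π (α₂ (weylObs (f n) (hobs n))) at h3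
    rw [hα₁.apply_weyl, hα₂.apply_weyl, map_smul, map_smul, hS n, mul_smul_comm,
      smul_mul_assoc] at h3
    have h4 := congrArg
      (fun A : BFock => Complex.exp (-(I * (chargeForm γ₁ (f n) : ℂ))) • A) h3
    simp only [smul_smul, ← Complex.exp_add] at h4
    rw [neg_add_cancel, Complex.exp_zero, one_smul] at h4
    rw [h4]
    congr 2
    push_cast
    ring

/-! ### Fourier transforms of test functions -/

/-- Integrability in three dimensions of a power singularity at the origin, with an integrable
decay at infinity. -/
theorem integrable_rpow_div {s : ℝ} (h1 : -3 < s) (h2 : s < 1) :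
    Integrable fun k : R3 => ‖k‖ ^ s * ((1 + ‖k‖) ^ 4)⁻¹ := by
  have h := integrable_fun_norm_addHaar (E := R3) (volume : Measure R3)
    (f := fun y : ℝ => y ^ s * ((1 + y) ^ 4)⁻¹)
  refine h.2 ?_
  simp only [finrank_euclideanSpace, Fintype.card_fin, smul_eq_mul]
  have hm : Measurable fun y : ℝ => y ^ (3 - 1) * (y ^ s * ((1 + y) ^ 4)⁻¹) := by fun_prop
  rw [← Set.Ioo_union_Ici_eq_Ioi (zero_lt_one (α := ℝ)), integrableOn_union]
  constructor
  · have h3 : IntegrableOn (fun y : ℝ => y ^ (s + 2)) (Set.Ioo 0 1) :=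
      (intervalIntegral.integrableOn_Ioo_rpow_iff zero_lt_one).2 (by linarith)
    refine h3.mono' hm.aestronglyMeasurable ?_
    filter_upwards [self_mem_ae_restrict measurableSet_Ioo] with y hy
    have hy0 : 0 < y := hy.1
    have h4 : ((1 + y) ^ 4)⁻¹ ≤ 1 := inv_le_one_of_one_le₀ (one_le_pow₀ (by linarith))
    rw [Real.norm_of_nonneg (by positivity), Real.rpow_add hy0, Real.rpow_two]
    calc y ^ 2 * (y ^ s * ((1 + y) ^ 4)⁻¹) ≤ y ^ 2 * (y ^ s * 1) := by gcongr
      _ = y ^ s * y ^ 2 := by ring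
  · have h3 : IntegrableOn (fun y : ℝ => y ^ (s - 2)) (Set.Ici 1) :=
      (integrableOn_Ici_iff_integrableOn_Ioi).2
        (integrableOn_Ioi_rpow_of_lt (by linarith) zero_lt_one)
    refine h3.mono' hm.aestronglyMeasurable ?_
    filter_upwards [self_mem_ae_restrict measurableSet_Ici] with y hy
    have hy0 : 0 < y := lt_of_lt_of_le zero_lt_one hy
    have h4 : ((1 + y) ^ 4)⁻¹ ≤ (y ^ 4)⁻¹ := by gcongr; linarith
    rw [Real.norm_of_nonneg (by positivity), Real.rpow_sub hy0, Real.rpow_two]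
    calc y ^ 2 * (y ^ s * ((1 + y) ^ 4)⁻¹) ≤ y ^ 2 * (y ^ s * (y ^ 4)⁻¹) := by gcongr
      _ = y ^ s / y ^ 2 := by field_simp

section TestFunctions

variable {h : R3 → ℝ} {U : Set R3}

theorem fourierHat_eq_fourier (h : R3 → ℝ) (k : R3) :
    fourierHat h k = FourierTransform.fourier (fun x => (h x : ℂ)) ((2 * Real.pi)⁻¹ • k) := by
  rw [Real.fourier_eq', fourierHat]
  congr 1
  ext x
  rw [smul_eq_mul, inner_smul_right, real_inner_comm]
  congr 2
  push_cast
  field_simp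

/-- The Fourier transform of a test function is the restriction of a Schwartz function, up to the
normalisation of the momentum. -/
theorem exists_schwartz_fourierHat (hh : h ∈ testFunctions U) :
    ∃ F : SchwartzMap R3 ℂ, ∀ k, fourierHat h k = F ((2 * Real.pi)⁻¹ • k) := by
  have h1 : ContDiff ℝ ∞ fun x => (h x : ℂ) := Complex.ofRealCLM.contDiff.comp hh.1
  have h2 : HasCompactSupport fun x => (h x : ℂ) := hh.2.1.comp_left Complex.ofReal_zero
  refine ⟨FourierTransform.fourier (h2.toSchwartzMap h1), fun k => ?_⟩
  rw [fourierHat_eq_fourier, SchwartzMap.fourier_coe]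
  rfl

theorem continuous_fourierHat (hh : h ∈ testFunctions U) : Continuous (fourierHat h) := by
  obtain ⟨F, hF⟩ := exists_schwartz_fourierHat hh
  rw [funext hF]
  exact F.continuous.comp (continuous_const_smul _)

theorem exists_norm_fourierHat_le (hh : h ∈ testFunctions U) :
    ∃ C, 0 ≤ C ∧ ∀ k, ‖fourierHat h k‖ ≤ C * ((1 + ‖k‖) ^ 5)⁻¹ := by
  obtain ⟨F, hF⟩ := exists_schwartz_fourierHat hh
  let M := 2 ^ 5 * ((Finset.Iic (5, 0)).sup fun m => SchwartzMap.seminorm ℝ m.1 m.2) F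
  have hM : ∀ x, (1 + ‖x‖) ^ 5 * ‖F x‖ ≤ M := fun x => by
    have := SchwartzMap.one_add_le_sup_seminorm_apply (𝕜 := ℝ) (m := (5, 0)) (k := 5) (n := 0)
      le_rfl le_rfl F x
    rwa [norm_iteratedFDeriv_zero] at this
  have hM0 : 0 ≤ M := le_trans (by positivity) (hM 0)
  refine ⟨(2 * Real.pi) ^ 5 * M, by positivity, fun k => ?_⟩
  have hpi : 1 ≤ 2 * Real.pi := by linarith [Real.pi_gt_three]
  have h1 : 1 + ‖k‖ ≤ 2 * Real.pi * (1 + ‖(2 * Real.pi)⁻¹ • k‖) := by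
    rw [norm_smul, Real.norm_of_nonneg (by positivity), mul_add, mul_inv_cancel_left₀
      (by positivity)]
    linarith
  rw [hF, ← div_eq_mul_inv, le_div_iff₀ (by positivity)]
  calc ‖F ((2 * Real.pi)⁻¹ • k)‖ * (1 + ‖k‖) ^ 5
      ≤ ‖F ((2 * Real.pi)⁻¹ • k)‖ * (2 * Real.pi * (1 + ‖(2 * Real.pi)⁻¹ • k‖)) ^ 5 := by
        gcongr
    _ = (2 * Real.pi) ^ 5 * ((1 + ‖(2 * Real.pi)⁻¹ • k‖) ^ 5 * ‖F ((2 * Real.pi)⁻¹ • k)‖) := by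
        ring
    _ ≤ (2 * Real.pi) ^ 5 * M := by gcongr; exact hM _

theorem integrable_testFunction (hh : h ∈ testFunctions U) : Integrable h :=
  hh.1.continuous.integrable_of_hasCompactSupport hh.2.1

theorem integrable_fourierHat_integrand (hh : h ∈ testFunctions U) (k : R3) :
    Integrable fun x : R3 => Complex.exp (-I * (⟪k, x⟫_ℝ : ℝ)) * (h x : ℂ) := by
  have hc : Continuous h := hh.1.continuous
  refine (integrable_testFunction hh).norm.mono' (by fun_prop) ?_
  refine Filter.Eventually.of_forall fun x => ?_
  rw [norm_mul, show -I * ((⟪k, x⟫_ℝ : ℝ) : ℂ) = ((-⟪k, x⟫_ℝ : ℝ) : ℂ) * I by push_cast; ring,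
    Complex.norm_exp_ofReal_mul_I, one_mul, Complex.norm_real]

theorem fourierHat_zero (h : R3 → ℝ) : fourierHat h 0 = ((∫ x, h x : ℝ) : ℂ) := by
  simp only [fourierHat, inner_zero_left, Complex.ofReal_zero, mul_zero, Complex.exp_zero, one_mul]
  exact integral_ofReal

theorem exists_norm_fourierHat_sub_le (hh : h ∈ testFunctions U) :
    ∃ C, 0 ≤ C ∧ ∀ k, ‖fourierHat h k - fourierHat h 0‖ ≤ C * ‖k‖ := by
  refine ⟨∫ x, ‖x‖ * ‖h x‖, by positivity, fun k => ?_⟩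
  have hc : Continuous h := hh.1.continuous
  have hi : Integrable fun x : R3 => ‖x‖ * ‖h x‖ :=
    Continuous.integrable_of_hasCompactSupport (by fun_prop) hh.2.1.norm.mul_left
  rw [fourierHat, fourierHat, ← integral_sub (integrable_fourierHat_integrand hh k)
    (integrable_fourierHat_integrand hh 0), ← integral_mul_const]
  refine norm_integral_le_of_norm_le (hi.mul_const _) (Filter.Eventually.of_forall fun x => ?_)
  rw [← sub_mul, norm_mul, Complex.norm_real, inner_zero_left, Complex.ofReal_zero, mul_zero,
    Complex.exp_zero, show -I * ((⟪k, x⟫_ℝ : ℝ) : ℂ) = I * ((-⟪k, x⟫_ℝ : ℝ) : ℂ) by push_cast; ring]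
  calc ‖Complex.exp (I * ((-⟪k, x⟫_ℝ : ℝ) : ℂ)) - 1‖ * ‖h x‖ ≤ ‖-⟪k, x⟫_ℝ‖ * ‖h x‖ := by
        gcongr; exact Real.norm_exp_I_mul_ofReal_sub_one_le
    _ ≤ (‖k‖ * ‖x‖) * ‖h x‖ := by
        gcongr; rw [norm_neg]; exact norm_inner_le_norm _ _
    _ = ‖x‖ * ‖h x‖ * ‖k‖ := by ring

theorem fourierHat_neg (h : R3 → ℝ) (k : R3) : fourierHat h (-k) = conj (fourierHat h k) := by
  rw [fourierHat, fourierHat, ← integral_conj]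
  refine integral_congr_ae (Filter.Eventually.of_forall fun x => ?_)
  simp only [map_mul, ← Complex.exp_conj, Complex.conj_ofReal, map_neg, Complex.conj_I,
    inner_neg_left]
  congr 2
  push_cast
  ring

theorem sub_mem_testFunctions {g : R3 → ℝ} (hh : h ∈ testFunctions Set.univ)
    (hg : g ∈ testFunctions Set.univ) : h - g ∈ testFunctions Set.univ :=
  ⟨hh.1.sub hg.1, hh.2.1.sub hg.2.1, Set.subset_univ _⟩

theorem fourierHat_sub {g : R3 → ℝ} (hh : h ∈ testFunctions Set.univ)
    (hg : g ∈ testFunctions Set.univ) (k : R3) :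
    fourierHat (h - g) k = fourierHat h k - fourierHat g k := by
  rw [fourierHat, fourierHat, fourierHat, ← integral_sub (integrable_fourierHat_integrand hh k)
    (integrable_fourierHat_integrand hg k)]
  refine integral_congr_ae (Filter.Eventually.of_forall fun x => ?_)
  simp only [Pi.sub_apply, Complex.ofReal_sub, mul_sub]

end TestFunctions

/-! ### Functions with the infrared behaviour of the observables -/

/-- The weight `ω^{-1/2} (1 + ω)^{-4}`: it has the infrared singularity of the elements of `ℒ`, and a
decay that makes it square integrable. -/
def irWeight (k : R3) : ℝ := ‖k‖ ^ (-1 / 2 : ℝ) * ((1 + ‖k‖) ^ 4)⁻¹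

/-- The functions that are dominated by `ω^{-1/2} (1 + ω)^{-4}` almost everywhere. All elements of `ℒ`,
and all charges `ω^{-1/2} σ̂ + i ω^{-3/2} ρ̂` with `ρ̂(0) = 0`, are of this kind. -/
def IsIRBounded (v : R3 → ℂ) : Prop := ∃ C, 0 ≤ C ∧ ∀ᵐ k : R3, ‖v k‖ ≤ C * irWeight k

theorem ae_ne_zero : ∀ᵐ k : R3, k ≠ 0 := by
  simp [ae_iff]

theorem norm_omegaPow (s : ℝ) (k : R3) : ‖omegaPow s k‖ = ‖k‖ ^ s := by
  rw [omegaPow, Complex.norm_real, Real.norm_of_nonneg (by positivity)]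

theorem measurable_omegaPow (s : ℝ) : Measurable (omegaPow s) := by unfold omegaPow; fun_prop

theorem conj_omegaPow (s : ℝ) (k : R3) : conj (omegaPow s k) = omegaPow s k :=
  Complex.conj_ofReal _

theorem omegaPow_neg (s : ℝ) (k : R3) : omegaPow s (-k) = omegaPow s k := by
  rw [omegaPow, norm_neg, omegaPow]

theorem irWeight_sq_le (k : R3) : irWeight k ^ 2 ≤ ‖k‖ ^ (-1 : ℝ) * ((1 + ‖k‖) ^ 4)⁻¹ := by
  have h1 : (‖k‖ ^ (-1 / 2 : ℝ)) ^ 2 = ‖k‖ ^ (-1 : ℝ) := by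
    rw [← Real.rpow_natCast, ← Real.rpow_mul (norm_nonneg _)]; norm_num
  have h2 : ((1 + ‖k‖) ^ 4)⁻¹ ≤ 1 :=
    inv_le_one_of_one_le₀ (one_le_pow₀ (by linarith [norm_nonneg k]))
  rw [irWeight, mul_pow, h1, pow_two]
  gcongr
  calc ((1 + ‖k‖) ^ 4)⁻¹ * ((1 + ‖k‖) ^ 4)⁻¹ ≤ 1 * ((1 + ‖k‖) ^ 4)⁻¹ := by gcongr
    _ = _ := one_mul _

namespace IsIRBounded

variable {u v : R3 → ℂ}

theorem congr (hu : IsIRBounded u) (h : v =ᵐ[volume] u) : IsIRBounded v := by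
  obtain ⟨C, hC, hb⟩ := hu
  exact ⟨C, hC, by filter_upwards [hb, h] with k h1 h2; rwa [h2]⟩

theorem mono (hu : IsIRBounded u) (h : ∀ᵐ k, ‖v k‖ ≤ ‖u k‖) : IsIRBounded v := by
  obtain ⟨C, hC, hb⟩ := hu
  exact ⟨C, hC, by filter_upwards [hb, h] with k h1 h2; exact h2.trans h1⟩

theorem add (hu : IsIRBounded u) (hv : IsIRBounded v) : IsIRBounded fun k => u k + v k := by
  obtain ⟨C, hC, hb⟩ := hu
  obtain ⟨C', hC', hb'⟩ := hv
  refine ⟨C + C', by positivity, ?_⟩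
  filter_upwards [hb, hb'] with k h1 h2
  rw [add_mul]
  exact (norm_add_le _ _).trans (add_le_add h1 h2)

theorem const_mul (hu : IsIRBounded u) (c : ℂ) : IsIRBounded fun k => c * u k := by
  obtain ⟨C, hC, hb⟩ := hu
  refine ⟨‖c‖ * C, by positivity, ?_⟩
  filter_upwards [hb] with k h1
  rw [norm_mul, mul_assoc]
  gcongr

theorem memLp (hu : IsIRBounded u) (hm : AEStronglyMeasurable u) : MemLp u 2 := by
  obtain ⟨C, hC, hb⟩ := hu
  rw [memLp_two_iff_integrable_sq_norm hm]
  refine ((integrable_rpow_div (s := -1) (by norm_num) (by norm_num)).const_mul (C ^ 2)).mono'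
    (hm.norm.pow 2) ?_
  filter_upwards [hb] with k h1
  rw [Real.norm_of_nonneg (by positivity)]
  calc ‖u k‖ ^ 2 ≤ (C * irWeight k) ^ 2 := by gcongr
    _ = C ^ 2 * irWeight k ^ 2 := mul_pow _ _ _
    _ ≤ _ := by gcongr; exact irWeight_sq_le k

theorem integrable (hu : IsIRBounded u) (hm : AEStronglyMeasurable u) : Integrable u := by
  obtain ⟨C, hC, hb⟩ := hu
  exact ((integrable_rpow_div (s := -1 / 2) (by norm_num) (by norm_num)).const_mul C).mono' hm hb

/-- The product with a function that is at most as singular as `ω^{-3/2}` is integrable. -/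
theorem integrable_mul (hu : IsIRBounded u) (hm : AEStronglyMeasurable u)
    (hv : AEStronglyMeasurable v) {A B : ℝ} (hA : 0 ≤ A) (hB : 0 ≤ B)
    (hb : ∀ k, ‖v k‖ ≤ A * ‖k‖ ^ (-1 / 2 : ℝ) + B * ‖k‖ ^ (-3 / 2 : ℝ)) :
    Integrable fun k => v k * u k := by
  obtain ⟨C, hC, hbu⟩ := hu
  refine ((((integrable_rpow_div (s := -1) (by norm_num) (by norm_num)).const_mul (A * C)).add
    ((integrable_rpow_div (s := -2) (by norm_num) (by norm_num)).const_mul (B * C)))).mono'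
    (hv.mul hm) ?_
  filter_upwards [hbu, ae_ne_zero] with k h1 h2
  have hk : 0 < ‖k‖ := norm_pos_iff.2 h2
  have e1 : ‖k‖ ^ (-1 / 2 : ℝ) * ‖k‖ ^ (-1 / 2 : ℝ) = ‖k‖ ^ (-1 : ℝ) := by
    rw [← Real.rpow_add hk]; norm_num
  have e2 : ‖k‖ ^ (-3 / 2 : ℝ) * ‖k‖ ^ (-1 / 2 : ℝ) = ‖k‖ ^ (-2 : ℝ) := by
    rw [← Real.rpow_add hk]; norm_num
  rw [norm_mul, Pi.add_apply]
  calc ‖v k‖ * ‖u k‖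
      ≤ (A * ‖k‖ ^ (-1 / 2 : ℝ) + B * ‖k‖ ^ (-3 / 2 : ℝ)) * (C * irWeight k) := by
        gcongr; exact hb k
    _ = A * C * ((‖k‖ ^ (-1 / 2 : ℝ) * ‖k‖ ^ (-1 / 2 : ℝ)) * ((1 + ‖k‖) ^ 4)⁻¹) +
        B * C * ((‖k‖ ^ (-3 / 2 : ℝ) * ‖k‖ ^ (-1 / 2 : ℝ)) * ((1 + ‖k‖) ^ 4)⁻¹) := by
        rw [irWeight]; ring
    _ = _ := by rw [e1, e2]

end IsIRBounded

section TestFunctionBounds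

variable {h : R3 → ℝ} {U : Set R3}

theorem isIRBounded_omegaPow_neg_half (hh : h ∈ testFunctions U) :
    IsIRBounded fun k => omegaPow (-1 / 2) k * fourierHat h k := by
  obtain ⟨C, hC, hb⟩ := exists_norm_fourierHat_le hh
  refine ⟨C, hC, Filter.Eventually.of_forall fun k => ?_⟩
  have h1 : ((1 + ‖k‖) ^ 5)⁻¹ ≤ ((1 + ‖k‖) ^ 4)⁻¹ := by
    gcongr
    · linarith [norm_nonneg k]
    · norm_num
  rw [norm_mul, norm_omegaPow, irWeight]
  calc ‖k‖ ^ (-1 / 2 : ℝ) * ‖fourierHat h k‖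
      ≤ ‖k‖ ^ (-1 / 2 : ℝ) * (C * ((1 + ‖k‖) ^ 4)⁻¹) := by
        gcongr; exact (hb k).trans (by gcongr)
    _ = _ := by ring

theorem isIRBounded_omegaPow_half (hh : h ∈ testFunctions U) :
    IsIRBounded fun k => omegaPow (1 / 2) k * fourierHat h k := by
  obtain ⟨C, hC, hb⟩ := exists_norm_fourierHat_le hh
  refine ⟨C, hC, ?_⟩
  filter_upwards [ae_ne_zero] with k h2
  have hk : 0 < ‖k‖ := norm_pos_iff.2 h2
  have e1 : ‖k‖ ^ (1 / 2 : ℝ) = ‖k‖ ^ (-1 / 2 : ℝ) * ‖k‖ := by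
    rw [← Real.rpow_add_one hk.ne']; norm_num
  rw [norm_mul, norm_omegaPow, irWeight, e1]
  calc ‖k‖ ^ (-1 / 2 : ℝ) * ‖k‖ * ‖fourierHat h k‖
      ≤ ‖k‖ ^ (-1 / 2 : ℝ) * (1 + ‖k‖) * (C * ((1 + ‖k‖) ^ 5)⁻¹) := by
        gcongr
        · linarith
        · exact hb k
    _ = _ := by field_simp

theorem isIRBounded_omegaPow_neg_three_halves (hh : h ∈ testFunctions U)
    (h0 : fourierHat h 0 = 0) :
    IsIRBounded fun k => omegaPow (-3 / 2) k * fourierHat h k := by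
  obtain ⟨C, hC, hb⟩ := exists_norm_fourierHat_le hh
  obtain ⟨C', hC', hb'⟩ := exists_norm_fourierHat_sub_le hh
  refine ⟨16 * C' + C, by positivity, ?_⟩
  filter_upwards [ae_ne_zero] with k h2
  have hk : 0 < ‖k‖ := norm_pos_iff.2 h2
  have e1 : ‖k‖ ^ (-1 / 2 : ℝ) = ‖k‖ ^ (-3 / 2 : ℝ) * ‖k‖ := by
    rw [← Real.rpow_add_one hk.ne']; norm_num
  have key : ‖fourierHat h k‖ ≤ (16 * C' + C) * ‖k‖ * ((1 + ‖k‖) ^ 4)⁻¹ := by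
    rw [← div_eq_mul_inv, le_div_iff₀ (by positivity)]
    rcases le_total ‖k‖ 1 with h1 | h1
    · have h3 := hb' k
      rw [h0, sub_zero] at h3
      calc ‖fourierHat h k‖ * (1 + ‖k‖) ^ 4 ≤ C' * ‖k‖ * (1 + 1) ^ 4 := by gcongr
        _ = 16 * C' * ‖k‖ := by ring
        _ ≤ _ := by gcongr; linarith
    · have h3 := hb k
      rw [← div_eq_mul_inv, le_div_iff₀ (by positivity)] at h3
      calc ‖fourierHat h k‖ * (1 + ‖k‖) ^ 4
          ≤ ‖fourierHat h k‖ * (1 + ‖k‖) ^ 5 := by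
            gcongr
            · linarith
            · norm_num
        _ ≤ C * 1 := by linarith
        _ ≤ (16 * C' + C) * ‖k‖ := by gcongr; linarith
  rw [norm_mul, norm_omegaPow, irWeight, e1]
  calc ‖k‖ ^ (-3 / 2 : ℝ) * ‖fourierHat h k‖
      ≤ ‖k‖ ^ (-3 / 2 : ℝ) * ((16 * C' + C) * ‖k‖ * ((1 + ‖k‖) ^ 4)⁻¹) := by gcongr
    _ = _ := by ring

theorem measurable_omegaPow_mul_fourierHat (s : ℝ) (hh : h ∈ testFunctions U) :
    Measurable fun k => omegaPow s k * fourierHat h k :=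
  (measurable_omegaPow s).mul (continuous_fourierHat hh).measurable

end TestFunctionBounds

theorem isIRBounded_of_mem_observableSpace {f : OneParticle} (hf : f ∈ observableSpace) :
    IsIRBounded f := by
  obtain ⟨O, -, hf⟩ := hf
  induction hf using Submodule.span_induction with
  | mem f hf =>
    obtain ⟨t, c, r, -, -, h, hh, g, hg, hfe⟩ := hf
    refine (((isIRBounded_omegaPow_neg_half hh).add
      ((isIRBounded_omegaPow_half hg).const_mul I)).mono
      (v := fun k => Complex.exp (I * ((‖k‖ * t : ℝ) : ℂ)) *
        (omegaPow (-1 / 2) k * fourierHat h k + I * omegaPow (1 / 2) k * fourierHat g k))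
      (Filter.Eventually.of_forall fun k => ?_)).congr hfe
    rw [norm_mul, mul_comm I, Complex.norm_exp_ofReal_mul_I, one_mul, mul_assoc I]
  | zero => exact ⟨0, le_rfl, Filter.Eventually.of_forall fun k => by simp⟩
  | add f g _ _ h1 h2 => exact (h1.add h2).congr (Lp.coeFn_add f g)
  | smul a f _ h1 =>
    refine (h1.const_mul a).congr ?_
    filter_upwards [Lp.coeFn_smul a f] with k hk
    rw [hk]; simp

/-! ### Charges -/

theorem measurable_of_mem_chargeSpace {γ : R3 → ℂ} (hγ : γ ∈ chargeSpace) : Measurable γ := by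
  obtain ⟨σ, hσ, ρ, hρ, rfl⟩ := hγ
  simp only [mul_assoc]
  exact (measurable_omegaPow_mul_fourierHat _ hσ).add
    ((measurable_omegaPow_mul_fourierHat _ hρ).const_mul I)

theorem exists_norm_le_of_mem_chargeSpace {γ : R3 → ℂ} (hγ : γ ∈ chargeSpace) :
    ∃ A B : ℝ, 0 ≤ A ∧ 0 ≤ B ∧
      ∀ k, ‖γ k‖ ≤ A * ‖k‖ ^ (-1 / 2 : ℝ) + B * ‖k‖ ^ (-3 / 2 : ℝ) := by
  obtain ⟨σ, hσ, ρ, hρ, rfl⟩ := hγ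
  obtain ⟨A, hA, hbA⟩ := exists_norm_fourierHat_le hσ
  obtain ⟨B, hB, hbB⟩ := exists_norm_fourierHat_le hρ
  refine ⟨A, B, hA, hB, fun k => ?_⟩
  have h1 : ((1 + ‖k‖) ^ 5)⁻¹ ≤ 1 :=
    inv_le_one_of_one_le₀ (one_le_pow₀ (by linarith [norm_nonneg k]))
  refine (norm_add_le _ _).trans (add_le_add ?_ ?_)
  · rw [norm_mul, norm_omegaPow, mul_comm]
    gcongr
    exact (hbA k).trans (mul_le_of_le_one_right hA h1)
  · rw [norm_mul, norm_mul, Complex.norm_I, one_mul, norm_omegaPow, mul_comm]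
    gcongr
    exact (hbB k).trans (mul_le_of_le_one_right hB h1)

theorem integrable_conj_charge_mul {γ : R3 → ℂ} (hγ : γ ∈ chargeSpace) {f : R3 → ℂ}
    (hf : IsIRBounded f) (hm : AEStronglyMeasurable f) :
    Integrable fun k => conj (γ k) * f k := by
  obtain ⟨A, B, hA, hB, hb⟩ := exists_norm_le_of_mem_chargeSpace hγ
  refine hf.integrable_mul hm
    (Complex.continuous_conj.measurable.comp (measurable_of_mem_chargeSpace hγ)).aestronglyMeasurable
    hA hB fun k => ?_
  rw [RCLike.norm_conj]
  exact hb k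

theorem conjugation_toLp {v : R3 → ℂ} (hv : MemLp v 2 volume) {c : ℂ}
    (h : ∀ k, conj (v (-k)) = c * v k) : conjugation (hv.toLp v) = c • hv.toLp v := by
  refine Lp.ext ?_
  have hneg : ∀ᵐ k : R3, hv.toLp v (-k) = v (-k) :=
    (Measure.measurePreserving_neg (volume : Measure R3)).quasiMeasurePreserving.ae
      (p := fun k => hv.toLp v k = v k) hv.coeFn_toLp
  filter_upwards [conjugation_ae (hv.toLp v), hneg, hv.coeFn_toLp,
    Lp.coeFn_smul c (hv.toLp v)] with k h1 h2 h3 h4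
  rw [h1, h2, h4, Pi.smul_apply, h3, h k, smul_eq_mul]

/-- If two charges have the same total charge, then their difference is a square integrable function;
its two summands are its even and odd parts with respect to the conjugation `Γ`. -/
theorem exists_charge_difference {σ₁ ρ₁ σ₂ ρ₂ : R3 → ℝ}
    (hσ₁ : σ₁ ∈ testFunctions Set.univ) (hρ₁ : ρ₁ ∈ testFunctions Set.univ)
    (hσ₂ : σ₂ ∈ testFunctions Set.univ) (hρ₂ : ρ₂ ∈ testFunctions Set.univ)
    (h0 : fourierHat ρ₁ 0 = fourierHat ρ₂ 0) :
    ∃ g₁ g₂ : OneParticle, IsIRBounded g₁ ∧ IsIRBounded g₂ ∧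
      conjugation g₁ = g₁ ∧ conjugation g₂ = -g₂ ∧
      ∀ f ∈ observableSpace, (⟪g₁ + g₂, f⟫_ℂ).im =
        chargeForm (fun k => omegaPow (-1 / 2) k * fourierHat σ₁ k +
          I * omegaPow (-3 / 2) k * fourierHat ρ₁ k) f -
        chargeForm (fun k => omegaPow (-1 / 2) k * fourierHat σ₂ k +
          I * omegaPow (-3 / 2) k * fourierHat ρ₂ k) f := by
  have hσ := sub_mem_testFunctions hσ₂ hσ₁
  have hρ := sub_mem_testFunctions hρ₂ hρ₁
  have hρ0 : fourierHat (ρ₂ - ρ₁) 0 = 0 := by rw [fourierHat_sub hρ₂ hρ₁, h0, sub_self]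
  let v₁ : R3 → ℂ := fun k => omegaPow (-1 / 2) k * fourierHat (σ₂ - σ₁) k
  let v₂ : R3 → ℂ := fun k => I * (omegaPow (-3 / 2) k * fourierHat (ρ₂ - ρ₁) k)
  have hb₁ : IsIRBounded v₁ := isIRBounded_omegaPow_neg_half hσ
  have hb₂ : IsIRBounded v₂ := (isIRBounded_omegaPow_neg_three_halves hρ hρ0).const_mul I
  have hL₁ : MemLp v₁ 2 volume :=
    hb₁.memLp (measurable_omegaPow_mul_fourierHat _ hσ).aestronglyMeasurable
  have hL₂ : MemLp v₂ 2 volume :=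
    hb₂.memLp ((measurable_omegaPow_mul_fourierHat _ hρ).const_mul I).aestronglyMeasurable
  refine ⟨hL₁.toLp v₁, hL₂.toLp v₂, hb₁.congr hL₁.coeFn_toLp, hb₂.congr hL₂.coeFn_toLp, ?_, ?_, ?_⟩
  · rw [conjugation_toLp hL₁ (c := 1), one_smul]
    intro k
    simp only [v₁, fourierHat_neg, map_mul, omegaPow_neg, conj_omegaPow, Complex.conj_conj, one_mul]
  · rw [conjugation_toLp hL₂ (c := -1), neg_one_smul]
    intro k
    simp only [v₂, fourierHat_neg, map_mul, omegaPow_neg, conj_omegaPow, Complex.conj_conj,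
      Complex.conj_I]
    ring
  · intro f hf
    have hfb := isIRBounded_of_mem_observableSpace hf
    have hfm : AEStronglyMeasurable f := Lp.aestronglyMeasurable f
    have i₁ := integrable_conj_charge_mul ⟨σ₁, hσ₁, ρ₁, hρ₁, rfl⟩ hfb hfm
    have i₂ := integrable_conj_charge_mul ⟨σ₂, hσ₂, ρ₂, hρ₂, rfl⟩ hfb hfm
    rw [chargeForm, chargeForm, neg_sub_neg, ← Complex.sub_im, ← integral_sub i₂ i₁, L2.inner_def]
    congr 1
    refine integral_congr_ae ?_
    filter_upwards [Lp.coeFn_add (hL₁.toLp v₁) (hL₂.toLp v₂), hL₁.coeFn_toLp,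
      hL₂.coeFn_toLp] with k h1 h2 h3
    rw [h1, Pi.add_apply, h2, h3, RCLike.inner_apply]
    simp only [v₁, v₂, fourierHat_sub hσ₂ hσ₁, fourierHat_sub hρ₂ hρ₁, map_add, map_mul, map_sub,
      conj_omegaPow, Complex.conj_I]
    ring

/-! ### Low energy estimates -/

theorem norm_sq_eq_integral (u : OneParticle) : ‖u‖ ^ 2 = ∫ k, ‖u k‖ ^ 2 := by
  have h : ((‖u‖ ^ 2 : ℝ) : ℂ) = ((∫ k, ‖u k‖ ^ 2 : ℝ) : ℂ) := by
    have h1 : ⟪u, u⟫_ℂ = ((‖u‖ : ℝ) : ℂ) ^ 2 := inner_self_eq_norm_sq_to_K u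
    rw [Complex.ofReal_pow, ← h1, L2.inner_def, ← integral_complex_ofReal]
    refine integral_congr_ae (Filter.Eventually.of_forall fun k => ?_)
    simp only [inner_self_eq_norm_sq_to_K, Complex.ofReal_pow]
    rfl
  exact_mod_cast h

/-- By scaling, `∫ |k|⁻¹` over a ball of radius `ε` is proportional to `ε²`. -/
theorem setIntegral_ball_inv_norm {ε : ℝ} (hε : 0 < ε) :
    ∫ k in Metric.ball (0 : R3) ε, ‖k‖ ^ (-1 : ℝ) =
      ε ^ 2 * ∫ k in Metric.ball (0 : R3) 1, ‖k‖ ^ (-1 : ℝ) := by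
  have h := Measure.setIntegral_comp_smul_of_pos (volume : Measure R3)
    (fun k : R3 => ‖k‖ ^ (-1 : ℝ)) (Metric.ball 0 1) hε
  rw [smul_ball hε.ne', smul_zero, Real.norm_of_nonneg hε.le, mul_one] at h
  simp only [finrank_euclideanSpace, Fintype.card_fin, norm_smul, smul_eq_mul,
    Real.norm_of_nonneg hε.le, Real.mul_rpow hε.le (norm_nonneg _), integral_const_mul,
    Real.rpow_neg_one] at h ⊢
  rw [show (∫ k in Metric.ball (0 : R3) ε, ‖k‖⁻¹) = ε ^ 3 * ((ε ^ 3)⁻¹ *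
    ∫ k in Metric.ball (0 : R3) ε, ‖k‖⁻¹) by field_simp, ← h]
  field_simp

theorem integrableOn_ball_inv_norm (ε : ℝ) :
    IntegrableOn (fun k : R3 => ‖k‖ ^ (-1 : ℝ)) (Metric.ball 0 ε) := by
  rcases le_or_gt ε 0 with h | h
  · rw [Metric.ball_eq_empty.2 h]; exact integrableOn_empty
  refine (((integrable_rpow_div (s := -1) (by norm_num) (by norm_num)).const_mul
    ((1 + ε) ^ 4)).integrableOn (s := Metric.ball 0 ε)).mono'
    (by have : Measurable fun k : R3 => ‖k‖ ^ (-1 : ℝ) := by fun_prop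
        exact this.aestronglyMeasurable) ?_
  filter_upwards [self_mem_ae_restrict Metric.isOpen_ball.measurableSet] with k hk
  have hk' : ‖k‖ < ε := by simpa using hk
  have h1 : 1 ≤ (1 + ε) ^ 4 * ((1 + ‖k‖) ^ 4)⁻¹ := by
    rw [← div_eq_mul_inv, one_le_div (by positivity)]
    gcongr
  rw [Real.norm_of_nonneg (by positivity)]
  calc ‖k‖ ^ (-1 : ℝ) = ‖k‖ ^ (-1 : ℝ) * 1 := (mul_one _).symm
    _ ≤ ‖k‖ ^ (-1 : ℝ) * ((1 + ε) ^ 4 * ((1 + ‖k‖) ^ 4)⁻¹) := by gcongr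
    _ = _ := by ring

/-- The low energy part of a function with the infrared behaviour `ω^{-1/2}` is of order `ε`. -/
theorem exists_norm_sub_cutoff_le {v : OneParticle} (hv : IsIRBounded v) :
    ∃ C, 0 ≤ C ∧ ∀ ε, 0 < ε → ‖v - cutoff ε v‖ ≤ C * ε := by
  obtain ⟨C, hC, hb⟩ := hv
  let J := ∫ k in Metric.ball (0 : R3) 1, ‖k‖ ^ (-1 : ℝ)
  have hJ : 0 ≤ J := by positivity
  refine ⟨C * Real.sqrt J, by positivity, fun ε hε => ?_⟩
  let s : Set R3 := (Metric.ball 0 ε)ᶜ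
  have hs : MeasurableSet s := Metric.isOpen_ball.measurableSet.compl
  have hL : MemLp (s.indicator v) 2 volume := (Lp.memLp v).indicator hs
  have hx : hL.toLp _ ∈ aboveSubspace ε := by
    rw [mem_aboveSubspace]
    filter_upwards [hL.coeFn_toLp] with k hk hkε
    rw [hk, Set.indicator_of_notMem]
    simpa [s] using hkε
  have h1 : ‖v - cutoff ε v‖ ≤ ‖v - hL.toLp _‖ := by
    rw [cutoff, Submodule.starProjection_minimal]
    exact ciInf_le (f := fun x : aboveSubspace ε => ‖v - x‖)
      ⟨0, Set.forall_mem_range.mpr fun _ => norm_nonneg _⟩ ⟨_, hx⟩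
  refine h1.trans (le_of_sq_le_sq ?_ (by positivity))
  have h2 : (fun k => ‖(v - hL.toLp _ : OneParticle) k‖ ^ 2) =ᵐ[volume]
      (Metric.ball (0 : R3) ε).indicator fun k => ‖v k‖ ^ 2 := by
    filter_upwards [Lp.coeFn_sub v (hL.toLp _), hL.coeFn_toLp] with k h3 h4
    rw [h3, Pi.sub_apply, h4]
    by_cases hk : k ∈ Metric.ball (0 : R3) ε
    · rw [Set.indicator_of_notMem (by simpa [s] using hk), sub_zero, Set.indicator_of_mem hk]
    · rw [Set.indicator_of_mem (show k ∈ s from hk), Set.indicator_of_notMem hk, sub_self]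
      simp
  rw [norm_sq_eq_integral, integral_congr_ae h2,
    integral_indicator Metric.isOpen_ball.measurableSet]
  calc ∫ k in Metric.ball (0 : R3) ε, ‖v k‖ ^ 2
      ≤ ∫ k in Metric.ball (0 : R3) ε, C ^ 2 * ‖k‖ ^ (-1 : ℝ) := by
        refine integral_mono_of_nonneg (Filter.Eventually.of_forall fun k => by positivity)
          ((integrableOn_ball_inv_norm ε).const_mul _) ?_
        filter_upwards [ae_restrict_of_ae hb] with k hk
        have h5 : ((1 + ‖k‖) ^ 4)⁻¹ ≤ 1 :=
          inv_le_one_of_one_le₀ (one_le_pow₀ (by linarith [norm_nonneg k]))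
        calc ‖v k‖ ^ 2 ≤ (C * irWeight k) ^ 2 := by gcongr
          _ = C ^ 2 * irWeight k ^ 2 := mul_pow _ _ _
          _ ≤ C ^ 2 * (‖k‖ ^ (-1 : ℝ) * 1) := by
              gcongr
              exact (irWeight_sq_le k).trans (by gcongr)
          _ = _ := by rw [mul_one]
    _ = (C * Real.sqrt J * ε) ^ 2 := by
        rw [integral_const_mul, setIntegral_ball_inv_norm hε, mul_pow, mul_pow, Real.sq_sqrt hJ]
        ring

/-! ### The conjugation -/

theorem ae_neg {p : R3 → Prop} (h : ∀ᵐ k, p k) : ∀ᵐ k, p (-k) :=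
  (Measure.measurePreserving_neg (volume : Measure R3)).quasiMeasurePreserving.ae h

theorem conjugation_add (u v : OneParticle) :
    conjugation (u + v) = conjugation u + conjugation v := by
  refine Lp.ext ?_
  filter_upwards [conjugation_ae (u + v), ae_neg (Lp.coeFn_add u v), conjugation_ae u,
    conjugation_ae v, Lp.coeFn_add (conjugation u) (conjugation v)] with k h1 h2 h3 h4 h5
  rw [h1, h2, h5, Pi.add_apply, Pi.add_apply, h3, h4, map_add]

theorem conjugation_smul (c : ℂ) (v : OneParticle) :
    conjugation (c • v) = conj c • conjugation v := by
  refine Lp.ext ?_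
  filter_upwards [conjugation_ae (c • v), ae_neg (Lp.coeFn_smul c v), conjugation_ae v,
    Lp.coeFn_smul (conj c) (conjugation v)] with k h1 h2 h3 h4
  rw [h1, h2, h4, Pi.smul_apply, Pi.smul_apply, h3, smul_eq_mul, smul_eq_mul, map_mul]

theorem conjugation_zero : conjugation 0 = 0 := by
  have := conjugation_smul 0 0
  rwa [map_zero, zero_smul, zero_smul] at this

theorem conjugation_sub (u v : OneParticle) :
    conjugation (u - v) = conjugation u - conjugation v := by
  rw [sub_eq_add_neg, ← neg_one_smul ℂ v, conjugation_add, conjugation_smul, map_neg, map_one,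
    neg_one_smul, sub_eq_add_neg]

theorem inner_conjugation (u v : OneParticle) :
    ⟪conjugation u, conjugation v⟫_ℂ = conj ⟪u, v⟫_ℂ := by
  rw [L2.inner_def, L2.inner_def, ← integral_conj,
    ← integral_neg_eq_self (fun k => conj ⟪u k, v k⟫_ℂ)]
  refine integral_congr_ae ?_
  filter_upwards [conjugation_ae u, conjugation_ae v] with k h1 h2
  rw [h1, h2, RCLike.inner_apply, RCLike.inner_apply, map_mul]

theorem norm_conjugation (v : OneParticle) : ‖conjugation v‖ = ‖v‖ := by
  have h := congrArg Complex.re (inner_conjugation v v)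
  rw [Complex.conj_re] at h
  have h1 : ∀ u : OneParticle, (⟪u, u⟫_ℂ).re = ‖u‖ ^ 2 := inner_self_eq_norm_sq (𝕜 := ℂ)
  rw [h1, h1] at h
  exact (pow_left_inj₀ (norm_nonneg _) (norm_nonneg _) two_ne_zero).1 h

theorem continuous_conjugation : Continuous conjugation :=
  (Isometry.of_dist_eq fun u v => by
    rw [dist_eq_norm, dist_eq_norm, ← conjugation_sub, norm_conjugation]).continuous

theorem conjugation_conjugation (v : OneParticle) : conjugation (conjugation v) = v := by
  refine Lp.ext ?_
  filter_upwards [conjugation_ae (conjugation v), ae_neg (conjugation_ae v)] with k h1 h2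
  rw [h1, h2, neg_neg, Complex.conj_conj]

theorem conjugation_real_smul (c : ℝ) (v : OneParticle) :
    conjugation ((c : ℂ) • v) = (c : ℂ) • conjugation v := by
  rw [conjugation_smul, Complex.conj_ofReal]

theorem inner_im_eq_zero_of_even {u v : OneParticle} (hu : conjugation u = u)
    (hv : conjugation v = v) : (⟪u, v⟫_ℂ).im = 0 := by
  have h := inner_conjugation u v
  rw [hu, hv] at h
  exact Complex.conj_eq_iff_im.1 h.symm

theorem inner_im_eq_zero_of_odd {u v : OneParticle} (hu : conjugation u = -u)
    (hv : conjugation v = -v) : (⟪u, v⟫_ℂ).im = 0 := by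
  have h := inner_conjugation u v
  rw [hu, hv, inner_neg_neg] at h
  exact Complex.conj_eq_iff_im.1 h.symm

theorem IsIRBounded.conjugation {v : OneParticle} (hv : IsIRBounded v) :
    IsIRBounded (conjugation v) := by
  obtain ⟨C, hC, hb⟩ := hv
  refine ⟨C, hC, ?_⟩
  filter_upwards [ae_neg hb, conjugation_ae v] with k h1 h2
  rw [h2, RCLike.norm_conj]
  simpa [irWeight] using h1

theorem IsIRBounded.lp_add {u v : OneParticle} (hu : IsIRBounded u) (hv : IsIRBounded v) :
    IsIRBounded (u + v : OneParticle) := (hu.add hv).congr (Lp.coeFn_add u v)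

theorem IsIRBounded.lp_smul {v : OneParticle} (hv : IsIRBounded v) (c : ℂ) :
    IsIRBounded (c • v : OneParticle) := (hv.const_mul c).congr (Lp.coeFn_smul c v)

theorem IsIRBounded.lp_sub {u v : OneParticle} (hu : IsIRBounded u) (hv : IsIRBounded v) :
    IsIRBounded (u - v : OneParticle) := by
  have := hu.lp_add (hv.lp_smul (-1))
  rwa [neg_one_smul, ← sub_eq_add_neg] at this

/-! ### The operators `T₁`, `T₂` and `T` -/

theorem aboveSubspace_anti {ε δ : ℝ} (h : ε ≤ δ) : aboveSubspace δ ≤ aboveSubspace ε := by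
  intro v hv
  rw [mem_aboveSubspace] at hv ⊢
  filter_upwards [hv] with k hk hkε using hk (hkε.trans_le h)

namespace InfravacuumData

variable (D : InfravacuumData)

theorem strictAnti_ε : StrictAnti D.ε := strictAnti_nat_of_succ_lt D.ε_anti

theorem Q_apply_shell (i : ℕ) (v : OneParticle) :
    D.Q i (cutoff (D.ε (i + 1)) v - cutoff (D.ε i) v) = D.Q i v :=
  congrArg (fun A : OneParticle →L[ℂ] OneParticle => A v) (D.Q_shell i)

theorem shell_Q_apply (i : ℕ) (v : OneParticle) :
    cutoff (D.ε (i + 1)) (D.Q i v) - cutoff (D.ε i) (D.Q i v) = D.Q i v := by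
  have h := congrArg star (D.Q_shell i)
  have hP : ∀ ε, star (cutoff ε) = cutoff ε := fun ε =>
    (isSelfAdjoint_starProjection (aboveSubspace ε)).star_eq
  rw [star_mul, star_sub, hP, hP, (D.Q_proj i).isSelfAdjoint.star_eq] at h
  exact congrArg (fun A : OneParticle →L[ℂ] OneParticle => A v) h

theorem norm_Q_apply_le (i : ℕ) (v : OneParticle) : ‖D.Q i v‖ ≤ ‖v - cutoff (D.ε i) v‖ := by
  have h1 : cutoff (D.ε (i + 1)) (cutoff (D.ε i) v) = cutoff (D.ε i) v :=
    Submodule.starProjection_eq_self_iff.2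
      (aboveSubspace_anti (D.ε_anti i).le (Submodule.starProjection_apply_mem _ _))
  have h2 : D.Q i v = D.Q i (cutoff (D.ε (i + 1)) (v - cutoff (D.ε i) v)) := by
    rw [map_sub, h1, D.Q_apply_shell]
  rw [h2]
  calc ‖D.Q i (cutoff (D.ε (i + 1)) (v - cutoff (D.ε i) v))‖
      ≤ 1 * ‖cutoff (D.ε (i + 1)) (v - cutoff (D.ε i) v)‖ :=
        (D.Q i).le_of_opNorm_le (D.Q_proj i).norm_le _
    _ ≤ ‖v - cutoff (D.ε i) v‖ := by
        rw [one_mul]; exact Submodule.norm_starProjection_apply_le _ _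

theorem inner_Q_apply_left (i : ℕ) (u v : OneParticle) :
    ⟪D.Q i u, v⟫_ℂ = ⟪D.Q i u, D.Q i v⟫_ℂ := by
  have h1 : D.Q i (D.Q i u) = D.Q i u :=
    congrArg (fun A : OneParticle →L[ℂ] OneParticle => A u) (D.Q_proj i).isIdempotentElem
  have h2 := (D.Q_proj i).isSelfAdjoint.star_eq
  rw [ContinuousLinearMap.star_eq_adjoint] at h2
  conv_rhs => rw [← ContinuousLinearMap.adjoint_inner_left, h2, h1]

theorem inner_Q_apply_of_lt {i j : ℕ} (hij : i < j) (u v : OneParticle) :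
    ⟪D.Q i u, D.Q j v⟫_ℂ = 0 := by
  have h1 : D.Q i u ∈ aboveSubspace (D.ε (i + 1)) := by
    rw [← D.shell_Q_apply i u]
    exact Submodule.sub_mem _ (Submodule.starProjection_apply_mem _ _)
      (aboveSubspace_anti (D.ε_anti i).le (Submodule.starProjection_apply_mem _ _))
  have h2 : D.Q i u ∈ aboveSubspace (D.ε j) :=
    aboveSubspace_anti (D.strictAnti_ε.antitone hij) h1
  have h3 : D.Q i u ∈ aboveSubspace (D.ε (j + 1)) :=
    aboveSubspace_anti (D.ε_anti j).le h2
  have h4 : ∀ ε w, D.Q i u ∈ aboveSubspace ε → ⟪D.Q i u, cutoff ε w⟫_ℂ = ⟪D.Q i u, w⟫_ℂ := by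
    intro ε w hw
    rw [cutoff, ← Submodule.inner_starProjection_left_eq_right,
      Submodule.starProjection_eq_self_iff.2 hw]
  rw [← D.shell_Q_apply j v, inner_sub_right, h4 _ _ h3, h4 _ _ h2, sub_self]

theorem inner_Q_apply_of_ne {i j : ℕ} (hij : i ≠ j) (u v : OneParticle) :
    ⟪D.Q i u, D.Q j v⟫_ℂ = 0 := by
  rcases hij.lt_or_gt with h | h
  · exact D.inner_Q_apply_of_lt h u v
  · rw [← inner_conj_symm, D.inner_Q_apply_of_lt h, map_zero]

/-- The operator `1 + ∑ᵢ cᵢ Qᵢ`, of which `T₁` and `T₂` are special cases. -/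
def diagonal (c : ℕ → ℝ) (v : OneParticle) : OneParticle := v + ∑' i, (c i : ℂ) • D.Q i v

variable {D} in
/-- The series for `T₁` and `T₂` converge absolutely on the functions with the infrared behaviour of
the observables: there `‖Qᵢ v‖` is of order `εᵢ`, and `∑ εᵢ / bᵢ²` over the `i` with `Qᵢ ≠ 0`
converges. -/
theorem summable_smul_Q {c : ℕ → ℝ} (hc : ∀ i, |c i| ≤ 1 / D.b i ^ 2) {v : OneParticle}
    (hv : IsIRBounded v) : Summable fun i => (c i : ℂ) • D.Q i v := by
  obtain ⟨C, hC, hb⟩ := exists_norm_sub_cutoff_le hv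
  refine Summable.of_norm_bounded (D.summable_energy.mul_left C) fun i => ?_
  have hε := D.ε_pos i
  have hbi := D.b_pos i
  by_cases h0 : D.Q i v = 0
  · rw [h0, smul_zero, norm_zero]; positivity
  have := D.Q_fin i
  have hr : (1 : ℝ) ≤ Module.finrank ℂ (LinearMap.range (D.Q i).toLinearMap) := by
    have : Nontrivial (LinearMap.range (D.Q i).toLinearMap) :=
      ⟨⟨⟨D.Q i v, v, rfl⟩, 0, fun h => h0 (congrArg Subtype.val h)⟩⟩
    exact_mod_cast Module.finrank_pos (R := ℂ) (M := LinearMap.range (D.Q i).toLinearMap)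
  rw [norm_smul, Complex.norm_real, Real.norm_eq_abs]
  calc |c i| * ‖D.Q i v‖ ≤ 1 / D.b i ^ 2 * (C * D.ε i) := by
        gcongr
        · exact hc i
        · exact (D.norm_Q_apply_le i v).trans (hb _ hε)
    _ = C * (D.ε i / D.b i ^ 2 * 1) := by ring
    _ ≤ _ := by gcongr

theorem inner_diagonal {c d : ℕ → ℝ} (hc : ∀ i, |c i| ≤ 1 / D.b i ^ 2)
    (hd : ∀ i, |d i| ≤ 1 / D.b i ^ 2) (hcd : ∀ i, c i + d i + c i * d i = 0) {u v : OneParticle}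
    (hu : IsIRBounded u) (hv : IsIRBounded v) :
    ⟪D.diagonal c u, D.diagonal d v⟫_ℂ = ⟪u, v⟫_ℂ := by
  let q : ℕ → ℂ := fun i => ⟪D.Q i u, D.Q i v⟫_ℂ
  let A := ∑' i, (c i : ℂ) • D.Q i u
  let B := ∑' i, (d i : ℂ) • D.Q i v
  have hA : HasSum (fun i => (c i : ℂ) • D.Q i u) A := (summable_smul_Q hc hu).hasSum
  have hB : HasSum (fun i => (d i : ℂ) • D.Q i v) B := (summable_smul_Q hd hv).hasSum
  have hAw : ∀ w, HasSum (fun i => (c i : ℂ) * ⟪D.Q i u, w⟫_ℂ) ⟪A, w⟫_ℂ := by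
    intro w
    have h := (hA.mapL (innerSL ℂ w)).map (starRingEnd ℂ) Complex.continuous_conj
    simp only [Function.comp_def, innerSL_apply_apply, inner_conj_symm] at h
    refine h.congr_fun fun i => ?_
    rw [inner_smul_left, Complex.conj_ofReal]
  have hwB : ∀ w, HasSum (fun i => (d i : ℂ) * ⟪w, D.Q i v⟫_ℂ) ⟪w, B⟫_ℂ := by
    intro w
    refine (hB.mapL (innerSL ℂ w)).congr_fun fun i => ?_
    rw [innerSL_apply_apply, inner_smul_right]
  have h1 : HasSum (fun i => (c i : ℂ) * q i) ⟪A, v⟫_ℂ :=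
    (hAw v).congr_fun fun i => by rw [D.inner_Q_apply_left]
  have h2 : HasSum (fun i => (d i : ℂ) * q i) ⟪u, B⟫_ℂ :=
    (hwB u).congr_fun fun i => by
      rw [← inner_conj_symm u, D.inner_Q_apply_left, inner_conj_symm]
  have h3 : HasSum (fun i => (c i * d i : ℂ) * q i) ⟪A, B⟫_ℂ := by
    refine (hAw B).congr_fun fun i => ?_
    rw [mul_assoc]
    congr 1
    refine (hwB (D.Q i u)).unique (hasSum_single i fun j hj => ?_) |>.symm
    rw [D.inner_Q_apply_of_ne hj.symm, mul_zero]
  have h4 : ⟪A, v⟫_ℂ + ⟪u, B⟫_ℂ + ⟪A, B⟫_ℂ = 0 := by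
    refine ((h1.add h2).add h3).unique (hasSum_zero.congr_fun fun i => ?_)
    have : (c i : ℂ) + d i + c i * d i = 0 := by exact_mod_cast hcd i
    linear_combination q i * this
  change ⟪u + A, v + B⟫_ℂ = _
  rw [inner_add_left, inner_add_right, inner_add_right]
  linear_combination h4

theorem conjugation_diagonal {c : ℕ → ℝ} (hc : ∀ i, |c i| ≤ 1 / D.b i ^ 2) {v : OneParticle}
    (hv : IsIRBounded v) : conjugation (D.diagonal c v) = D.diagonal c (conjugation v) := by
  let φ : OneParticle →+ OneParticle :=
    { toFun := conjugation, map_zero' := conjugation_zero, map_add' := conjugation_add }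
  have h := (summable_smul_Q hc hv).hasSum.map φ continuous_conjugation
  rw [diagonal, conjugation_add, diagonal]
  congr 1
  refine h.tsum_eq.symm.trans (tsum_congr fun i => ?_)
  change conjugation _ = _
  rw [conjugation_real_smul, D.Q_conj]

theorem diagonal_neg (c : ℕ → ℝ) (v : OneParticle) : D.diagonal c (-v) = -D.diagonal c v := by
  simp only [diagonal, map_neg, smul_neg, tsum_neg, neg_add]

theorem abs_coeff_T₁_le (i : ℕ) : |D.b i - 1| ≤ 1 / D.b i ^ 2 := by
  have h0 := D.b_pos i
  have h1 := D.b_lt_one i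
  rw [abs_of_nonpos (by linarith), le_div_iff₀ (by positivity)]
  nlinarith [pow_le_one₀ (n := 2) h0.le h1.le, pow_pos h0 2]

theorem abs_coeff_T₂_le (i : ℕ) : |1 / D.b i - 1| ≤ 1 / D.b i ^ 2 := by
  have h0 := D.b_pos i
  have h1 := D.b_lt_one i
  have h2 : 1 ≤ 1 / D.b i := by rw [one_le_div h0]; exact h1.le
  rw [abs_of_nonneg (by linarith), ← one_div_pow]
  nlinarith

/-- `T` is symplectic: for `g` with even part `g₁` and odd part `g₂`, the symplectic form of
`T g = T₂ g₁ + T₁ g₂` with `T f` is that of `g` with `f`. -/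
theorem im_inner_T {g₁ g₂ f : OneParticle} (hg₁ : IsIRBounded g₁) (hg₂ : IsIRBounded g₂)
    (h₁ : conjugation g₁ = g₁) (h₂ : conjugation g₂ = -g₂) (hf : IsIRBounded f) :
    (⟪D.T₂ g₁ + D.T₁ g₂, D.T f⟫_ℂ).im = (⟪g₁ + g₂, f⟫_ℂ).im := by
  let f₁ : OneParticle := (1 / 2 : ℂ) • (f + conjugation f)
  let f₂ : OneParticle := (1 / 2 : ℂ) • (f - conjugation f)
  have hhalf : conj (1 / 2 : ℂ) = 1 / 2 := by
    rw [map_div₀, map_one, map_ofNat]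
  have hf₁ : IsIRBounded f₁ := (hf.lp_add hf.conjugation).lp_smul _
  have hf₂ : IsIRBounded f₂ := (hf.lp_sub hf.conjugation).lp_smul _
  have he : conjugation f₁ = f₁ := by
    rw [conjugation_smul, conjugation_add, conjugation_conjugation, hhalf, add_comm]
  have ho : conjugation f₂ = -f₂ := by
    rw [conjugation_smul, conjugation_sub, conjugation_conjugation, hhalf, ← smul_neg, neg_sub]
  have hff : f = f₁ + f₂ := by
    rw [← smul_add, add_add_sub_cancel, ← two_smul ℂ f, smul_smul]
    norm_num
  have ha := D.abs_coeff_T₁_le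
  have hb := D.abs_coeff_T₂_le
  have hne : ∀ i, (D.b i : ℝ) ≠ 0 := fun i => (D.b_pos i).ne'
  have e1 : conjugation (D.T₂ g₁) = D.T₂ g₁ := by
    have := D.conjugation_diagonal hb hg₁
    rwa [h₁] at this
  have e2 : conjugation (D.T₂ f₁) = D.T₂ f₁ := by
    have := D.conjugation_diagonal hb hf₁
    rwa [he] at this
  have o1 : conjugation (D.T₁ g₂) = -D.T₁ g₂ := by
    have := D.conjugation_diagonal ha hg₂
    rwa [h₂, diagonal_neg] at this
  have o2 : conjugation (D.T₁ f₂) = -D.T₁ f₂ := by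
    have := D.conjugation_diagonal ha hf₂
    rwa [ho, diagonal_neg] at this
  have s1 : ⟪D.T₂ g₁, D.T₁ f₂⟫_ℂ = ⟪g₁, f₂⟫_ℂ :=
    D.inner_diagonal hb ha (fun i => by have := hne i; field_simp; ring) hg₁ hf₂
  have s2 : ⟪D.T₁ g₂, D.T₂ f₁⟫_ℂ = ⟪g₂, f₁⟫_ℂ :=
    D.inner_diagonal ha hb (fun i => by have := hne i; field_simp; ring) hg₂ hf₁
  have hT : D.T f = D.T₂ f₁ + D.T₁ f₂ := rfl
  rw [hT]
  conv_rhs => rw [hff]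
  simp only [inner_add_left, inner_add_right, Complex.add_im]
  rw [inner_im_eq_zero_of_even e1 e2, inner_im_eq_zero_of_odd o1 o2, s1, s2,
    inner_im_eq_zero_of_even h₁ he, inner_im_eq_zero_of_odd h₂ ho]

/-- `T` acts trivially on the real wave functions that are orthogonal to the ranges of the `Qᵢ`. -/
theorem T_eq_self {f : OneParticle} (hf : conjugation f = f) (hQ : ∀ i, D.Q i f = 0) :
    D.T f = f := by
  have h1 : (1 / 2 : ℂ) • (f + conjugation f) = f := by
    rw [hf, ← two_smul ℂ f, smul_smul]; norm_num
  have h2 : (1 / 2 : ℂ) • (f - conjugation f) = 0 := by rw [hf, sub_self, smul_zero]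
  rw [T, h1, h2, T₂, T₁]
  simp [hQ]

end InfravacuumData

/-! ### Spherical means of solid harmonics -/

/-- Integration in polar coordinates of a product of a radial and an angular function. -/
theorem integral_radial_mul_angular (A : ℝ → ℂ) (G : R3 → ℂ) :
    ∫ k : R3, A ‖k‖ * G (‖k‖⁻¹ • k) =
      (∫ θ : Metric.sphere (0 : R3) 1, G θ ∂(volume : Measure R3).toSphere) *
        ∫ r : Set.Ioi (0 : ℝ), A r ∂(Measure.volumeIoiPow 2) := by
  calc ∫ k : R3, A ‖k‖ * G (‖k‖⁻¹ • k)
      = ∫ k : ({(0)}ᶜ : Set R3), A ‖k.1‖ * G (‖k.1‖⁻¹ • k.1)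
          ∂((volume : Measure R3).comap (↑)) := by
        rw [integral_subtype_comap (measurableSet_singleton _).compl
          fun k : R3 => A ‖k‖ * G (‖k‖⁻¹ • k), restrict_compl_singleton]
    _ = ∫ x, G x.1 * A x.2 ∂((volume : Measure R3).toSphere.prod (.volumeIoiPow 2)) := by
        have h := (volume : Measure R3).measurePreserving_homeomorphUnitSphereProd.integral_comp
          (Homeomorph.measurableEmbedding _)
          (fun x : Metric.sphere (0 : R3) 1 × Set.Ioi (0 : ℝ) => G x.1 * A x.2)
        simp only [finrank_euclideanSpace, Fintype.card_fin] at h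
        rw [← h]
        refine integral_congr_ae (Filter.Eventually.of_forall fun k => ?_)
        simp [mul_comm]
    _ = _ := integral_prod_mul (fun θ : Metric.sphere (0 : R3) 1 => G θ)
        (fun r : Set.Ioi (0 : ℝ) => A r)

/-- A complex polynomial as a function on momentum space. -/
def polyFun (p : MvPolynomial (Fin 3) ℂ) (k : R3) : ℂ := MvPolynomial.eval (fun j => (k j : ℂ)) p

theorem continuous_polyFun (p : MvPolynomial (Fin 3) ℂ) : Continuous (polyFun p) := by
  unfold polyFun
  exact (MvPolynomial.continuous_eval p).comp (by fun_prop)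

theorem hasLineDerivAt_polyFun (p : MvPolynomial (Fin 3) ℂ) (j : Fin 3) (k : R3) :
    HasLineDerivAt ℝ (polyFun p) (polyFun (MvPolynomial.pderiv j p) k) k
      (EuclideanSpace.single j 1) := by
  unfold HasLineDerivAt polyFun
  induction p using MvPolynomial.induction_on with
  | C a => simpa using hasDerivAt_const (0 : ℝ) a
  | add p q hp hq => simp only [map_add]; exact hp.add hq
  | mul_X p i hp =>
    have hX : HasDerivAt (fun t : ℝ => (((k + t • EuclideanSpace.single j (1 : ℝ)) i : ℝ) : ℂ))
        (if i = j then 1 else 0) 0 := by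
      have h1 : HasDerivAt (fun t : ℝ => k i + t * (if i = j then 1 else 0))
          (if i = j then 1 else 0) 0 := by
        simpa using ((hasDerivAt_id (0 : ℝ)).mul_const (if i = j then (1 : ℝ) else 0)).const_add (k i)
      have h2 := h1.ofReal_comp
      refine (h2.congr_of_eventuallyEq (Filter.Eventually.of_forall fun t => ?_)).congr_deriv ?_
      · simp
      · split_ifs <;> simp
    have := hp.mul hX
    simp only [map_mul, MvPolynomial.eval_X, Derivation.leibniz, MvPolynomial.pderiv_X, smul_eq_mul,
      map_add, zero_smul, add_zero] at this ⊢
    refine this.congr_deriv ?_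
    by_cases hij : i = j
    · subst hij; simp; ring
    · simp [hij]; ring

theorem hasDerivAt_max_sq (t : ℝ) : HasDerivAt (fun t : ℝ => max t 0 ^ 2) (2 * max t 0) t := by
  rcases lt_trichotomy t 0 with h | h | h
  · rw [max_eq_right h.le, mul_zero]
    refine (hasDerivAt_const t (0 : ℝ)).congr_of_eventuallyEq ?_
    filter_upwards [gt_mem_nhds h] with s hs
    rw [max_eq_right hs.le]; norm_num
  · subst h
    rw [max_self, mul_zero, hasDerivAt_iff_isLittleO_nhds_zero]
    simp only [zero_add, max_self, smul_zero, sub_zero, ne_eq, OfNat.ofNat_ne_zero,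
      not_false_eq_true, zero_pow]
    refine Asymptotics.IsBigO.trans_isLittleO (g := fun h : ℝ => h ^ 2) ?_ ?_
    · refine Asymptotics.isBigO_of_le _ fun s => ?_
      rw [norm_pow, norm_pow]
      gcongr
      rw [Real.norm_of_nonneg (le_max_right _ _)]
      exact max_le (le_abs_self s) (abs_nonneg s)
    · exact Asymptotics.isLittleO_pow_id one_lt_two
  · rw [max_eq_left h.le]
    have h1 : HasDerivAt (fun s : ℝ => s ^ 2) (2 * t) t := by simpa using hasDerivAt_pow 2 t
    refine h1.congr_of_eventuallyEq ?_
    filter_upwards [lt_mem_nhds h] with s hs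
    rw [max_eq_left hs.le]

/-- The radial cutoff `max (1 - |k|²) 0`; its square is continuously differentiable, with the gradient
`-4 k max (1 - |k|²) 0`. -/
def bumpWeight (k : R3) : ℝ := max (1 - ‖k‖ ^ 2) 0

theorem continuous_bumpWeight : Continuous bumpWeight := by unfold bumpWeight; fun_prop

theorem hasCompactSupport_bumpWeight : HasCompactSupport bumpWeight := by
  refine HasCompactSupport.of_support_subset_isCompact (isCompact_closedBall (0 : R3) 1) ?_
  intro k hk
  rw [mem_closedBall_zero_iff]
  by_contra! h
  refine hk ?_
  rw [bumpWeight, max_eq_right]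
  nlinarith

theorem hasLineDerivAt_bumpWeight_sq (j : Fin 3) (k : R3) :
    HasLineDerivAt ℝ (fun k => ((bumpWeight k ^ 2 : ℝ) : ℂ)) (-4 * (k j : ℂ) * (bumpWeight k : ℂ)) k
      (EuclideanSpace.single j 1) := by
  unfold HasLineDerivAt bumpWeight
  have h1 : HasDerivAt (fun t : ℝ => 1 - ‖k + t • EuclideanSpace.single j (1 : ℝ)‖ ^ 2)
      (-(2 * k j)) 0 := by
    have h2 : HasDerivAt (fun t : ℝ => k + t • EuclideanSpace.single j (1 : ℝ))
        (EuclideanSpace.single j (1 : ℝ)) 0 := by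
      simpa using ((hasDerivAt_id (0 : ℝ)).smul_const (EuclideanSpace.single j (1 : ℝ))).const_add k
    have h3 := h2.norm_sq.const_sub 1
    simpa [EuclideanSpace.inner_single_right] using h3
  have h4 := ((hasDerivAt_max_sq _).comp (0 : ℝ) h1).ofReal_comp
  refine h4.congr_deriv ?_
  simp only [zero_smul, add_zero]
  push_cast
  ring

/-- Integration by parts against the radial weight shows that a homogeneous harmonic polynomial of
positive degree `l` has weighted mean zero: with Euler's identity `l p = k · ∇p`,
`-4 l ∫ p w = ∫ ∇p · ∇w² = -∫ (Δp) w² = 0`. -/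
theorem integral_polyFun_mul_bumpWeight {l : ℕ} (hl : 0 < l) {p : MvPolynomial (Fin 3) ℂ}
    (hp : IsSolidHarmonic l p) : ∫ k, polyFun p k * (bumpWeight k : ℂ) = 0 := by
  have hint : ∀ f : R3 → ℂ, Continuous f → ∀ w : R3 → ℂ, Continuous w → HasCompactSupport w →
      Integrable fun k => f k * w k := fun f hf w hw hws =>
    (hf.mul hw).integrable_of_hasCompactSupport hws.mul_left
  let w : R3 → ℂ := fun k => (bumpWeight k : ℂ)
  let χ : R3 → ℂ := fun k => ((bumpWeight k ^ 2 : ℝ) : ℂ)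
  have hw : Continuous w := Complex.continuous_ofReal.comp continuous_bumpWeight
  have hws : HasCompactSupport w := hasCompactSupport_bumpWeight.comp_left Complex.ofReal_zero
  have hχ : Continuous χ := Complex.continuous_ofReal.comp (continuous_bumpWeight.pow 2)
  have hχs : HasCompactSupport χ :=
    hasCompactSupport_bumpWeight.comp_left (g := fun x : ℝ => ((x ^ 2 : ℝ) : ℂ)) (by simp)
  have hkj : ∀ j : Fin 3, Continuous fun k : R3 => -4 * (k j : ℂ) * w k := fun j => by fun_prop
  have hparts : ∀ j : Fin 3,
      ∫ k, polyFun (MvPolynomial.pderiv j p) k * (-4 * (k j : ℂ) * w k) =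
        -∫ k, polyFun (MvPolynomial.pderiv j (MvPolynomial.pderiv j p)) k * χ k := by
    intro j
    exact integral_bilinear_hasLineDerivAt_right_eq_neg_left_of_integrable
      (B := ContinuousLinearMap.mul ℝ ℂ) (v := EuclideanSpace.single j (1 : ℝ))
      (hint _ (continuous_polyFun _) _ hχ hχs)
      (hint _ (continuous_polyFun _) _ (hkj j) hws.mul_left)
      (hint _ (continuous_polyFun _) _ hχ hχs)
      (fun k _ => hasLineDerivAt_polyFun _ j k) (fun k _ => hasLineDerivAt_bumpWeight_sq j k)
  have hsum := Finset.sum_congr (rfl : (Finset.univ : Finset (Fin 3)) = _) fun j _ => hparts j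
  rw [Finset.sum_neg_distrib, ← integral_finsetSum _ fun j _ =>
      hint _ (continuous_polyFun _) _ (hkj j) hws.mul_left,
    ← integral_finsetSum _ fun j _ => hint _ (continuous_polyFun _) _ hχ hχs] at hsum
  have e1 : ∀ k, ∑ j, polyFun (MvPolynomial.pderiv j (MvPolynomial.pderiv j p)) k * χ k = 0 := by
    intro k
    have := congrArg (fun q => polyFun q k) hp.2
    simp only [polyFun, map_sum, map_zero] at this ⊢
    rw [← Finset.sum_mul, this, zero_mul]
  have e2 : ∀ k, ∑ j, polyFun (MvPolynomial.pderiv j p) k * (-4 * (k j : ℂ) * w k) =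
      (-4 * l : ℂ) * (polyFun p k * w k) := by
    intro k
    have := congrArg (fun q => polyFun q k) hp.1.sum_X_mul_pderiv
    simp only [polyFun, map_sum, map_mul, MvPolynomial.eval_X, nsmul_eq_mul,
      map_natCast] at this ⊢
    rw [mul_assoc, ← mul_assoc (l : ℂ), ← this, Finset.sum_mul, Finset.mul_sum]
    exact Finset.sum_congr rfl fun j _ => by ring
  simp only [e1, e2, integral_zero, neg_zero, integral_const_mul] at hsum
  refine (mul_eq_zero.1 hsum).resolve_left ?_
  have : (l : ℂ) ≠ 0 := by exact_mod_cast hl.ne'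
  exact mul_ne_zero (by norm_num) this

theorem polyFun_smul {l : ℕ} {p : MvPolynomial (Fin 3) ℂ} (hp : p.IsHomogeneous l) (c : ℝ)
    (k : R3) : polyFun p (c • k) = (c : ℂ) ^ l * polyFun p k := by
  simp only [polyFun, MvPolynomial.eval_eq, Finset.mul_sum]
  refine Finset.sum_congr rfl fun d hd => ?_
  have hd' : ∑ i ∈ d.support, d i = l := by
    rw [← Finsupp.degree_apply]
    by_contra h
    exact MvPolynomial.mem_support_iff.1 hd (hp.coeff_eq_zero h)
  rw [← hd', ← Finset.prod_pow_eq_pow_sum, mul_left_comm, ← Finset.prod_mul_distrib]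
  congr 1
  refine Finset.prod_congr rfl fun i _ => ?_
  simp [mul_pow]

/-- The spherical mean of a solid harmonic of positive degree vanishes. -/
theorem integral_sphere_polyFun {l : ℕ} (hl : 0 < l) {p : MvPolynomial (Fin 3) ℂ}
    (hp : IsSolidHarmonic l p) :
    ∫ θ : Metric.sphere (0 : R3) 1, polyFun p θ ∂(volume : Measure R3).toSphere = 0 := by
  let A : ℝ → ℂ := fun r => ((r ^ l * max (1 - r ^ 2) 0 : ℝ) : ℂ)
  have h1 := integral_radial_mul_angular A (polyFun p)
  have h2 : ∫ k : R3, A ‖k‖ * polyFun p (‖k‖⁻¹ • k) = 0 := by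
    rw [← integral_polyFun_mul_bumpWeight hl hp]
    refine integral_congr_ae ?_
    filter_upwards [ae_ne_zero] with k hk
    have hk' : ‖k‖ ≠ 0 := norm_ne_zero_iff.2 hk
    have h3 : polyFun p k = (‖k‖ : ℂ) ^ l * polyFun p (‖k‖⁻¹ • k) := by
      rw [← polyFun_smul hp.1, smul_smul, mul_inv_cancel₀ hk', one_smul]
    rw [h3]
    simp only [A, bumpWeight]
    push_cast
    ring
  rw [h2] at h1
  refine (mul_eq_zero.1 h1.symm).resolve_right fun h3 => ?_
  -- The radial integral is nonzero, since `A` is the radial part of a nonnegative function.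
  have h4 := integral_radial_mul_angular A fun _ => 1
  rw [h3, mul_zero] at h4
  simp only [mul_one] at h4
  have h5 : ∫ k : R3, ‖k‖ ^ l * bumpWeight k = 0 := by
    have : ((∫ k : R3, ‖k‖ ^ l * bumpWeight k : ℝ) : ℂ) = 0 := by
      rw [← integral_complex_ofReal]; exact h4
    exact_mod_cast this
  have hc : Continuous fun k : R3 => ‖k‖ ^ l * bumpWeight k :=
    (continuous_norm.pow l).mul continuous_bumpWeight
  refine (hc.integral_pos_of_hasCompactSupport_nonneg_nonzero
    hasCompactSupport_bumpWeight.mul_left (fun k => ?_)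
    (x := EuclideanSpace.single 0 (1 / 2 : ℝ)) ?_).ne' h5
  · exact mul_nonneg (by positivity) (le_max_right _ _)
  · have : ‖(EuclideanSpace.single 0 (1 / 2 : ℝ) : R3)‖ = 1 / 2 := by simp
    simp only [bumpWeight, this]
    norm_num

/-- Rotation invariant functions are orthogonal to the shell harmonics. -/
theorem inner_shellHarmonics_eq_zero {a b : ℝ} {N : ℕ} {u : OneParticle}
    (hu : u ∈ shellHarmonics a b N) {f : OneParticle} {F : ℝ → ℂ}
    (hf : f =ᵐ[volume] fun k => F ‖k‖) : ⟪u, f⟫_ℂ = 0 := by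
  induction hu using Submodule.span_induction with
  | mem u hu =>
    obtain ⟨l, p, hl, -, hp, hup⟩ := hu
    let A : ℝ → ℂ := fun r =>
      (Set.Icc a b).indicator (fun r : ℝ => ((r ^ (-3 / 2 : ℝ) : ℝ) : ℂ)) r * conj (F r)
    have h1 := integral_radial_mul_angular A (polyFun p)
    rw [integral_sphere_polyFun hl hp, zero_mul] at h1
    have h2 : ⟪f, u⟫_ℂ = 0 := by
      rw [L2.inner_def, ← h1]
      refine integral_congr_ae ?_
      filter_upwards [hup, hf] with k h3 h4
      rw [h3, h4, RCLike.inner_apply]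
      have h5 : polyFun p (‖k‖⁻¹ • k) =
          MvPolynomial.eval (fun j => ((k j / ‖k‖ : ℝ) : ℂ)) p := by
        simp only [polyFun, PiLp.smul_apply, smul_eq_mul, div_eq_inv_mul]
      by_cases hk : a ≤ ‖k‖ ∧ ‖k‖ ≤ b
      · simp only [A]
        rw [Set.indicator_of_mem (show k ∈ {k : R3 | a ≤ ‖k‖ ∧ ‖k‖ ≤ b} from hk),
          Set.indicator_of_mem (show ‖k‖ ∈ Set.Icc a b from hk), h5, omegaPow]
        ring
      · simp only [A]
        rw [Set.indicator_of_notMem (show k ∉ {k : R3 | a ≤ ‖k‖ ∧ ‖k‖ ≤ b} from hk),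
          Set.indicator_of_notMem (show ‖k‖ ∉ Set.Icc a b from hk)]
        ring
    rw [← inner_conj_symm, h2, map_zero]
  | zero => exact inner_zero_left _
  | add u v _ _ h1 h2 => rw [inner_add_left, h1, h2, add_zero]
  | smul c u _ h1 => rw [inner_smul_left, h1, mul_zero]

theorem InfravacuumData.IsKPRLike.Q_apply_radial {D : InfravacuumData} (hD : D.IsKPRLike)
    {f : OneParticle} {F : ℝ → ℂ} (hf : f =ᵐ[volume] fun k => F ‖k‖) (i : ℕ) : D.Q i f = 0 := by
  have h1 : D.Q i f ∈ shellHarmonics (D.ε (i + 1)) (D.ε i) (i + 1) := by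
    rw [← hD.range_Q i]; exact ⟨f, rfl⟩
  have h2 := inner_shellHarmonics_eq_zero h1 hf
  rw [D.inner_Q_apply_left] at h2
  exact inner_self_eq_zero.1 h2

/-! ### A rotation invariant test function -/

/-- A rotation invariant bump function with values in `[0, 1]`. -/
def radialBump (x : R3) : ℝ := Real.smoothTransition (1 - ‖x‖ ^ 2)

theorem contDiff_radialBump : ContDiff ℝ ∞ radialBump :=
  Real.smoothTransition.contDiff.comp (contDiff_const.sub (contDiff_norm_sq ℝ))

theorem hasCompactSupport_radialBump : HasCompactSupport radialBump := by
  refine HasCompactSupport.of_support_subset_isCompact (isCompact_closedBall (0 : R3) 1) ?_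
  intro x hx
  rw [mem_closedBall_zero_iff]
  by_contra! h
  exact hx (Real.smoothTransition.zero_of_nonpos (by nlinarith))

theorem radialBump_mem : radialBump ∈ testFunctions Set.univ :=
  ⟨contDiff_radialBump, hasCompactSupport_radialBump, Set.subset_univ _⟩

theorem integral_radialBump_pos : 0 < ∫ x, radialBump x := by
  refine contDiff_radialBump.continuous.integral_pos_of_hasCompactSupport_nonneg_nonzero
    hasCompactSupport_radialBump (fun x => Real.smoothTransition.nonneg _) (x := 0) ?_
  simp [radialBump, Real.smoothTransition.one_of_one_le]

theorem fourierHat_comp_linearIsometryEquiv (A : R3 ≃ₗᵢ[ℝ] R3) (h : R3 → ℝ) (k : R3) :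
    fourierHat h (A k) = fourierHat (h ∘ A) k := by
  rw [fourierHat, fourierHat,
    ← A.measurePreserving.integral_comp A.toHomeomorph.measurableEmbedding]
  simp only [A.inner_map_map, Function.comp_apply]

theorem fourierHat_radialBump_eq {k k' : R3} (h : ‖k‖ = ‖k'‖) :
    fourierHat radialBump k = fourierHat radialBump k' := by
  have h1 : radialBump ∘ ((ℝ ∙ (k - k'))ᗮ).reflection = radialBump := by
    ext x
    simp only [Function.comp_apply, radialBump, LinearIsometryEquiv.norm_map]
  rw [← Submodule.reflection_sub h, fourierHat_comp_linearIsometryEquiv, h1]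

theorem fourierHat_radialBump_im (k : R3) : (fourierHat radialBump k).im = 0 := by
  have h := fourierHat_neg radialBump k
  rw [fourierHat_radialBump_eq (norm_neg k)] at h
  exact Complex.conj_eq_iff_im.1 h.symm

/-- There is a test function whose Fourier transform is rotation invariant and nonnegative, namely
the convolution square of a rotation invariant bump function. -/
theorem exists_radial_testFunction :
    ∃ (R : ℝ) (h : R3 → ℝ), 0 < R ∧ h ∈ testFunctions (Metric.ball 0 R) ∧
      (∀ k k' : R3, ‖k‖ = ‖k'‖ → fourierHat h k = fourierHat h k') ∧
      (∀ k, ∃ x : ℝ, 0 ≤ x ∧ fourierHat h k = x) ∧ fourierHat h 0 ≠ 0 := by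
  let φ := radialBump
  let φc : R3 → ℂ := fun x => (radialBump x : ℂ)
  let h : R3 → ℝ := convolution φ φ (ContinuousLinearMap.mul ℝ ℝ) volume
  have hφ := integrable_testFunction radialBump_mem
  have hs : HasCompactSupport h :=
    hasCompactSupport_radialBump.convolution _ hasCompactSupport_radialBump
  obtain ⟨R, hR, hsR⟩ := hs.isCompact.isBounded.subset_ball_lt 0 (0 : R3)
  have hmem : h ∈ testFunctions (Metric.ball 0 R) :=
    ⟨hasCompactSupport_radialBump.contDiff_convolution_right _ hφ.locallyIntegrable
      contDiff_radialBump, hs, hsR⟩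
  have hconv : (fun x => (h x : ℂ)) = convolution φc φc (ContinuousLinearMap.mul ℂ ℂ) volume := by
    ext x
    simp only [h, convolution_def, ContinuousLinearMap.mul_apply', φc]
    rw [← integral_complex_ofReal]
    simp only [Complex.ofReal_mul]
    rfl
  have hsq : ∀ k, fourierHat h k = fourierHat radialBump k ^ 2 := by
    intro k
    rw [fourierHat_eq_fourier, hconv, Real.fourier_mul_convolution_eq (f₁ := φc) (f₂ := φc) hφ.ofReal hφ.ofReal,
      fourierHat_eq_fourier, pow_two]
  refine ⟨R, h, hR, hmem, fun k k' hk => ?_, fun k => ?_, ?_⟩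
  · rw [hsq, hsq, fourierHat_radialBump_eq hk]
  · refine ⟨(fourierHat radialBump k).re ^ 2, by positivity, ?_⟩
    rw [hsq, Complex.ofReal_pow]
    congr 1
    exact Complex.ext rfl (by simp [fourierHat_radialBump_im])
  · rw [hsq, fourierHat_zero]
    exact pow_ne_zero 2 (Complex.ofReal_ne_zero.2 integral_radialBump_pos.ne')

/-! ### Dilations -/

/-- The test function that is spread out to the scale `a`, with amplitude `s a⁻²`. -/
def dilate (s a : ℝ) (h : R3 → ℝ) (x : R3) : ℝ := s * (a ^ 2)⁻¹ * h (a⁻¹ • x)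

theorem dilate_mem_testFunctions {h : R3 → ℝ} {R a : ℝ} (s : ℝ) (ha : 0 < a)
    (hh : h ∈ testFunctions (Metric.ball 0 R)) :
    dilate s a h ∈ testFunctions (Metric.ball 0 (a * R)) := by
  have hcomp : HasCompactSupport fun x : R3 => h (a⁻¹ • x) :=
    hh.2.1.comp_smul (inv_ne_zero ha.ne')
  refine ⟨contDiff_const.mul (hh.1.comp (contDiff_const_smul _)), hcomp.mul_left, ?_⟩
  have h1 : tsupport (dilate s a h) ⊆ (fun x : R3 => a⁻¹ • x) ⁻¹' tsupport h := by
    refine closure_minimal (fun x hx => ?_)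
      ((isClosed_tsupport h).preimage (continuous_const_smul _))
    refine subset_tsupport h fun h0 => hx ?_
    simp [dilate, h0]
  intro x hx
  have h2 := hh.2.2 (h1 hx)
  rw [mem_ball_zero_iff, norm_smul, Real.norm_of_nonneg (inv_nonneg.2 ha.le)] at h2
  rw [mem_ball_zero_iff]
  exact (inv_mul_lt_iff₀ ha).1 h2

theorem fourierHat_dilate (h : R3 → ℝ) (s : ℝ) {a : ℝ} (ha : 0 < a) (k : R3) :
    fourierHat (dilate s a h) k = (s * a : ℝ) * fourierHat h (a • k) := by
  have h1 := Measure.integral_comp_smul (volume : Measure R3)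
    (fun y : R3 => Complex.exp (-I * (⟪a • k, y⟫_ℝ : ℝ)) * (h y : ℂ)) a⁻¹
  have h2 : ∀ x : R3, ⟪a • k, a⁻¹ • x⟫_ℝ = ⟪k, x⟫_ℝ := fun x => by
    rw [inner_smul_left, inner_smul_right, conj_trivial, mul_inv_cancel_left₀ ha.ne']
  simp only [h2, finrank_euclideanSpace, Fintype.card_fin] at h1
  rw [abs_of_nonneg (by positivity), inv_pow, inv_inv, Complex.real_smul] at h1
  have h3 : fourierHat (dilate s a h) k = ((s * (a ^ 2)⁻¹ : ℝ) : ℂ) *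
      ∫ x : R3, Complex.exp (-I * (⟪k, x⟫_ℝ : ℝ)) * (h (a⁻¹ • x) : ℂ) := by
    rw [fourierHat, ← integral_const_mul]
    refine integral_congr_ae (Filter.Eventually.of_forall fun x => ?_)
    simp only [dilate]
    push_cast
    ring
  have ha' : (a : ℂ) ≠ 0 := Complex.ofReal_ne_zero.2 ha.ne'
  rw [h3, h1, fourierHat]
  push_cast
  field_simp

/-- The momentum space function `ω^{-1/2} ĥ` of the dilated test function is the dilated function,
normalised so as to leave the `L²` norm unchanged. -/
theorem omegaPow_mul_fourierHat_dilate (h : R3 → ℝ) (s : ℝ) {a : ℝ} (ha : 0 < a) (k : R3) :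
    omegaPow (-1 / 2) k * fourierHat (dilate s a h) k =
      (s * a ^ (3 / 2 : ℝ) : ℝ) * (omegaPow (-1 / 2) (a • k) * fourierHat h (a • k)) := by
  have h1 : a ^ (3 / 2 : ℝ) * a ^ (-1 / 2 : ℝ) = a := by
    rw [← Real.rpow_add ha]; norm_num
  have h2 : (a : ℂ) = ((a ^ (3 / 2 : ℝ) : ℝ) : ℂ) * ((a ^ (-1 / 2 : ℝ) : ℝ) : ℂ) := by
    rw [← Complex.ofReal_mul, h1]
  rw [fourierHat_dilate h s ha, omegaPow, omegaPow, norm_smul, Real.norm_of_nonneg ha.le,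
    Real.mul_rpow ha.le (norm_nonneg k)]
  push_cast
  rw [h2]
  ring

theorem integral_comp_dilation {F : Type*} [NormedAddCommGroup F] [NormedSpace ℝ F] {a : ℝ}
    (ha : 0 < a) (f : R3 → F) : ∫ k, f (a • k) = (a ^ 3)⁻¹ • ∫ k, f k := by
  have h := Measure.integral_comp_smul (volume : Measure R3) f a
  rwa [finrank_euclideanSpace, Fintype.card_fin, abs_of_nonneg (by positivity)] at h

/-! ### The infrared limit of the charge forms -/

section Infrared

variable {h : R3 → ℝ} {R : ℝ}

theorem memLp_omegaPow_neg_half {U : Set R3} (hh : h ∈ testFunctions U) :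
    MemLp (fun k => omegaPow (-1 / 2) k * fourierHat h k) 2 volume :=
  (isIRBounded_omegaPow_neg_half hh).memLp
    (measurable_omegaPow_mul_fourierHat _ hh).aestronglyMeasurable

/-- The one-particle vector `ω^{-1/2} ĥ`. -/
def fieldVec {U : Set R3} (hh : h ∈ testFunctions U) : OneParticle :=
  (memLp_omegaPow_neg_half hh).toLp _

theorem coeFn_fieldVec {U : Set R3} (hh : h ∈ testFunctions U) :
    fieldVec hh =ᵐ[volume] fun k => omegaPow (-1 / 2) k * fourierHat h k := MemLp.coeFn_toLp _

theorem fieldVec_mem_observableSpace (hR : 0 < R) (hh : h ∈ testFunctions (Metric.ball 0 R)) :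
    fieldVec hh ∈ observableSpace := by
  refine ⟨doubleCone (0 - R, 0) (0 + R, 0), ⟨_, _, ?_, rfl⟩, Submodule.subset_span ?_⟩
  · simp only [forwardCone, Set.mem_ofPred_eq, Prod.mk_sub_mk, sub_self, norm_zero]
    linarith
  · refine ⟨0, 0, R, hR, subset_rfl, h, hh, 0, ?_, ?_⟩
    · exact ⟨contDiff_const, HasCompactSupport.zero, by simp [tsupport]⟩
    · filter_upwards [coeFn_fieldVec hh] with k hk
      have h0 : fourierHat 0 k = 0 := by simp [fourierHat]
      rw [hk, h0, mul_zero, mul_zero, add_zero, Complex.ofReal_zero, mul_zero, Complex.exp_zero,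
        one_mul]

theorem conjugation_fieldVec {U : Set R3} (hh : h ∈ testFunctions U) :
    conjugation (fieldVec hh) = fieldVec hh := by
  refine (conjugation_toLp _ (c := 1) fun k => ?_).trans (one_smul _ _)
  simp only [fourierHat_neg, map_mul, omegaPow_neg, conj_omegaPow, Complex.conj_conj, one_mul]

/-- The dilated vectors all have the same norm. -/
theorem norm_fieldVec_dilate (hh : h ∈ testFunctions (Metric.ball 0 R)) (s : ℝ) {a : ℝ}
    (ha : 0 < a) :
    ‖fieldVec (dilate_mem_testFunctions s ha hh)‖ = |s| * ‖fieldVec hh‖ := by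
  refine (pow_left_inj₀ (norm_nonneg _) (by positivity) two_ne_zero).1 ?_
  rw [mul_pow, sq_abs, norm_sq_eq_integral, norm_sq_eq_integral]
  let G : R3 → ℂ := fun k => omegaPow (-1 / 2) k * fourierHat h k
  have h3 : (a ^ (3 / 2 : ℝ)) ^ 2 = a ^ 3 := by
    rw [← Real.rpow_natCast, ← Real.rpow_mul ha.le, ← Real.rpow_natCast]; norm_num
  calc ∫ k, ‖fieldVec (dilate_mem_testFunctions s ha hh) k‖ ^ 2
      = ∫ k, (s ^ 2 * a ^ 3) * ‖G (a • k)‖ ^ 2 := by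
        refine integral_congr_ae ?_
        filter_upwards [coeFn_fieldVec (dilate_mem_testFunctions s ha hh)] with k hk
        rw [hk, omegaPow_mul_fourierHat_dilate h s ha, norm_mul, mul_pow, Complex.norm_real,
          Real.norm_eq_abs, sq_abs, mul_pow, h3]
    _ = s ^ 2 * ∫ k, ‖G k‖ ^ 2 := by
        rw [integral_const_mul, integral_comp_dilation ha fun k => ‖G k‖ ^ 2, smul_eq_mul]
        field_simp
    _ = _ := by
        congr 1
        refine integral_congr_ae ?_
        filter_upwards [coeFn_fieldVec hh] with k hk
        rw [hk]

theorem integral_mul_fieldVec_dilate (hh : h ∈ testFunctions (Metric.ball 0 R)) (s : ℝ) {a : ℝ}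
    (ha : 0 < a) (A : R3 → ℂ) :
    ∫ k, A k * fieldVec (dilate_mem_testFunctions s ha hh) k =
      ∫ k, (s * a ^ (-3 / 2 : ℝ) : ℝ) * A (a⁻¹ • k) *
        (omegaPow (-1 / 2) k * fourierHat h k) := by
  let G : R3 → ℂ := fun k => omegaPow (-1 / 2) k * fourierHat h k
  have h1 : ∫ k, A k * fieldVec (dilate_mem_testFunctions s ha hh) k =
      ∫ k, (fun y => A (a⁻¹ • y) * ((s * a ^ (3 / 2 : ℝ) : ℝ) * G y)) (a • k) := by
    refine integral_congr_ae ?_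
    filter_upwards [coeFn_fieldVec (dilate_mem_testFunctions s ha hh)] with k hk
    rw [hk, omegaPow_mul_fourierHat_dilate h s ha, inv_smul_smul₀ ha.ne']
  have h2 : (a ^ 3)⁻¹ * a ^ (3 / 2 : ℝ) = a ^ (-3 / 2 : ℝ) := by
    rw [← Real.rpow_natCast, ← Real.rpow_neg ha.le, ← Real.rpow_add ha]; norm_num
  rw [h1, integral_comp_dilation ha fun y => A (a⁻¹ • y) * ((s * a ^ (3 / 2 : ℝ) : ℝ) * G y),
    ← integral_smul]
  refine integral_congr_ae (Filter.Eventually.of_forall fun k => ?_)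
  simp only [← h2, Complex.real_smul, G]
  push_cast
  ring

/-- The dilated vectors tend weakly to zero: their integrals against a bounded function are of order
`a^{-3/2}`. -/
theorem tendsto_inner_fieldVec_dilate (hh : h ∈ testFunctions (Metric.ball 0 R)) (s : ℝ)
    {a : ℕ → ℝ} (ha : ∀ n, 0 < a n) (hlim : Filter.Tendsto a Filter.atTop Filter.atTop)
    (u : OneParticle) :
    Filter.Tendsto (fun n => ⟪fieldVec (dilate_mem_testFunctions s (ha n) hh), u⟫_ℂ)
      Filter.atTop (𝓝 0) := by
  let G : R3 → ℂ := fun k => omegaPow (-1 / 2) k * fourierHat h k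
  have hG : Integrable G := (isIRBounded_omegaPow_neg_half hh).integrable
    (measurable_omegaPow_mul_fourierHat _ hh).aestronglyMeasurable
  revert u
  refine tendsto_zero_of_dense (C := |s| * ‖fieldVec hh‖)
    (SchwartzMap.denseRange_toLpCLM (E := R3) (F := ℂ) (p := 2) (μ := (volume : Measure R3))
      ENNReal.ofNat_ne_top) (fun n x y => ?_) ?_
  · rw [← inner_sub_right, ← norm_fieldVec_dilate hh s (ha n)]
    exact norm_inner_le_norm _ _
  · rintro _ ⟨F, rfl⟩
    obtain ⟨M, hM⟩ : ∃ M, ∀ x, ‖F x‖ ≤ M := by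
      obtain ⟨M, -, hM⟩ := F.decay 0 0
      exact ⟨M, fun x => by simpa using hM x⟩
    have hbound : ∀ n, ‖⟪fieldVec (dilate_mem_testFunctions s (ha n) hh),
        SchwartzMap.toLpCLM ℝ ℂ 2 volume F⟫_ℂ‖ ≤ |s| * M * (∫ k, ‖G k‖) * a n ^ (-3 / 2 : ℝ) := by
      intro n
      have h1 : ⟪SchwartzMap.toLpCLM ℝ ℂ 2 volume F,
          fieldVec (dilate_mem_testFunctions s (ha n) hh)⟫_ℂ =
          ∫ k, conj (F k) * fieldVec (dilate_mem_testFunctions s (ha n) hh) k := by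
        rw [L2.inner_def]
        refine integral_congr_ae ?_
        filter_upwards [F.coeFn_toLp 2 (volume : Measure R3)] with k hk
        rw [SchwartzMap.toLpCLM_apply, hk, RCLike.inner_apply, mul_comm]
      rw [norm_inner_symm, h1, integral_mul_fieldVec_dilate hh s (ha n),
        mul_right_comm, ← integral_const_mul]
      refine norm_integral_le_of_norm_le (hG.norm.const_mul _)
        (Filter.Eventually.of_forall fun k => ?_)
      rw [norm_mul, norm_mul, Complex.norm_real, norm_mul, Real.norm_eq_abs,
        Real.norm_of_nonneg (Real.rpow_nonneg (ha n).le _), RCLike.norm_conj]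
      have := hM ((a n)⁻¹ • k)
      have h4 := Real.rpow_nonneg (ha n).le (-3 / 2)
      calc |s| * a n ^ (-3 / 2 : ℝ) * ‖F ((a n)⁻¹ • k)‖ * ‖G k‖
          ≤ |s| * a n ^ (-3 / 2 : ℝ) * M * ‖G k‖ := by gcongr
        _ = _ := by ring
    refine squeeze_zero_norm hbound ?_
    have h2 : Filter.Tendsto (fun n => a n ^ (-3 / 2 : ℝ)) Filter.atTop (𝓝 0) := by
      have := (tendsto_rpow_neg_atTop (y := 3 / 2) (by norm_num)).comp hlim
      refine this.congr fun n => ?_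
      simp only [Function.comp_apply]
      norm_num
    simpa using h2.const_mul (|s| * M * ∫ k, ‖G k‖)

/-- Along the dilated vectors only the total charge `ρ̂(0)` is felt in the limit. -/
theorem tendsto_chargeForm_fieldVec_dilate (hh : h ∈ testFunctions (Metric.ball 0 R)) (s : ℝ)
    {a : ℕ → ℝ} (ha : ∀ n, 1 ≤ a n) (hlim : Filter.Tendsto a Filter.atTop Filter.atTop)
    (ha' : ∀ n, 0 < a n) {σ ρ : R3 → ℝ} (hσ : σ ∈ testFunctions Set.univ)
    (hρ : ρ ∈ testFunctions Set.univ) {c : ℝ}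
    (hc : ∫ k, omegaPow (-3 / 2) k * (omegaPow (-1 / 2) k * fourierHat h k) = c) :
    Filter.Tendsto (fun n => chargeForm (fun k => omegaPow (-1 / 2) k * fourierHat σ k +
        I * omegaPow (-3 / 2) k * fourierHat ρ k)
          (fieldVec (dilate_mem_testFunctions s (ha' n) hh)))
      Filter.atTop (𝓝 (s * (∫ x, ρ x) * c)) := by
  let γ : R3 → ℂ := fun k => omegaPow (-1 / 2) k * fourierHat σ k +
    I * omegaPow (-3 / 2) k * fourierHat ρ k
  let G : R3 → ℂ := fun k => omegaPow (-1 / 2) k * fourierHat h k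
  have hγ : γ ∈ chargeSpace := ⟨σ, hσ, ρ, hρ, rfl⟩
  have hγm := measurable_of_mem_chargeSpace hγ
  have hGm : AEStronglyMeasurable G :=
    (measurable_omegaPow_mul_fourierHat _ hh).aestronglyMeasurable
  obtain ⟨A, B, hA, hB, hbd⟩ := exists_norm_le_of_mem_chargeSpace hγ
  let bound : R3 → ℝ := fun k => A * ‖k‖ ^ (-1 / 2 : ℝ) + B * ‖k‖ ^ (-3 / 2 : ℝ)
  have hbound0 : ∀ k, 0 ≤ bound k := fun k => by positivity
  have hboundm : Measurable bound := by fun_prop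
  have hinv : Filter.Tendsto (fun n => (a n)⁻¹) Filter.atTop (𝓝 0) := hlim.inv_tendsto_atTop
  have hlimI : Filter.Tendsto (fun n => ∫ k, (s * a n ^ (-3 / 2 : ℝ) : ℝ) *
      conj (γ ((a n)⁻¹ • k)) * G k) Filter.atTop
      (𝓝 (∫ k, (s : ℂ) * (-I * omegaPow (-3 / 2) k * conj (fourierHat ρ 0)) * G k)) := by
    refine tendsto_integral_of_dominated_convergence (fun k => |s| * ‖(bound k : ℂ) * G k‖)
      (fun n => ?_) ?_ (fun n => ?_) ?_
    · have : Measurable fun k : R3 => conj (γ ((a n)⁻¹ • k)) :=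
        Complex.continuous_conj.measurable.comp (hγm.comp (measurable_const_smul _))
      exact ((this.const_mul _).aestronglyMeasurable).mul hGm
    · refine ((isIRBounded_omegaPow_neg_half hh).integrable_mul hGm
        (v := fun k => (bound k : ℂ))
        (Complex.measurable_ofReal.comp hboundm).aestronglyMeasurable hA hB fun k => ?_).norm.const_mul _
      rw [Complex.norm_real, Real.norm_of_nonneg (hbound0 k)]
    · filter_upwards [ae_ne_zero] with k hk
      have hk' : 0 < ‖k‖ := norm_pos_iff.2 hk
      have han := ha' n
      rw [norm_mul _ (G k), norm_mul, Complex.norm_real, norm_mul s, Real.norm_eq_abs,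
        Real.norm_of_nonneg (Real.rpow_nonneg han.le _), RCLike.norm_conj,
        norm_mul (bound k : ℂ) (G k), Complex.norm_real, Real.norm_of_nonneg (hbound0 k)]
      have e1 : a n ^ (-3 / 2 : ℝ) * ‖(a n)⁻¹ • k‖ ^ (-1 / 2 : ℝ) ≤ ‖k‖ ^ (-1 / 2 : ℝ) := by
        rw [norm_smul, Real.norm_of_nonneg (by positivity), Real.mul_rpow (by positivity) hk'.le,
          Real.inv_rpow han.le, ← Real.rpow_neg han.le, ← mul_assoc, ← Real.rpow_add han]
        exact mul_le_of_le_one_left (by positivity)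
          (Real.rpow_le_one_of_one_le_of_nonpos (ha n) (by norm_num))
      have e2 : a n ^ (-3 / 2 : ℝ) * ‖(a n)⁻¹ • k‖ ^ (-3 / 2 : ℝ) = ‖k‖ ^ (-3 / 2 : ℝ) := by
        rw [norm_smul, Real.norm_of_nonneg (by positivity), Real.mul_rpow (by positivity) hk'.le,
          Real.inv_rpow han.le, ← Real.rpow_neg han.le, ← mul_assoc, ← Real.rpow_add han]
        norm_num
      have e3 : a n ^ (-3 / 2 : ℝ) * ‖γ ((a n)⁻¹ • k)‖ ≤ bound k := by
        calc a n ^ (-3 / 2 : ℝ) * ‖γ ((a n)⁻¹ • k)‖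
            ≤ a n ^ (-3 / 2 : ℝ) * (A * ‖(a n)⁻¹ • k‖ ^ (-1 / 2 : ℝ) +
                B * ‖(a n)⁻¹ • k‖ ^ (-3 / 2 : ℝ)) := by gcongr; exact hbd _
          _ = A * (a n ^ (-3 / 2 : ℝ) * ‖(a n)⁻¹ • k‖ ^ (-1 / 2 : ℝ)) +
                B * (a n ^ (-3 / 2 : ℝ) * ‖(a n)⁻¹ • k‖ ^ (-3 / 2 : ℝ)) := by ring
          _ ≤ bound k := by
              rw [e2]
              exact add_le_add (mul_le_mul_of_nonneg_left e1 hA) le_rfl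
      calc |s| * a n ^ (-3 / 2 : ℝ) * ‖γ ((a n)⁻¹ • k)‖ * ‖G k‖
          = |s| * (a n ^ (-3 / 2 : ℝ) * ‖γ ((a n)⁻¹ • k)‖) * ‖G k‖ := by ring
        _ ≤ |s| * bound k * ‖G k‖ := by gcongr
        _ = _ := by ring
    · filter_upwards [ae_ne_zero] with k hk
      have hk' : 0 < ‖k‖ := norm_pos_iff.2 hk
      refine Filter.Tendsto.mul_const _ ?_
      have hsc : Filter.Tendsto (fun n => (a n)⁻¹ • k) Filter.atTop (𝓝 0) := by
        simpa using hinv.smul_const k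
      have hhat : ∀ {g : R3 → ℝ}, g ∈ testFunctions Set.univ →
          Filter.Tendsto (fun n => conj (fourierHat g ((a n)⁻¹ • k))) Filter.atTop
            (𝓝 (conj (fourierHat g 0))) := fun hg =>
        ((Complex.continuous_conj.comp (continuous_fourierHat hg)).tendsto 0).comp hsc
      have hterm : ∀ n, ((s * a n ^ (-3 / 2 : ℝ) : ℝ) : ℂ) * conj (γ ((a n)⁻¹ • k)) =
          s * ((((a n)⁻¹ : ℝ) : ℂ) * omegaPow (-1 / 2) k * conj (fourierHat σ ((a n)⁻¹ • k)) +
            -I * omegaPow (-3 / 2) k * conj (fourierHat ρ ((a n)⁻¹ • k))) := by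
        intro n
        have han := ha' n
        have e1 : a n ^ (-3 / 2 : ℝ) * ‖(a n)⁻¹ • k‖ ^ (-1 / 2 : ℝ) =
            (a n)⁻¹ * ‖k‖ ^ (-1 / 2 : ℝ) := by
          rw [norm_smul, Real.norm_of_nonneg (by positivity), Real.mul_rpow (by positivity) hk'.le,
            Real.inv_rpow han.le, ← Real.rpow_neg han.le, ← mul_assoc, ← Real.rpow_add han,
            ← Real.rpow_neg_one (a n)]
          norm_num
        have e2 : a n ^ (-3 / 2 : ℝ) * ‖(a n)⁻¹ • k‖ ^ (-3 / 2 : ℝ) = ‖k‖ ^ (-3 / 2 : ℝ) := by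
          rw [norm_smul, Real.norm_of_nonneg (by positivity), Real.mul_rpow (by positivity) hk'.le,
            Real.inv_rpow han.le, ← Real.rpow_neg han.le, ← mul_assoc, ← Real.rpow_add han]
          norm_num
        have e1' : ((a n ^ (-3 / 2 : ℝ) : ℝ) : ℂ) * omegaPow (-1 / 2) ((a n)⁻¹ • k) =
            (((a n)⁻¹ : ℝ) : ℂ) * omegaPow (-1 / 2) k := by
          rw [omegaPow, omegaPow, ← Complex.ofReal_mul, e1, Complex.ofReal_mul]
        have e2' : ((a n ^ (-3 / 2 : ℝ) : ℝ) : ℂ) * omegaPow (-3 / 2) ((a n)⁻¹ • k) =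
            omegaPow (-3 / 2) k := by
          rw [omegaPow, omegaPow, ← Complex.ofReal_mul, e2]
        simp only [γ, map_add, map_mul, conj_omegaPow, Complex.conj_I, Complex.ofReal_mul s]
        linear_combination (s : ℂ) * conj (fourierHat σ ((a n)⁻¹ • k)) * e1' -
          (s : ℂ) * I * conj (fourierHat ρ ((a n)⁻¹ • k)) * e2'
      simp only [hterm]
      refine Filter.Tendsto.const_mul _ ?_
      have h1 := (((Complex.continuous_ofReal.tendsto _).comp hinv).mul_const
        (omegaPow (-1 / 2) k)).mul (hhat hσ)
      have h2 := (hhat hρ).const_mul (-I * omegaPow (-3 / 2) k)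
      have h3 := h1.add h2
      rw [Complex.ofReal_zero, zero_mul, zero_mul, zero_add] at h3
      exact h3
  have hval : ∫ k, (s : ℂ) * (-I * omegaPow (-3 / 2) k * conj (fourierHat ρ 0)) * G k =
      -I * ((s * (∫ x, ρ x) * c : ℝ) : ℂ) := by
    rw [fourierHat_zero, Complex.conj_ofReal]
    push_cast
    rw [← hc, ← integral_const_mul, ← integral_const_mul]
    refine integral_congr_ae (Filter.Eventually.of_forall fun k => ?_)
    simp only [G]
    ring
  rw [hval] at hlimI
  have h3 := ((Complex.continuous_im.tendsto _).comp hlimI).neg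
  have h4 : -(-I * ((s * (∫ x, ρ x) * c : ℝ) : ℂ)).im = s * (∫ x, ρ x) * c := by
    rw [neg_mul, Complex.neg_im, neg_neg, Complex.I_mul_im, Complex.ofReal_re]
  rw [h4] at h3
  refine h3.congr fun n => ?_
  rw [chargeForm, integral_mul_fieldVec_dilate hh s (ha' n) fun k => conj (γ k)]
  rfl

theorem exists_pos_integral_eq {U : Set R3} (hh : h ∈ testFunctions U)
    (hpos : ∀ k, ∃ x : ℝ, 0 ≤ x ∧ fourierHat h k = x) (h0 : fourierHat h 0 ≠ 0) :
    ∃ c : ℝ, 0 < c ∧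
      ∫ k, omegaPow (-3 / 2) k * (omegaPow (-1 / 2) k * fourierHat h k) = c := by
  choose x hx0 hx using hpos
  let g : R3 → ℝ := fun k => ‖k‖ ^ (-3 / 2 : ℝ) * (‖k‖ ^ (-1 / 2 : ℝ) * x k)
  have hg : ∀ k, omegaPow (-3 / 2) k * (omegaPow (-1 / 2) k * fourierHat h k) = (g k : ℂ) := by
    intro k
    simp only [g, omegaPow, hx k, Complex.ofReal_mul]
  have hg0 : ∀ k, 0 ≤ g k := fun k =>
    mul_nonneg (by positivity) (mul_nonneg (by positivity) (hx0 k))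
  have hi : Integrable g := by
    have h1 := (isIRBounded_omegaPow_neg_half hh).integrable_mul
      (measurable_omegaPow_mul_fourierHat _ hh).aestronglyMeasurable
      (measurable_omegaPow (-3 / 2)).aestronglyMeasurable (A := 0) (B := 1) le_rfl zero_le_one
      (fun k => by rw [norm_omegaPow]; simp)
    simp only [hg] at h1
    exact h1.re
  refine ⟨∫ k, g k, ?_, by simp only [hg]; exact integral_complex_ofReal⟩
  refine (integral_nonneg hg0).lt_of_ne' fun hzero => h0 ?_
  rw [integral_eq_zero_iff_of_nonneg hg0 hi] at hzero
  have hae : fourierHat h =ᵐ[volume] fun _ => 0 := by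
    filter_upwards [hzero, ae_ne_zero] with k h1 h2
    have hk' : 0 < ‖k‖ := norm_pos_iff.2 h2
    have h3 : x k = 0 := by
      have e1 := Real.rpow_pos_of_pos hk' (-3 / 2)
      have e2 := Real.rpow_pos_of_pos hk' (-1 / 2)
      simpa [g, e1.ne', e2.ne'] using h1
    rw [hx k, h3, Complex.ofReal_zero]
  exact congrFun ((continuous_fourierHat hh).ae_eq_iff_eq volume continuous_const |>.1 hae) 0

/-- If the representation acts as the vacuum representation on the rotation invariant real
observables, then equivalent charges have the same total charge. -/
theorem integral_eq_of_unitarilyEquivalent {π : quasilocalAlgebra →⋆ₐ[ℂ] BFock}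
    (hπ : ∀ (f : OneParticle) (hf : f ∈ observableSpace), conjugation f = f →
      (∃ F : ℝ → ℂ, f =ᵐ[volume] fun k => F ‖k‖) → π (weylObs f hf) = weyl f)
    {σ₁ ρ₁ σ₂ ρ₂ : R3 → ℝ}
    (hσ₁ : σ₁ ∈ testFunctions Set.univ) (hρ₁ : ρ₁ ∈ testFunctions Set.univ)
    (hσ₂ : σ₂ ∈ testFunctions Set.univ) (hρ₂ : ρ₂ ∈ testFunctions Set.univ)
    {α₁ α₂ : quasilocalAlgebra ≃⋆ₐ[ℂ] quasilocalAlgebra}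
    (hα₁ : IsChargeAutomorphism (fun k => omegaPow (-1 / 2) k * fourierHat σ₁ k +
      I * omegaPow (-3 / 2) k * fourierHat ρ₁ k) α₁)
    (hα₂ : IsChargeAutomorphism (fun k => omegaPow (-1 / 2) k * fourierHat σ₂ k +
      I * omegaPow (-3 / 2) k * fourierHat ρ₂ k) α₂)
    (h : UnitarilyEquivalent (π.comp (α₁ : quasilocalAlgebra →⋆ₐ[ℂ] quasilocalAlgebra))
      (π.comp (α₂ : quasilocalAlgebra →⋆ₐ[ℂ] quasilocalAlgebra))) :
    ∫ x, ρ₁ x = ∫ x, ρ₂ x := by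
  obtain ⟨R, η, hR, hη, hrad, hpos, hη0⟩ := exists_radial_testFunction
  obtain ⟨c, hc, hcη⟩ := exists_pos_integral_eq hη hpos hη0
  by_contra hne
  let a : ℕ → ℝ := fun n => n + 1
  have ha : ∀ n, 1 ≤ a n := fun n => by simp [a]
  have ha' : ∀ n, 0 < a n := fun n => by positivity
  have hlim : Filter.Tendsto a Filter.atTop Filter.atTop :=
    Filter.tendsto_atTop_add_const_right _ _ tendsto_natCast_atTop_atTop
  -- With this amplitude the limiting phase is `exp (iπ) = -1`.
  let s : ℝ := Real.pi / (((∫ x, ρ₂ x) - ∫ x, ρ₁ x) * c)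
  let f : ℕ → OneParticle := fun n => fieldVec (dilate_mem_testFunctions s (ha' n) hη)
  have hobs : ∀ n, f n ∈ observableSpace := fun n =>
    fieldVec_mem_observableSpace (mul_pos (ha' n) hR) _
  have hradial : ∀ n, ∃ F : ℝ → ℂ, f n =ᵐ[volume] fun k => F ‖k‖ := by
    intro n
    refine ⟨fun r => ((r ^ (-1 / 2 : ℝ) : ℝ) : ℂ) *
      fourierHat (dilate s (a n) η) (EuclideanSpace.single 0 r), ?_⟩
    filter_upwards [coeFn_fieldVec (dilate_mem_testFunctions s (ha' n) hη)] with k hk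
    rw [hk, omegaPow, fourierHat_dilate η s (ha' n), fourierHat_dilate η s (ha' n),
      hrad (a n • k) (a n • EuclideanSpace.single 0 ‖k‖) (by simp [norm_smul])]
  have hone := exp_eq_one_of_unitarilyEquivalent hα₁ hα₂ h hobs
    (fun n => hπ _ _ (conjugation_fieldVec _) (hradial n))
    (fun n => norm_fieldVec_dilate hη s (ha' n))
    (tendsto_inner_fieldVec_dilate hη s ha' hlim)
    (tendsto_chargeForm_fieldVec_dilate hη s ha hlim ha' hσ₁ hρ₁ hcη)
    (tendsto_chargeForm_fieldVec_dilate hη s ha hlim ha' hσ₂ hρ₂ hcη)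
  have hs : s * (∫ x, ρ₂ x) * c - s * (∫ x, ρ₁ x) * c = Real.pi := by
    have h1 : (∫ x, ρ₂ x) - ∫ x, ρ₁ x ≠ 0 := sub_ne_zero.2 (Ne.symm hne)
    simp only [s]
    field_simp
  rw [hs, mul_comm, Complex.exp_pi_mul_I] at hone
  norm_num at hone

end Infrared

/-! ### Equivalence of charged representations -/

theorem isLocallyNormal_vacuumRep : IsLocallyNormal vacuumRep :=
  fun _ _ x y => ⟨x, y, fun _ _ => rfl⟩

end

theorem lemma3p6 (D : InfravacuumData) (hD : D.IsKPRLike)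
    (π : quasilocalAlgebra →⋆ₐ[ℂ] BFock) (hπ : D.IsRepresentation π)
    (γ₁ γ₂ : R3 → ℂ) (hγ₁ : γ₁ ∈ chargeSpace) (hγ₂ : γ₂ ∈ chargeSpace)
    (α₁ α₂ : quasilocalAlgebra ≃⋆ₐ[ℂ] quasilocalAlgebra)
    (hα₁ : IsChargeAutomorphism γ₁ α₁) (hα₂ : IsChargeAutomorphism γ₂ α₂) :
    UnitarilyEquivalent (vacuumRep.comp (α₁ : quasilocalAlgebra →⋆ₐ[ℂ] quasilocalAlgebra))
        (vacuumRep.comp (α₂ : quasilocalAlgebra →⋆ₐ[ℂ] quasilocalAlgebra)) ↔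
      UnitarilyEquivalent (π.comp (α₁ : quasilocalAlgebra →⋆ₐ[ℂ] quasilocalAlgebra))
        (π.comp (α₂ : quasilocalAlgebra →⋆ₐ[ℂ] quasilocalAlgebra)) := by
  obtain ⟨σ₁, hσ₁, ρ₁, hρ₁, rfl⟩ := hγ₁
  obtain ⟨σ₂, hσ₂, ρ₂, hρ₂, rfl⟩ := hγ₂
  constructor
  · intro h
    have hq := integral_eq_of_unitarilyEquivalent (π := vacuumRep) (fun f hf _ _ => rfl)
      hσ₁ hρ₁ hσ₂ hρ₂ hα₁ hα₂ h
    obtain ⟨g₁, g₂, hb₁, hb₂, he, ho, hg⟩ := exists_charge_difference hσ₁ hρ₁ hσ₂ hρ₂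
      (by rw [fourierHat_zero, fourierHat_zero, hq])
    refine unitarilyEquivalent_of_chargeForm hπ.locallyNormal hπ.apply_weyl hα₁ hα₂
      (g := D.T₂ g₁ + D.T₁ g₂) fun f hf => ?_
    rw [D.im_inner_T hb₁ hb₂ he ho (isIRBounded_of_mem_observableSpace hf), hg f hf]
  · intro h
    have hq := integral_eq_of_unitarilyEquivalent (π := π) (fun f hf hc hF => by
        obtain ⟨F, hF⟩ := hF
        rw [hπ.apply_weyl, D.T_eq_self hc fun i => hD.Q_apply_radial hF i])
      hσ₁ hρ₁ hσ₂ hρ₂ hα₁ hα₂ h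
    obtain ⟨g₁, g₂, -, -, -, -, hg⟩ := exists_charge_difference hσ₁ hρ₁ hσ₂ hρ₂
      (by rw [fourierHat_zero, fourierHat_zero, hq])
    exact unitarilyEquivalent_of_chargeForm (S := id) isLocallyNormal_vacuumRep
      (fun f hf => rfl) hα₁ hα₂ hg
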